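/- \textbf{Setting.} Let $m_1\le\dots\le m_n$ be integers with $i\le m_i\le n$, and let $P$ be the natural unit interval order on $[n]=\{1,\dots,n\}$ given by $i<_P j$ iff $m_i<j$. Let $\mathrm{inc}(P)$ be its incomparability graph. For $\mu\in\mathbb{N}^n$, let $P^\mu$ be the graph on the vertices (``blocks'') $v_{a,i}$, $a\in[n]$, $1\le i\le\mu_a$, in which two distinct blocks $v_{a,i},v_{b,j}$ are adjacent iff $a=b$ or $a,b$ are incomparable in $P$. A heap $H$ of $P$ of type $\mu$ is an acyclic orientation of $P^\mu$ such that, for $i<j$, the edge between $v_{a,i}$ and $v_{a,j}$ is directed toward $v_{a,i}$; its connected components are those of $P^\mu$. The rank of a block is one more than the length of a longest directed path from it to a sink. A connected component with all ranks at most $2$, and with $n_1$ blocks of rank $1$ and $n_2$ blocks of rank $2$, is of type W if $n_1=n_2-1$. Let $\mathrm{asc}_P(H)$ be the number of edges directed $v_{b,j}\to v_{a,i}$ with $a>b$. Let $W(H)$ be the set of words obtained by reading the first indices $a$ of the blocks $v_{a,i}$ along the linear extensions of $H$ (where $v$ comes before $w$ whenever $w\to v$), and let $\mathsf{w}_H$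 be the unique word $w\in W(H)$ that has no position $i$ with $w_i>_P w_{i+1}$. In the free associative ring $\mathcal{U}=\mathbb{Z}\langle u_1,\dots,u_n\rangle$ write $u_w=u_{w_1}\cdots u_{w_d}$ for a word $w=w_1\cdots w_d$. Let $\mathcal{I}_P$ be the two-sided ideal generated by $u_au_c-u_cu_a$ for $a<_Pc$, and by $u_au_cu_b-u_bu_au_c$ for $a<b<c$ with $a\not<_Pb$, $b\not<_Pc$, $a<_Pc$. Put $\mathfrak{e}_k(\mathbf{u})=\sum_{i_1>_P\cdots>_P i_k}u_{i_1}\cdots u_{i_k}$ and $\mathfrak{e}_\lambda(\mathbf{u})=\mathfrak{e}_{\lambda_1}(\mathbf{u})\mathfrak{e}_{\lambda_2}(\mathbf{u})\cdots$ for a partition $\lambda_1\ge\lambda_2\ge\cdots$. Put $\mathfrak{m}_\lambda(\mathbf{u})=\sum_\nu N_{\lambda,\nu}\,\mathfrak{e}_\nu(\mathbf{u})$, where the integers $N_{\lambda,\nu}$ are defined by the expansion $m_\lambda(\mathbf{x})=\sum_\nu N_{\lambda,\nu}e_\nu(\mathbf{x})$ of the ordinary monomial symmetric function into elementary symmetric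 functions. Let $X_P(\mathbf{x},q;\mu)=\sum_\kappa q^{\mathrm{asc}(\kappa)}\prod_{i}\prod_{r\in\kappa(i)}x_r$, where $\kappa$ ranges over all maps from $[n]$ to the finite sets of positive integers such that $|\kappa(i)|=\mu_i$ for all $i$ and $\kappa(i)\cap\kappa(j)=\emptyset$ for every edge $\{i,j\}$ of $\mathrm{inc}(P)$, and $\mathrm{asc}(\kappa)$ is the number of pairs $((i,r),(j,s))$ such that $\{i,j\}$ is an edge of $\mathrm{inc}(P)$, $i<j$, $r\in\kappa(i)$, $s\in\kappa(j)$ and $r<s$. \textbf{Theorem.} For all integers $k\ge\ell\ge0$, $$\mathfrak{m}_{(2^\ell,1^{k-\ell})}(\mathbf{u})\equiv\sum_H u_{\mathsf{w}_H}\pmod{\mathcal{I}_P},$$ where $H$ ranges over all heaps of $P$ (of any type) that consist of $k$ blocks of rank $1$ and $\ell$ blocks of rank $2$ and have no connected component of type W. Consequently, for every $\mu\in\mathbb{N}^n$, the function $X_P(\mathbf{x},q;\mu)$ has an expansion $X_P(\mathbf{x},q;\mu)=\sum_\lambda c_\lambda(q)e_\lambda(\mathbf{x})$ (a finite sum, with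 $c_\lambda(q)\in\mathbb{Q}[q]$), and in every such expansion, for all $k\ge\ell\ge0$, $$c_{(2^\ell,1^{k-\ell})}(q)=\sum_H q^{\mathrm{asc}_P(H)},$$ where $H$ ranges over the heaps of $P$ of type $\mu$ that consist of $k$ blocks of rank $1$ and $\ell$ blocks of rank $2$ and have no connected component of type W. -/

import Mathlib

/-! Symmetric functions -/


open Classical in
/-- The elementary symmetric function `e_k` in countably many commuting variables (indexed by `ℕ`
instead of the positive integers), as the power series in which a monomial has coefficient `1` if it
is a product of `k` distinct variables, and `0` otherwise. -/
noncomputable def elemSym (R : Type*) [CommRing R] (k : ℕ) : MvPowerSeries ℕ R :=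
  fun α => if (∀ i, α i ≤ 1) ∧ α.degree = k then 1 else 0

/-- `e_λ = e_{λ_1} e_{λ_2} ⋯`. -/
noncomputable def elemSymPart (R : Type*) [CommRing R] {d : ℕ} (lam : Nat.Partition d) :
    MvPowerSeries ℕ R :=
  (lam.parts.map (elemSym R)).prod

open Classical in
/-- The monomial symmetric function `m_λ`: the sum of the monomials `x^α` over the distinct
rearrangements `α` of `λ`, that is, over the exponents whose multiset of nonzero values is the
multiset of parts of `λ`. -/
noncomputable def monomialSym (R : Type*) [CommRing R] {d : ℕ} (lam : Nat.Partition d) :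
    MvPowerSeries ℕ R :=
  fun α => if α.support.val.map α = lam.parts then 1 else 0

namespace SymAux

open MvPolynomial

theorem coeff_esymm_fin {r : ℕ} (k : ℕ) (β : Fin r →₀ ℕ) :
    coeff β (esymm (Fin r) ℤ k) = if (∀ i, β i ≤ 1) ∧ β.degree = k then 1 else 0 := by
  classical
  rw [esymm_eq_sum_monomial, coeff_sum]
  simp only [coeff_monomial]
  split_ifs with h
  · rw [Finset.sum_eq_single β.support]
    · rw [if_pos]
      ext i
      have := h.1 i
      by_cases hi : β i = 0
      · simp [Finsupp.finsetSum_apply, Finsupp.single_apply, hi]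
      · simp [Finsupp.finsetSum_apply, Finsupp.single_apply, hi]
        omega
    · intro t _ ht
      rw [if_neg]
      rintro rfl
      apply ht
      ext i
      simp [Finsupp.finsetSum_apply, Finsupp.single_apply]
    · intro hn
      exfalso
      apply hn
      rw [Finset.mem_powersetCard]
      refine ⟨Finset.subset_univ _, ?_⟩
      rw [← h.2, Finsupp.degree_apply, Finset.card_eq_sum_ones]
      refine Finset.sum_congr rfl fun i hi => ?_
      have := h.1 i
      have := Finsupp.mem_support_iff.1 hi
      omega
  · refine Finset.sum_eq_zero fun t ht => ?_
    rw [if_neg]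
    rintro rfl
    apply h
    constructor
    · intro i
      simp only [Finsupp.finsetSum_apply, Finsupp.single_apply]
      rw [Finset.sum_ite_eq']
      split_ifs <;> simp
    · rw [map_sum]
      simp [(Finset.mem_powersetCard.1 ht).2]

theorem degree_embDomain {r : ℕ} (e : Fin r ↪ ℕ) (β : Fin r →₀ ℕ) :
    (Finsupp.embDomain e β).degree = β.degree := by
  rw [Finsupp.degree_apply, Finsupp.degree_apply, Finsupp.support_embDomain, Finset.sum_map]
  simp

open Classical in
theorem coeff_elemSym (k : ℕ) (α : ℕ →₀ ℕ) :
    MvPowerSeries.coeff α (elemSym ℤ k) = if (∀ i, α i ≤ 1) ∧ α.degree = k then 1 else 0 := rfl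

theorem kill_elemSym {r : ℕ} (e : Fin r ↪ ℕ) (k : ℕ) :
    MvPowerSeries.killCompl e (elemSym ℤ k) = (esymm (Fin r) ℤ k : MvPowerSeries (Fin r) ℤ) := by
  ext β
  rw [MvPowerSeries.coeff_killCompl, coeff_coe, coeff_esymm_fin]
  classical
  rw [coeff_elemSym]
  refine if_congr ?_ rfl rfl
  rw [degree_embDomain]
  refine and_congr_left fun _ => ⟨fun h i => ?_, fun h i => ?_⟩
  · have := h (e i)
    rwa [Finsupp.embDomain_apply_self] at this
  · by_cases hi : i ∈ Set.range e
    · obtain ⟨j, rfl⟩ := hi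
      rw [Finsupp.embDomain_apply_self]
      exact h j
    · rw [Finsupp.embDomain_of_notMem_range _ _ _ hi]
      simp

theorem kill_elemSymPart {r d : ℕ} (e : Fin r ↪ ℕ) (lam : Nat.Partition d) :
    MvPowerSeries.killCompl e (elemSymPart ℤ lam) =
      (esymmPart (Fin r) ℤ lam : MvPowerSeries (Fin r) ℤ) := by
  rw [elemSymPart, esymmPart, map_multiset_prod, Multiset.map_map]
  have : ((lam.parts.map (esymm (Fin r) ℤ)).prod : MvPowerSeries (Fin r) ℤ) =
      ((lam.parts.map (esymm (Fin r) ℤ)).map (coeToMvPowerSeries.ringHom)).prod := by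
    rw [← map_multiset_prod]
    rfl
  rw [this, Multiset.map_map]
  congr 1
  refine Multiset.map_congr rfl fun k _ => ?_
  exact kill_elemSym e k

theorem coeff_kill_monomialSym {r d : ℕ} (e : Fin r ↪ ℕ) (lam : Nat.Partition d)
    (β : Fin r →₀ ℕ) :
    monomialSym ℤ lam (Finsupp.embDomain e β) =
      if β.support.val.map β = lam.parts then 1 else 0 := by
  classical
  change (if _ then _ else _) = _
  rw [Finsupp.support_embDomain, Finset.map_val, Multiset.map_map]
  congr 3
  ext i
  simp

theorem degree_of_shape {σ : Type*} {d : ℕ} (lam : Nat.Partition d) (β : σ →₀ ℕ)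
    (h : β.support.val.map β = lam.parts) : β.degree = d := by
  rw [← lam.parts_sum, ← h]
  rfl

theorem finite_shape {d : ℕ} (lam : Nat.Partition d) :
    {β : Fin d →₀ ℕ | β.support.val.map β = lam.parts}.Finite := by
  have : Set.Finite {β : Fin d →₀ ℕ | β ≤ Finsupp.equivFunOnFinite.symm (fun _ => d)} :=
    Set.finite_Iic _
  refine this.subset fun β hβ i => ?_
  have := degree_of_shape lam β hβ
  simp only [Finsupp.equivFunOnFinite_symm_apply_apply]
  exact (Finsupp.le_degree i β).trans this.le

open Classical in
noncomputable def finMono {d : ℕ} (lam : Nat.Partition d) : MvPolynomial (Fin d) ℤ :=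
  ∑ β ∈ (finite_shape lam).toFinset, monomial β 1

theorem coeff_finMono {d : ℕ} (lam : Nat.Partition d) (β : Fin d →₀ ℕ) :
    coeff β (finMono lam) = if β.support.val.map β = lam.parts then 1 else 0 := by
  classical
  rw [finMono, coeff_sum]
  simp [coeff_monomial]

theorem finMono_symm {d : ℕ} (lam : Nat.Partition d) : (finMono lam).IsSymmetric := by
  intro e
  ext β
  obtain ⟨γ, rfl⟩ : ∃ γ, β = Finsupp.embDomain e.toEmbedding γ := by
    refine ⟨Finsupp.embDomain e.symm.toEmbedding β, ?_⟩
    ext i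
    have h1 := Finsupp.embDomain_apply_self e.symm.toEmbedding β i
    have h2 := Finsupp.embDomain_apply_self e.toEmbedding
      (Finsupp.embDomain e.symm.toEmbedding β) (e.symm i)
    simp only [Equiv.coe_toEmbedding, Equiv.apply_symm_apply] at h1 h2
    rw [h2, h1]
  have h0 : Finsupp.embDomain e.toEmbedding γ = Finsupp.mapDomain e γ :=
    Finsupp.embDomain_eq_mapDomain _ _
  have h1 : coeff (Finsupp.embDomain e.toEmbedding γ) (rename e (finMono lam)) =
      coeff γ (finMono lam) := by
    rw [h0]
    exact coeff_rename_mapDomain e e.injective _ _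
  rw [h1, coeff_finMono, coeff_finMono, Finsupp.support_embDomain, Finset.map_val,
    Multiset.map_map]
  refine if_congr ?_ rfl rfl
  have h2 : (Finsupp.embDomain e.toEmbedding γ) ∘ e.toEmbedding = γ :=
    funext fun i => Finsupp.embDomain_apply_self e.toEmbedding γ i
  rw [h2]

theorem esymm_hom {r : ℕ} (k : ℕ) : (esymm (Fin r) ℤ k).IsHomogeneous k := by
  intro β hβ
  rw [coeff_esymm_fin] at hβ
  split_ifs at hβ with h
  · rw [← h.2, Finsupp.degree_eq_weight_one]
    rfl
  · simp at hβ

theorem esymmPart_hom {r d : ℕ} (lam : Nat.Partition d) :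
    (esymmPart (Fin r) ℤ lam).IsHomogeneous d := by
  have key : ∀ s : Multiset ℕ, ((s.map (esymm (Fin r) ℤ)).prod).IsHomogeneous s.sum := by
    intro s
    induction s using Multiset.induction with
    | empty => simpa using isHomogeneous_one (Fin r) ℤ
    | cons a s ih =>
      rw [Multiset.map_cons, Multiset.prod_cons, Multiset.sum_cons]
      exact (esymm_hom a).mul ih
  have h := key lam.parts
  rwa [lam.parts_sum] at h

/-- Multiplicities of a partition of `d`. -/
noncomputable def mult {d : ℕ} (lam : Nat.Partition d) : Fin d →₀ ℕ :=
  Finsupp.equivFunOnFinite.symm fun i => lam.parts.count (i.1 + 1)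

theorem mult_apply {d : ℕ} (lam : Nat.Partition d) (i : Fin d) :
    mult lam i = lam.parts.count (i.1 + 1) := rfl

theorem mult_injective {d : ℕ} : Function.Injective (mult (d := d)) := by
  intro a b h
  ext k
  rcases Nat.eq_zero_or_pos k with rfl | hk
  · rw [Multiset.count_eq_zero_of_notMem, Multiset.count_eq_zero_of_notMem]
    · intro h0; exact lt_irrefl _ (b.parts_pos h0)
    · intro h0; exact lt_irrefl _ (a.parts_pos h0)
  · by_cases hkd : k ≤ d
    · have := DFunLike.congr_fun h (⟨k - 1, by omega⟩ : Fin d)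
      rw [mult_apply, mult_apply] at this
      simpa [Nat.sub_add_cancel hk] using this
    · rw [Multiset.count_eq_zero_of_notMem, Multiset.count_eq_zero_of_notMem]
      · intro h0; exact hkd (Nat.Partition.le_of_mem_parts h0)
      · intro h0; exact hkd (Nat.Partition.le_of_mem_parts h0)

theorem exists_mult {d : ℕ} (s : Fin d →₀ ℕ) (h : ∑ i, (i.1 + 1) * s i = d) :
    ∃ lam : Nat.Partition d, mult lam = s := by
  classical
  refine ⟨⟨∑ i, s i • ({i.1 + 1} : Multiset ℕ), ?_, ?_⟩, ?_⟩
  · intro k hk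
    rw [Multiset.mem_sum] at hk
    obtain ⟨i, _, hi⟩ := hk
    have := Multiset.mem_of_mem_nsmul hi
    rw [Multiset.mem_singleton] at this
    omega
  · rw [Multiset.sum_sum]
    conv_rhs => rw [← h]
    refine Finset.sum_congr rfl fun i _ => ?_
    rw [Multiset.sum_nsmul]
    simp [mul_comm]
  · ext i
    rw [mult_apply]
    simp only
    rw [Multiset.count_sum']
    simp only [Multiset.count_nsmul, Multiset.count_singleton]
    rw [Finset.sum_eq_single i]
    · simp
    · intro j _ hj
      rw [if_neg]
      · simp
      · intro h'; apply hj; ext; omega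
    · simp

theorem esymmPart_eq {d : ℕ} (lam : Nat.Partition d) :
    esymmPart (Fin d) ℤ lam = ∏ i : Fin d, esymm (Fin d) ℤ (i.1 + 1) ^ mult lam i := by
  classical
  rw [esymmPart, Finset.prod_multiset_map_count]
  have hsub : lam.parts.toFinset ⊆ (Finset.univ : Finset (Fin d)).map
      ⟨fun i => i.1 + 1, fun i j h => by ext; simpa using h⟩ := by
    intro k hk
    rw [Multiset.mem_toFinset] at hk
    have h1 := lam.parts_pos hk
    have h2 := Nat.Partition.le_of_mem_parts hk
    rw [Finset.mem_map]
    exact ⟨⟨k - 1, by omega⟩, Finset.mem_univ _, Nat.sub_add_cancel h1⟩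
  rw [Finset.prod_subset hsub, Finset.prod_map]
  · rfl
  · intro k _ hk
    rw [Multiset.mem_toFinset] at hk
    rw [Multiset.count_eq_zero_of_notMem hk, pow_zero]

theorem esymmPart_aeval {d : ℕ} (lam : Nat.Partition d) :
    esymmPart (Fin d) ℤ lam =
      aeval (fun i : Fin d => esymm (Fin d) ℤ (i.1 + 1)) (monomial (mult lam) (1 : ℤ)) := by
  rw [aeval_monomial, esymmPart_eq, map_one, one_mul, Finsupp.prod_fintype _ _ (by simp)]

theorem fin_expansion {d : ℕ} (lam : Nat.Partition d) :
    ∃ N : Nat.Partition d → ℤ, finMono lam = ∑ μ, N μ • esymmPart (Fin d) ℤ μ := by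
  classical
  obtain ⟨p, hp⟩ := esymmAlgHom_surjective (σ := Fin d) (R := ℤ) (n := d) (by simp)
    ⟨finMono lam, finMono_symm lam⟩
  have hp' : aeval (fun i : Fin d => esymm (Fin d) ℤ (i.1 + 1)) p = finMono lam := by
    rw [← esymmAlgHom_apply, hp]
  refine ⟨fun μ => coeff (mult μ) p, ?_⟩
  ext β
  by_cases hβ : β.degree = d
  · rw [← hp', coeff_sum]
    conv_lhs => rw [p.as_sum, map_sum, coeff_sum]
    have hT : ∀ s : Fin d →₀ ℕ, coeff β (aeval (fun i : Fin d => esymm (Fin d) ℤ (i.1 + 1))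
        (monomial s (coeff s p))) =
        coeff s p * coeff β (∏ i : Fin d, esymm (Fin d) ℤ (i.1 + 1) ^ s i) := by
      intro s
      rw [aeval_monomial, Finsupp.prod_fintype _ _ (by simp), algebraMap_eq, coeff_C_mul]
    simp only [hT]
    have hwt : ∀ s : Fin d →₀ ℕ, (∀ μ : Nat.Partition d, mult μ ≠ s) →
        coeff β (∏ i : Fin d, esymm (Fin d) ℤ (i.1 + 1) ^ s i) = 0 := by
      intro s hs
      have h1 : (∏ i : Fin d, esymm (Fin d) ℤ (i.1 + 1) ^ s i).IsHomogeneous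
          (∑ i : Fin d, (i.1 + 1) * s i) :=
        IsHomogeneous.prod _ _ _ fun i _ => (esymm_hom _).pow _
      apply h1.coeff_eq_zero
      intro h2
      obtain ⟨μ, hμ⟩ := exists_mult s (by rw [← h2, hβ])
      exact hs μ hμ
    have hR : ∀ μ : Nat.Partition d, coeff β (coeff (mult μ) p • esymmPart (Fin d) ℤ μ) =
        coeff (mult μ) p * coeff β (∏ i : Fin d, esymm (Fin d) ℤ (i.1 + 1) ^ mult μ i) := by
      intro μ
      rw [coeff_smul, esymmPart_eq, smul_eq_mul]
    simp only [hR]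
    refine Eq.trans ?_ (Finset.sum_map Finset.univ ⟨mult, mult_injective⟩
      (fun s => coeff s p * coeff β (∏ i : Fin d, esymm (Fin d) ℤ (i.1 + 1) ^ s i)))
    have e1 : ∑ s ∈ p.support, coeff s p *
          coeff β (∏ i : Fin d, esymm (Fin d) ℤ (i.1 + 1) ^ s i) =
        ∑ s ∈ p.support ∪ Finset.univ.map ⟨mult, mult_injective⟩, coeff s p *
          coeff β (∏ i : Fin d, esymm (Fin d) ℤ (i.1 + 1) ^ s i) := by
      refine Finset.sum_subset Finset.subset_union_left fun s _ hs => ?_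
      rw [notMem_support_iff.1 hs, zero_mul]
    rw [e1]
    symm
    refine Finset.sum_subset Finset.subset_union_right fun s _ hs => ?_
    rw [hwt s, mul_zero]
    intro μ hμ
    apply hs
    rw [Finset.mem_map]
    exact ⟨μ, Finset.mem_univ _, hμ⟩
  · rw [coeff_finMono, if_neg (fun h => hβ (degree_of_shape lam β h)), coeff_sum]
    symm
    refine Finset.sum_eq_zero fun μ _ => ?_
    rw [coeff_smul, (esymmPart_hom μ).coeff_eq_zero hβ, smul_zero]

theorem exists_emb {r : ℕ} (α : ℕ →₀ ℕ) (h : α.support.card ≤ r) :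
    ∃ (e : Fin r ↪ ℕ) (β : Fin r →₀ ℕ), Finsupp.embDomain e β = α := by
  classical
  obtain ⟨t, hst, ht⟩ := Infinite.exists_superset_card_eq α.support r h
  let e : Fin r ↪ ℕ := (t.orderEmbOfFin ht).toEmbedding
  refine ⟨e, α.comapDomain e e.injective.injOn, ?_⟩
  rw [Finsupp.embDomain_eq_mapDomain, Finsupp.mapDomain_comapDomain _ e.injective]
  intro i hi
  have : i ∈ Set.range (t.orderEmbOfFin ht) := by
    rw [Finset.range_orderEmbOfFin]
    exact hst hi
  exact this

theorem card_le_degree (α : ℕ →₀ ℕ) : α.support.card ≤ α.degree := by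
  rw [Finsupp.degree_apply, Finset.card_eq_sum_ones]
  exact Finset.sum_le_sum fun i hi => Nat.one_le_iff_ne_zero.2 (Finsupp.mem_support_iff.1 hi)

theorem sum_elemSymPart_kill {r d : ℕ} (e : Fin r ↪ ℕ) (N : Nat.Partition d → ℤ)
    (β : Fin r →₀ ℕ) :
    MvPowerSeries.coeff (Finsupp.embDomain e β) (∑ μ, N μ • elemSymPart ℤ μ) =
      coeff β (∑ μ, N μ • esymmPart (Fin r) ℤ μ) := by
  rw [map_sum, coeff_sum]
  refine Finset.sum_congr rfl fun μ _ => ?_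
  rw [map_zsmul, coeff_smul, ← MvPowerSeries.coeff_killCompl, kill_elemSymPart, coeff_coe]

end SymAux

/-- `m_λ` is, in exactly one way, an integral combination of the `e_ν` with `ν ⊢ |λ|`. -/
theorem existsUnique_monomialToElem {d : ℕ} (lam : Nat.Partition d) :
    ∃! N : Nat.Partition d → ℤ, monomialSym ℤ lam = ∑ μ, N μ • elemSymPart ℤ μ := by
  classical
  obtain ⟨N, hN⟩ := SymAux.fin_expansion lam
  refine ⟨N, ?_, ?_⟩
  · ext α
    by_cases hα : α.degree = d
    · obtain ⟨e, β, rfl⟩ := SymAux.exists_emb (r := d) α (hα ▸ SymAux.card_le_degree α)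
      rw [SymAux.sum_elemSymPart_kill, ← hN, SymAux.coeff_finMono]
      exact SymAux.coeff_kill_monomialSym e lam β
    · obtain ⟨r, hr⟩ : ∃ r, α.support.card ≤ r := ⟨_, le_rfl⟩
      obtain ⟨e, β, rfl⟩ := SymAux.exists_emb α hr
      rw [SymAux.sum_elemSymPart_kill]
      rw [SymAux.degree_embDomain] at hα
      have h1 : MvPowerSeries.coeff (Finsupp.embDomain e β) (monomialSym ℤ lam) = 0 := by
        refine (SymAux.coeff_kill_monomialSym e lam β).trans (if_neg fun h => hα ?_)
        exact SymAux.degree_of_shape lam β h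
      rw [h1, MvPolynomial.coeff_sum]
      symm
      refine Finset.sum_eq_zero fun μ _ => ?_
      rw [MvPolynomial.coeff_smul, (SymAux.esymmPart_hom μ).coeff_eq_zero hα, smul_zero]
  · intro N' hN'
    have h1 : ∑ μ, N' μ • MvPolynomial.esymmPart (Fin d) ℤ μ =
        ∑ μ, N μ • MvPolynomial.esymmPart (Fin d) ℤ μ := by
      ext β
      rw [← SymAux.sum_elemSymPart_kill Fin.valEmbedding, ← hN, SymAux.coeff_finMono, ← hN']
      exact SymAux.coeff_kill_monomialSym _ lam β
    have h2 : ∀ M : Nat.Partition d → ℤ, ∑ μ, M μ • MvPolynomial.esymmPart (Fin d) ℤ μ =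
        (MvPolynomial.esymmAlgHom (Fin d) ℤ d
          (∑ μ, M μ • MvPolynomial.monomial (SymAux.mult μ) (1 : ℤ))).val := by
      intro M
      rw [MvPolynomial.esymmAlgHom_apply, map_sum]
      refine Finset.sum_congr rfl fun μ _ => ?_
      rw [map_zsmul, SymAux.esymmPart_aeval]
    rw [h2, h2] at h1
    have h3 := MvPolynomial.esymmAlgHom_injective (σ := Fin d) ℤ (n := d) (by simp)
      (Subtype.ext h1)
    funext ν
    have h4 : ∀ M : Nat.Partition d → ℤ, MvPolynomial.coeff (SymAux.mult ν)
        (∑ μ, M μ • MvPolynomial.monomial (SymAux.mult μ) (1 : ℤ)) = M ν := by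
      intro M
      rw [MvPolynomial.coeff_sum, Finset.sum_eq_single ν]
      · rw [MvPolynomial.coeff_smul, MvPolynomial.coeff_monomial, if_pos rfl, smul_eq_mul, mul_one]
      · intro μ _ hμ
        rw [MvPolynomial.coeff_smul, MvPolynomial.coeff_monomial,
          if_neg (fun h => hμ (SymAux.mult_injective h)), smul_zero]
      · simp
    rw [← h4 N', h3, h4]

/-- The transition coefficients `N_{λ,ν}` defined by `m_λ(x) = ∑_ν N_{λ,ν} e_ν(x)`. -/
noncomputable def monomialToElem {d : ℕ} (lam : Nat.Partition d) : Nat.Partition d → ℤ :=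
  (existsUnique_monomialToElem lam).choose

/-! Natural unit interval orders and heaps -/

/-- A natural unit interval order on `{1, …, n}`, given by a weakly increasing sequence
`m_1 ≤ ⋯ ≤ m_n` with `i ≤ m_i ≤ n`. Everything is shifted to `Fin n = {0, …, n - 1}`. -/
structure NatUnitIntervalOrder (n : ℕ) where
  m : Fin n → Fin n
  mono : Monotone m
  le_m : ∀ i, i ≤ m i

namespace NatUnitIntervalOrder

variable {n : ℕ} (P : NatUnitIntervalOrder n)

/-- `i <_P j` if and only if `m_i < j`. -/
def lt (i j : Fin n) : Prop := P.m i < j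

/-- The incomparability graph of `P`. -/
def inc : SimpleGraph (Fin n) where
  Adj a b := a ≠ b ∧ ¬ P.lt a b ∧ ¬ P.lt b a
  symm := ⟨fun _ _ h => ⟨h.1.symm, h.2.2, h.2.1⟩⟩
  loopless := ⟨fun _ h => h.1 rfl⟩

end NatUnitIntervalOrder

/-- The blocks `v_{a,i}`, `1 ≤ i ≤ μ_a` (with `i` shifted to start at `0`). -/
abbrev Block {n : ℕ} (μ : Fin n → ℕ) : Type := Σ a : Fin n, Fin (μ a)

/-- The graph `P^μ` on the blocks: distinct `v_{a,i}` and `v_{b,j}` are adjacent if `a = b`, or `a`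
and `b` are incomparable in `P`. -/
def NatUnitIntervalOrder.blockGraph {n : ℕ} (P : NatUnitIntervalOrder n) (μ : Fin n → ℕ) : SimpleGraph (Block μ) where
  Adj v w := v ≠ w ∧ (v.1 = w.1 ∨ P.inc.Adj v.1 w.1)
  symm := ⟨fun _ _ h => ⟨h.1.symm, h.2.imp Eq.symm fun h' => h'.symm⟩⟩
  loopless := ⟨fun _ h => h.1 rfl⟩

/-- A heap of `P` of type `μ`: an acyclic orientation of `P^μ` (`arrow v w` means that the edge
`{v, w}` is directed `v → w`) such that the edge between `v_{a,i}` and `v_{a,j}` with `i < j` is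
directed toward `v_{a,i}`. -/
@[ext]
structure Heap {n : ℕ} (P : NatUnitIntervalOrder n) (μ : Fin n → ℕ) where
  arrow : Block μ → Block μ → Prop
  adj_of_arrow : ∀ v w, arrow v w → (P.blockGraph μ).Adj v w
  arrow_or_arrow : ∀ v w, (P.blockGraph μ).Adj v w → arrow v w ∨ arrow w v
  acyclic : ∀ v, ¬ Relation.TransGen arrow v v
  toward : ∀ (a : Fin n) (i j : Fin (μ a)), i < j → arrow ⟨a, j⟩ ⟨a, i⟩

namespace Heap

variable {n : ℕ} {P : NatUnitIntervalOrder n} {μ : Fin n → ℕ} (H : Heap P μ)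

noncomputable instance : Fintype (Heap P μ) :=
  have : Finite (Heap P μ) := Finite.of_injective Heap.arrow fun _ _ h => Heap.ext h
  Fintype.ofFinite _

/-- `f` is a linear extension of the poset on the blocks in which `v ≺ w` whenever `v ← w`. -/
def IsLinearExtension (f : Block μ ≃ Fin (∑ a, μ a)) : Prop :=
  ∀ v w, H.arrow w v → f v < f w

/-- The word listing the letters `a` of the blocks `v_{a,i}` in the order given by `f`. -/
def wordOf (f : Block μ ≃ Fin (∑ a, μ a)) : List (Fin n) :=
  List.ofFn fun k => (f.symm k).1

/-- `W(H)`: the words of the linear extensions of `H`. -/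
def W : Set (List (Fin n)) :=
  {w | ∃ f, H.IsLinearExtension f ∧ w = wordOf f}

end Heap

/-- The word `w` has no `P`-descents: there is no `i` with `w_i >_P w_{i+1}`. -/
def NatUnitIntervalOrder.NoDescents {n : ℕ} (P : NatUnitIntervalOrder n) (w : List (Fin n)) : Prop :=
  w.IsChain fun a b => ¬ P.lt b a

namespace Heap

variable {n : ℕ} {P : NatUnitIntervalOrder n} {μ : Fin n → ℕ} (H : Heap P μ)

theorem exists_strictMono_fin (α : Type) [Fintype α] (r : PartialOrder α) {d : ℕ}
    (hc : Fintype.card α = d) : ∃ f : α ≃ Fin d, ∀ v w, r.le v w → v ≠ w → f v < f w := by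
  let _ : Fintype (LinearExtension α) := inferInstanceAs (Fintype α)
  let g := Fintype.orderIsoFinOfCardEq (LinearExtension α) hc
  refine ⟨g.symm.toEquiv, fun v w hle hne => ?_⟩
  have h1 : (toLinearExtension v : LinearExtension α) ≤ toLinearExtension w :=
    toLinearExtension.monotone hle
  have h2 : (toLinearExtension v : LinearExtension α) < toLinearExtension w :=
    lt_of_le_of_ne h1 hne
  exact g.symm.strictMono h2

theorem exists_linearExtension : ∃ f, H.IsLinearExtension f := by
  classical
  let r : PartialOrder (Block μ) :=
    { le := Relation.ReflTransGen fun v w => H.arrow w v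
      lt := fun a b => Relation.ReflTransGen (fun v w => H.arrow w v) a b ∧
        ¬ Relation.ReflTransGen (fun v w => H.arrow w v) b a
      le_refl := fun _ => Relation.ReflTransGen.refl
      le_trans := fun _ _ _ => Relation.ReflTransGen.trans
      le_antisymm := fun a b hab hba => by
        rcases Relation.reflTransGen_iff_eq_or_transGen.1 hab with h | h
        · exact h.symm
        · exfalso
          have h2 := Relation.TransGen.trans_left h hba
          have h3 := Relation.transGen_swap.1 h2
          exact H.acyclic _ h3 }
  obtain ⟨f, hf⟩ := exists_strictMono_fin (Block μ) r (by simp : Fintype.card (Block μ) = ∑ a, μ a)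
  refine ⟨f, fun v w h => hf v w (Relation.ReflTransGen.single h) ?_⟩
  exact fun h' => (H.adj_of_arrow _ _ h).1 h'.symm

theorem comparable {v w : Block μ} (hne : v ≠ w) (h : ¬ (P.blockGraph μ).Adj v w) :
    P.lt v.1 w.1 ∨ P.lt w.1 v.1 := by
  by_contra hc
  rw [not_or] at hc
  apply h
  refine ⟨hne, ?_⟩
  by_cases he : v.1 = w.1
  · exact Or.inl he
  · exact Or.inr ⟨he, hc.1, hc.2⟩

theorem lt_trans' {a b c : Fin n} (h1 : P.lt a b) (h2 : P.lt b c) : P.lt a c :=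
  lt_of_lt_of_le (lt_of_lt_of_le h1 (P.le_m b)) h2.le

theorem lt_irrefl' {a : Fin n} (h : P.lt a a) : False :=
  absurd (lt_of_le_of_lt (P.le_m a) h) (lt_irrefl a)

theorem isChain_wordOf (f : Block μ ≃ Fin (∑ a, μ a)) :
    P.NoDescents (wordOf f) ↔ ∀ (k : ℕ) (hk : k + 1 < ∑ a, μ a),
      ¬ P.lt (f.symm ⟨k + 1, hk⟩).1 (f.symm ⟨k, by omega⟩).1 := by
  rw [NatUnitIntervalOrder.NoDescents, wordOf, List.isChain_iff_getElem]
  simp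

theorem exists_noDescents : ∃ f, H.IsLinearExtension f ∧ P.NoDescents (wordOf f) := by
  classical
  let S : Finset (Block μ ≃ Fin (∑ a, μ a)) := Finset.univ.filter H.IsLinearExtension
  have hS : S.Nonempty := by
    obtain ⟨f, hf⟩ := H.exists_linearExtension
    exact ⟨f, by simpa [S] using hf⟩
  obtain ⟨f, hf, hmin⟩ := S.exists_min_image
    (fun f => toLex (fun k => (f.symm k).1)) hS
  have hfl : H.IsLinearExtension f := by simpa [S] using hf
  refine ⟨f, hfl, ?_⟩
  rw [isChain_wordOf]
  intro k hk hlt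
  set i : Fin (∑ a, μ a) := ⟨k, by omega⟩ with hi
  set j : Fin (∑ a, μ a) := ⟨k + 1, hk⟩ with hj
  have hij : i < j := by simp [hi, hj]
  let g := f.trans (Equiv.swap i j)
  have hg : H.IsLinearExtension g := by
    intro v w hvw
    have h1 := hfl v w hvw
    change Equiv.swap i j (f v) < Equiv.swap i j (f w)
    have hno : ¬ (f v = i ∧ f w = j) := by
      rintro ⟨hv, hw⟩
      have hadj := (H.adj_of_arrow _ _ hvw).2
      rw [← hv, ← hw] at hlt
      simp only [Equiv.symm_apply_apply] at hlt
      rcases hadj with h | h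
      · rw [h] at hlt; exact lt_irrefl' hlt
      · exact h.2.1 hlt
    simp only [Equiv.swap_apply_def]
    simp only [hi, hj, Fin.ext_iff, Fin.lt_def] at *
    grind
  have := hmin g (by simpa [S] using hg)
  refine absurd this (not_le.2 ?_)
  refine ⟨i, fun l hl => ?_, ?_⟩
  · change (f.symm ((Equiv.swap i j).symm l)).1 = (f.symm l).1
    rw [Equiv.symm_swap, Equiv.swap_apply_of_ne_of_ne hl.ne (hl.trans hij).ne]
  · change (f.symm ((Equiv.swap i j).symm i)).1 < (f.symm i).1
    rw [Equiv.symm_swap, Equiv.swap_apply_left]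
    exact lt_of_le_of_lt (P.le_m _) hlt

theorem no_crossing (f g : Block μ ≃ Fin (∑ a, μ a)) (hf : H.IsLinearExtension f)
    (hg : H.IsLinearExtension g) (hgd : P.NoDescents (wordOf g)) (k : Fin (∑ a, μ a))
    (hagree : ∀ l < k, f.symm l = g.symm l) (hne : f.symm k ≠ g.symm k) :
    P.lt (g.symm k).1 (f.symm k).1 := by
  set v := f.symm k with hv
  have hfv : f v = k := by simp [hv]
  have hgv : k < g v := by
    rcases lt_trichotomy (g v) k with h | h | h
    · have := hagree _ h
      simp only [Equiv.symm_apply_apply] at this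
      have h2 : g v = f v := by rw [← Equiv.apply_symm_apply f (g v), this]
      rw [h2, hfv] at h
      exact absurd h (lt_irrefl _)
    · exfalso; apply hne; rw [← h]; simp
    · exact h
  have hcomp : ∀ l, k ≤ l → l < g v → P.lt (g.symm l).1 v.1 ∨ P.lt v.1 (g.symm l).1 := by
    intro l hkl hlv
    have hx : g (g.symm l) = l := by simp
    have hxv : g.symm l ≠ v := by
      intro h; rw [← h, hx] at hlv; exact lt_irrefl _ hlv
    apply comparable hxv
    intro hadj
    have hfx : k < f (g.symm l) := by
      rcases lt_trichotomy (f (g.symm l)) k with h | h | h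
      · have := hagree _ h
        simp only [Equiv.symm_apply_apply] at this
        have h2 : g (g.symm l) = f (g.symm l) := by
          conv_lhs => rw [this]
          simp
        rw [hx] at h2
        rw [← h2] at h
        exact absurd hkl (not_le.2 h)
      · exfalso; apply hxv; rw [hv, ← h]; simp
      · exact h
    rcases H.arrow_or_arrow _ _ hadj with h | h
    · have := hg _ _ h
      rw [hx] at this
      exact absurd this (not_lt.2 hlv.le)
    · have := hf _ _ h
      rw [hfv] at this
      exact absurd this (not_lt.2 hfx.le)
  rcases hcomp k le_rfl hgv with h | h
  · exact h
  · exfalso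
    rw [isChain_wordOf] at hgd
    have key : ∀ t : ℕ, ∀ ht : k.1 + t < ∑ a, μ a, k.1 + t < (g v).1 →
        P.lt v.1 (g.symm ⟨k.1 + t, ht⟩).1 := by
      intro t
      induction t with
      | zero => intro _ _; exact h
      | succ t ih =>
        intro ht htv
        have h1 := ih (by omega) (by omega)
        rcases hcomp ⟨k.1 + (t + 1), ht⟩ (by simp [Fin.le_def]) htv with h2 | h2
        · exfalso
          exact hgd (k.1 + t) ht (lt_trans' h2 h1)
        · exact h2
    have hgv' : k.1 < (g v).1 := hgv
    have hlast := key ((g v).1 - k.1 - 1) (by omega) (by omega)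
    have hd := hgd (k.1 + ((g v).1 - k.1 - 1)) (by omega)
    apply hd
    have : (⟨k.1 + ((g v).1 - k.1 - 1) + 1, by omega⟩ : Fin (∑ a, μ a)) = g v := by
      ext; simp; omega
    rw [this]
    simpa using hlast

theorem existsUnique_word : ∃! w, w ∈ H.W ∧ P.NoDescents w := by
  classical
  obtain ⟨f, hf, hfd⟩ := H.exists_noDescents
  refine ⟨wordOf f, ⟨⟨f, hf, rfl⟩, hfd⟩, ?_⟩
  rintro _ ⟨⟨g, hg, rfl⟩, hgd⟩
  suffices h : ∀ k, f.symm k = g.symm k by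
    simp only [wordOf, h]
  intro k
  induction k using WellFoundedLT.induction with
  | ind k ih =>
    by_contra hne
    have h1 := H.no_crossing f g hf hg hgd k ih hne
    have h2 := H.no_crossing g f hg hf hfd k (fun l hl => (ih l hl).symm) (Ne.symm hne)
    exact lt_irrefl' (lt_trans' h1 h2)

/-- `w_H`: the unique word in `W(H)` without `P`-descents. -/
noncomputable def word : List (Fin n) := H.existsUnique_word.choose

/-- A sink is a block without outgoing arrows. -/
def IsSink (v : Block μ) : Prop := ∀ w, ¬ H.arrow v w

/-- The numbers of vertices of the directed paths from `p` to some sink. -/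
def pathSizes (p : Block μ) : Set ℕ :=
  {r | ∃ l : List (Block μ), l.IsChain H.arrow ∧ l.head? = some p ∧
    (∃ s, l.getLast? = some s ∧ H.IsSink s) ∧ l.length = r}

/-- The rank of a block `p`: one more than the length of a longest path from `p` to some sink, i.e.
the largest number of vertices of such a path. -/
noncomputable def rank (p : Block μ) : ℕ := sSup (H.pathSizes p)

theorem exists_pathSize (p : Block μ) : (H.pathSizes p).Nonempty := by
  have hwf : WellFounded (Relation.TransGen fun w v => H.arrow v w) := by
    have : IsTrans (Block μ) (Relation.TransGen fun w v => H.arrow v w) :=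
      ⟨fun _ _ _ => Relation.TransGen.trans⟩
    have : Std.Irrefl (Relation.TransGen fun w v : Block μ => H.arrow v w) :=
      ⟨fun v h => H.acyclic v (Relation.transGen_swap.1 h)⟩
    exact Finite.wellFounded_of_trans_of_irrefl _
  induction p using hwf.induction with
  | h p ih =>
    by_cases hs : H.IsSink p
    · exact ⟨1, [p], by simp, rfl, ⟨p, rfl, hs⟩, rfl⟩
    · simp only [IsSink, not_forall, not_not] at hs
      obtain ⟨w, hw⟩ := hs
      obtain ⟨r, l, hl, hh, ⟨s, hs, hss⟩, -⟩ := ih w (Relation.TransGen.single hw)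
      cases l with
      | nil => simp at hh
      | cons x l =>
        obtain rfl : x = w := by simpa using hh
        exact ⟨_, p :: x :: l, List.IsChain.cons_cons hw hl, rfl, ⟨s, by simpa using hs, hss⟩, rfl⟩

/-- The longest path in the definition of the rank exists. -/
theorem isGreatest_rank (p : Block μ) : IsGreatest (H.pathSizes p) (H.rank p) := by
  have hb : BddAbove (H.pathSizes p) := by
    refine ⟨Fintype.card (Block μ), ?_⟩
    rintro _ ⟨l, hl, -, -, rfl⟩
    have h1 : l.Pairwise (Relation.TransGen H.arrow) := by
      have : IsTrans (Block μ) (Relation.TransGen H.arrow) :=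
        ⟨fun _ _ _ => Relation.TransGen.trans⟩
      exact (hl.imp fun _ _ => Relation.TransGen.single).pairwise
    have h2 : l.Nodup := h1.imp fun {a b} (h : Relation.TransGen H.arrow a b) (hab : a = b) =>
      H.acyclic b (by rwa [hab] at h)
    exact h2.length_le_card
  exact ⟨Nat.sSup_mem (H.exists_pathSize p) hb, fun r hr => le_csSup hb hr⟩

open Classical in
/-- The number of ascents: arrows `v_{b,j} → v_{a,i}` with `a > b`. -/
noncomputable def asc : ℕ :=
  (Finset.univ.filter fun e : Block μ × Block μ => H.arrow e.1 e.2 ∧ e.1.1 < e.2.1).card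

open Classical in
/-- A connected component (of rank at most 2) is of type W if, with `n_1` blocks of rank 1 and `n_2`
blocks of rank 2, it satisfies `n_1 = n_2 - 1`. Ranks may be computed in the whole heap, since all
directed paths starting at a block stay in its component. -/
def IsTypeW (C : (P.blockGraph μ).ConnectedComponent) : Prop :=
  (∀ v ∈ C.supp, H.rank v ≤ 2) ∧
    (Finset.univ.filter fun v => v ∈ C.supp ∧ H.rank v = 1).card + 1 =
      (Finset.univ.filter fun v => v ∈ C.supp ∧ H.rank v = 2).card

open Classical in
/-- `H` consists of `k` blocks of rank 1 and `l` blocks of rank 2, and has no connected component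
of type W. -/
def IsTwoColumn (k l : ℕ) : Prop :=
  (∀ v, H.rank v ≤ 2) ∧ (Finset.univ.filter fun v => H.rank v = 1).card = k ∧
    (Finset.univ.filter fun v => H.rank v = 2).card = l ∧ ∀ C, ¬ H.IsTypeW C

end Heap

open Classical in
/-- The heaps of `P` of type `μ` with `k` blocks of rank 1, `l` blocks of rank 2, no others, and
no connected component of type W. -/
noncomputable def twoColumnHeaps {n : ℕ} (P : NatUnitIntervalOrder n) (μ : Fin n → ℕ) (k l : ℕ) :
    Finset (Heap P μ) :=
  Finset.univ.filter fun H => H.IsTwoColumn k l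

/-- The partition `(2^l, 1^{k-l})` of `k + l`, for `l ≤ k`. -/
def twoColumn (k l : ℕ) (h : l ≤ k) : Nat.Partition (k + l) where
  parts := Multiset.replicate l 2 + Multiset.replicate (k - l) 1
  parts_pos := by
    intro i hi
    rcases Multiset.mem_add.1 hi with h | h <;> rw [Multiset.eq_of_mem_replicate h] <;> norm_num
  parts_sum := by
    simp only [Multiset.sum_add, Multiset.sum_replicate, smul_eq_mul]
    omega

namespace NatUnitIntervalOrder

variable {n : ℕ} (P : NatUnitIntervalOrder n)

/-- The monomial `u_w = u_{w_1} ⋯ u_{w_d}` in the free associative ring `ℤ⟨u_1, …, u_n⟩`. -/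
noncomputable def u (w : List (Fin n)) : FreeAlgebra ℤ (Fin n) :=
  (w.map (FreeAlgebra.ι ℤ)).prod

/-- The two-sided ideal `I_P` generated by `u_a u_c - u_c u_a` (`a <_P c`) and
`u_a u_c u_b - u_b u_a u_c` (`a < b < c`, `a ≮_P b`, `b ≮_P c`, `a <_P c`). -/
noncomputable def ideal : TwoSidedIdeal (FreeAlgebra ℤ (Fin n)) :=
  TwoSidedIdeal.span
    ({x | ∃ a c, P.lt a c ∧ x = u [a, c] - u [c, a]} ∪
      {x | ∃ a b c, a < b ∧ b < c ∧ ¬ P.lt a b ∧ ¬ P.lt b c ∧ P.lt a c ∧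
        x = u [a, c, b] - u [b, a, c]})

open Classical in
/-- The noncommutative `P`-elementary symmetric function
`e_k(u) = ∑_{i_1 >_P i_2 >_P ⋯ >_P i_k} u_{i_1} ⋯ u_{i_k}`. -/
noncomputable def elem (k : ℕ) : FreeAlgebra ℤ (Fin n) :=
  ∑ i : Fin k → Fin n with (List.ofFn i).IsChain (fun a b => P.lt b a), u (List.ofFn i)

/-- `e_λ(u) = e_{λ_1}(u) ⋯ e_{λ_r}(u)` for `λ_1 ≥ ⋯ ≥ λ_r`. -/
noncomputable def elemPart {d : ℕ} (lam : Nat.Partition d) : FreeAlgebra ℤ (Fin n) :=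
  ((lam.parts.sort (· ≥ ·)).map P.elem).prod

/-- The noncommutative `P`-monomial symmetric function `m_λ(u) = ∑_ν N_{λ,ν} e_ν(u)`. -/
noncomputable def monomial {d : ℕ} (lam : Nat.Partition d) : FreeAlgebra ℤ (Fin n) :=
  ∑ ν : Nat.Partition d, monomialToElem lam ν • P.elemPart ν

end NatUnitIntervalOrder

/-! Multi-chromatic quasisymmetric functions -/

namespace MultiColoring

variable {n : ℕ} (G : SimpleGraph (Fin n)) (μ : Fin n → ℕ)

/-- `κ` is a proper multi-coloring of `G` of type `μ`; the colors are indexed by `ℕ` instead of the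
positive integers, as are the variables. -/
def IsProper (κ : Fin n → Finset ℕ) : Prop :=
  (∀ i, (κ i).card = μ i) ∧ ∀ i j, G.Adj i j → Disjoint (κ i) (κ j)

/-- The exponent of the monomial `x^κ = ∏_i ∏_{c ∈ κ(i)} x_c`. -/
noncomputable def content (κ : Fin n → Finset ℕ) : ℕ →₀ ℕ :=
  ∑ i, ∑ c ∈ κ i, Finsupp.single c 1

open Classical in
/-- The number of pairs `((i,r),(j,s))` with `{i,j}` an edge, `i < j`, `r ∈ κ(i)`, `s ∈ κ(j)` and
`r < s`. -/
noncomputable def asc (κ : Fin n → Finset ℕ) : ℕ :=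
  ∑ e : Fin n × Fin n with G.Adj e.1 e.2 ∧ e.1 < e.2,
    ((κ e.1 ×ˢ κ e.2).filter fun c => c.1 < c.2).card

open Classical in
/-- The finite set of all proper multi-colorings of type `μ` with `x^κ = x^α`. -/
noncomputable def withContent (α : ℕ →₀ ℕ) : Finset (Fin n → Finset ℕ) :=
  (Fintype.piFinset fun _ => α.support.powerset).filter fun κ => IsProper G μ κ ∧ content κ = α

theorem mem_withContent (α : ℕ →₀ ℕ) (κ : Fin n → Finset ℕ) :
    κ ∈ withContent G μ α ↔ IsProper G μ κ ∧ content κ = α := by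
  classical
  rw [withContent, Finset.mem_filter, and_iff_right_iff_imp]
  rintro ⟨-, rfl⟩
  rw [Fintype.mem_piFinset]
  intro i
  rw [Finset.mem_powerset]
  intro c hc
  rw [Finsupp.mem_support_iff, content, Finsupp.finsetSum_apply]
  refine (Finset.sum_pos' (fun _ _ => Nat.zero_le _) ⟨i, Finset.mem_univ _, ?_⟩).ne'
  rw [Finsupp.finsetSum_apply]
  exact Finset.sum_pos' (fun _ _ => Nat.zero_le _) ⟨c, hc, by simp⟩

end MultiColoring

/-- The multi-chromatic quasisymmetric function `X_G(x, q; μ) = ∑_κ q^{asc_G(κ)} x^κ`, a power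
series over `ℚ[q]`, given by its coefficients. -/
noncomputable def chromatic {n : ℕ} (G : SimpleGraph (Fin n)) (μ : Fin n → ℕ) :
    MvPowerSeries ℕ (Polynomial ℚ) :=
  fun α => ∑ κ ∈ MultiColoring.withContent G μ α, Polynomial.X ^ MultiColoring.asc G κ

/-! ### Transition matrices between elementary and monomial symmetric functions -/

namespace SymTransition

open Finset

/-! The coefficient of `m_μ` in `e_λ` counts 0-1-matrices with row sums `λ` and column sums `μ`, so
it is symmetric in `λ` and `μ`. In two variables `e_{(2^i,1^{d-2i})}` is `(xy)^i (x+y)^{d-2i}`, and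
`e_λ` vanishes if `λ` has a part above `2`. Hence `e_{d-j} e_j = ∑_{i ≤ j} C(d-2i, j-i)
m_{(2^i,1^{d-2i})}` for `2j ≤ d`. The noncommutative `m_λ(u)` are defined by the same transition
coefficients, so they satisfy the same relations (`sum_choose_smul_monomial`). These are
unitriangular in `j`; it is therefore enough that the heap sums satisfy them modulo the ideal
(`elemIn_mul_elemIn_eq_sum`).

A term of `e_{d-j}(u) e_j(u)` is a pair of chains of `P`. It is the same as a type `μ` with a proper
two-coloring of `P^μ` in which `j` blocks have color `true` and the lower of two blocks with the
same letter has color `false`. By the unit interval property, each component of a properly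
two-colored graph is a path, so its color counts differ by at most one. If they differ, the product
of the letters of one color commutes with that of the other modulo the ideal
(`path_balanced_or_commute`); this is where the generators of degree three enter. So colors may be
interchanged on unbalanced components without changing the class of the monomial (`weight_flip`). If
every unbalanced component of a coloring has more vertices of color `false`, and `i` vertices have
color `true`, there are `d - 2i` unbalanced components, and interchanging the colors on `j - i` of
them gives the binomial coefficient (`sum_colorings`). Such colorings are the colorings by rank of
the heaps in the theorem (`sum_twoColumnHeaps`).

For the chromatic function, let the letters act on functions of multiplicity vectors by appending,
with a power of `q` recording new inversions. This action kills the ideal (`appendRep_eq_zero`). The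
resulting functional `typeCoeff` sends the word of a heap of type `μ` to `q^asc`, and `e_λ(u)` to
the coefficient of `x^λ` in the chromatic function, because the color classes are chains
(`coeff_chromatic`). As the transition matrix is symmetric, inverting it shows that the coefficient
of `e_λ` is the value of the functional at `m_λ(u)` (`eq_typeCoeff_monomial`), to which the
congruence applies. -/

/-- The transpose of a finitely supported matrix. -/
noncomputable def transpose (l : ℕ →₀ ℕ →₀ ℕ) : ℕ →₀ ℕ →₀ ℕ :=
  (Finsupp.equivMapDomain (Equiv.prodComm ℕ ℕ) l.uncurry).curry

@[simp]
theorem transpose_apply (l : ℕ →₀ ℕ →₀ ℕ) (i j : ℕ) : transpose l j i = l i j := by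
  simp [transpose, Finsupp.curry_apply, Finsupp.equivMapDomain_apply]

theorem transpose_transpose (l : ℕ →₀ ℕ →₀ ℕ) : transpose (transpose l) = l := by
  ext i j
  simp

theorem degree_eq_sum {σ : Type*} (β : σ →₀ ℕ) {s : Finset σ} (h : β.support ⊆ s) :
    β.degree = ∑ i ∈ s, β i := by
  rw [Finsupp.degree_apply]
  exact Finset.sum_subset h fun i _ hi => Finsupp.notMem_support_iff.1 hi

open Classical in
/-- The 0-1-matrices with row sums `α` and column sums `β`. -/
noncomputable def zeroOne (α β : ℕ →₀ ℕ) : Finset (ℕ →₀ ℕ →₀ ℕ) :=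
  (α.support.finsuppAntidiag β).filter
    fun l => ∀ i ∈ α.support, (∀ j, l i j ≤ 1) ∧ (l i).degree = α i

/-- The definition treats rows and columns differently, as the expansion of a product does; this
form is visibly invariant under transposition. -/
theorem mem_zeroOne (α β : ℕ →₀ ℕ) (l : ℕ →₀ ℕ →₀ ℕ) :
    l ∈ zeroOne α β ↔ (∀ i j, l i j ≤ 1) ∧ (∀ i, (l i).degree = α i) ∧
      ∀ j, (transpose l j).degree = β j := by
  have key : l.support ⊆ α.support → ∀ j, (∑ i ∈ α.support, l i) j = (transpose l j).degree := by
    intro h j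
    rw [degree_eq_sum (s := α.support), Finsupp.finsetSum_apply]
    · simp
    · intro i hi
      apply h
      rw [Finsupp.mem_support_iff, transpose_apply] at hi
      rw [Finsupp.mem_support_iff]
      rintro h0
      simp [h0] at hi
  classical
  rw [zeroOne, mem_filter, mem_finsuppAntidiag]
  constructor
  · rintro ⟨⟨h1, h2⟩, h3⟩
    have h4 : ∀ i, i ∉ α.support → l i = 0 := fun i hi =>
      Finsupp.notMem_support_iff.1 fun h => hi (h2 h)
    refine ⟨fun i j => ?_, fun i => ?_, fun j => ?_⟩
    · by_cases hi : i ∈ α.support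
      · exact (h3 i hi).1 j
      · simp [h4 i hi]
    · by_cases hi : i ∈ α.support
      · exact (h3 i hi).2
      · rw [h4 i hi, Finsupp.notMem_support_iff.1 hi, map_zero]
    · rw [← key h2, h1]
  · rintro ⟨h1, h2, h3⟩
    have h4 : l.support ⊆ α.support := by
      intro i hi
      rw [Finsupp.mem_support_iff, ← h2 i]
      intro h0
      exact Finsupp.mem_support_iff.1 hi ((Finsupp.degree_eq_zero_iff _).1 h0)
    refine ⟨⟨?_, h4⟩, fun i _ => ⟨h1 i, h2 i⟩⟩
    ext j
    rw [key h4, h3]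

theorem card_zeroOne_comm (α β : ℕ →₀ ℕ) : (zeroOne α β).card = (zeroOne β α).card := by
  refine Finset.card_bij' (fun l _ => transpose l) (fun l _ => transpose l) ?_ ?_
    (fun l _ => transpose_transpose l) (fun l _ => transpose_transpose l)
  all_goals
    intro l hl
    rw [mem_zeroOne] at hl ⊢
    refine ⟨fun i j => ?_, hl.2.2, fun j => ?_⟩
    · rw [transpose_apply]
      exact hl.1 _ _
    · rw [transpose_transpose]
      exact hl.2.1 j

/-- Expanding the product chooses from each factor a squarefree monomial of degree `α i`, that is,
the `i`-th row of a 0-1-matrix. -/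
theorem coeff_prod_elemSym (R : Type*) [CommRing R] (α β : ℕ →₀ ℕ) :
    MvPowerSeries.coeff β (∏ i ∈ α.support, elemSym R (α i)) = ((zeroOne α β).card : R) := by
  classical
  have h : ∀ (k : ℕ) (γ : ℕ →₀ ℕ), MvPowerSeries.coeff γ (elemSym R k) =
      if (∀ i, γ i ≤ 1) ∧ γ.degree = k then 1 else 0 := fun k γ => by
    change elemSym R k γ = _
    rw [elemSym]
  rw [MvPowerSeries.coeff_prod]
  simp only [h, Finset.prod_ite_zero, Finset.prod_const_one]
  rw [Finset.sum_boole, zeroOne]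

/-- `α` is an exponent whose nonzero values are the parts of `lam`. -/
def HasShape (α : ℕ →₀ ℕ) {d : ℕ} (lam : Nat.Partition d) : Prop :=
  α.support.val.map α = lam.parts

theorem elemSymPart_eq_prod (R : Type*) [CommRing R] {α : ℕ →₀ ℕ} {d : ℕ} {lam : Nat.Partition d}
    (h : HasShape α lam) : elemSymPart R lam = ∏ i ∈ α.support, elemSym R (α i) := by
  rw [elemSymPart, ← h, Multiset.map_map]
  rfl

/-- An exponent of shape `lam`. -/
noncomputable def exponent {d : ℕ} (lam : Nat.Partition d) : ℕ →₀ ℕ := lam.parts.toList.toFinsupp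

theorem hasShape_exponent {d : ℕ} (lam : Nat.Partition d) : HasShape (exponent lam) lam := by
  have h1 : (exponent lam).support = range lam.parts.toList.length := by
    rw [exponent, List.toFinsupp_support, Finset.filter_eq_self]
    intro i hi
    rw [Finset.mem_range] at hi
    rw [List.getD_eq_getElem _ _ hi]
    exact (lam.parts_pos (Multiset.mem_toList.1 (List.getElem_mem hi))).ne'
  rw [HasShape, h1, Finset.range_val, ← Multiset.coe_range, Multiset.map_coe]
  conv_rhs => rw [← Multiset.coe_toList lam.parts]
  congr 1
  apply List.ext_getElem
  · simp
  · intro i hi hi'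
    simp [exponent, List.getElem?_eq_getElem hi']

theorem exists_shape (α : ℕ →₀ ℕ) : ∃ lam : Nat.Partition α.degree, HasShape α lam :=
  ⟨⟨α.support.val.map α, by
    intro i hi
    obtain ⟨j, hj, rfl⟩ := Multiset.mem_map.1 hi
    exact Nat.pos_of_ne_zero (Finsupp.mem_support_iff.1 hj), rfl⟩, rfl⟩

/-- The coefficient of `m_μ` in `e_λ`. -/
noncomputable def elemToMonomial {d : ℕ} : Matrix (Nat.Partition d) (Nat.Partition d) ℤ :=
  fun lam mu => (zeroOne (exponent lam) (exponent mu)).card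

theorem elemToMonomial_comm {d : ℕ} (lam mu : Nat.Partition d) :
    elemToMonomial lam mu = elemToMonomial mu lam := by
  rw [elemToMonomial, card_zeroOne_comm]
  rfl

/-- Permuting the row sums only permutes the commuting factors of a product of elementary functions;
the column sums are handled by transposition. -/
theorem card_zeroOne_eq {d e : ℕ} {α α' β β' : ℕ →₀ ℕ} {lam : Nat.Partition d}
    {mu : Nat.Partition e} (hα : HasShape α lam) (hα' : HasShape α' lam)
    (hβ : HasShape β mu) (hβ' : HasShape β' mu) :
    (zeroOne α β).card = (zeroOne α' β').card := by
  have h : ∀ {e : ℕ} {α α' β : ℕ →₀ ℕ} {lam : Nat.Partition e}, HasShape α lam →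
      HasShape α' lam → (zeroOne α β).card = (zeroOne α' β).card := by
    intro e α α' β lam h h'
    have := coeff_prod_elemSym ℤ α β
    rw [← elemSymPart_eq_prod ℤ h, elemSymPart_eq_prod ℤ h', coeff_prod_elemSym] at this
    exact_mod_cast this.symm
  rw [h hα hα', card_zeroOne_comm, h hβ hβ', card_zeroOne_comm]

theorem coeff_elemSymPart (R : Type*) [CommRing R] {d : ℕ} (lam mu : Nat.Partition d)
    {α : ℕ →₀ ℕ} (h : HasShape α mu) :
    MvPowerSeries.coeff α (elemSymPart R lam) = ((elemToMonomial lam mu : ℤ) : R) := by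
  rw [elemSymPart_eq_prod R (hasShape_exponent lam), coeff_prod_elemSym, elemToMonomial,
    card_zeroOne_eq (hasShape_exponent lam) (hasShape_exponent lam) h (hasShape_exponent mu)]
  simp

/-- The row sums and the column sums of a matrix have the same total. -/
theorem coeff_elemSymPart_of_degree_ne (R : Type*) [CommRing R] {d : ℕ} (lam : Nat.Partition d)
    {α : ℕ →₀ ℕ} (h : α.degree ≠ d) : MvPowerSeries.coeff α (elemSymPart R lam) = 0 := by
  classical
  rw [elemSymPart_eq_prod R (hasShape_exponent lam), coeff_prod_elemSym, Finset.card_eq_zero.2,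
    Nat.cast_zero]
  rw [Finset.eq_empty_iff_forall_notMem]
  intro l hl
  apply h
  have h1 := (mem_filter.1 (by rwa [zeroOne] at hl)).1
  rw [mem_finsuppAntidiag] at h1
  refine Eq.trans ?_ (SymAux.degree_of_shape lam _ (hasShape_exponent lam))
  rw [← h1.1, map_sum, Finsupp.degree_apply]
  exact Finset.sum_congr rfl fun i _ => ((mem_zeroOne _ _ _).1 hl).2.1 i

theorem monomialSym_eq {d : ℕ} (lam : Nat.Partition d) :
    monomialSym ℤ lam = ∑ nu, monomialToElem lam nu • elemSymPart ℤ nu :=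
  (existsUnique_monomialToElem lam).choose_spec.1

theorem monomialToElem_mul_elemToMonomial {d : ℕ} :
    (Matrix.of (monomialToElem (d := d)) * elemToMonomial : Matrix _ _ ℤ) = 1 := by
  classical
  ext lam mu
  have h := congrArg (MvPowerSeries.coeff (exponent mu)) (monomialSym_eq lam)
  simp only [map_sum, map_zsmul, coeff_elemSymPart ℤ _ mu (hasShape_exponent mu)] at h
  rw [Matrix.mul_apply, Matrix.one_apply]
  simp only [Matrix.of_apply]
  simp only [smul_eq_mul, Int.cast_id] at h
  rw [← h]
  change (if _ then _ else _) = _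
  rw [hasShape_exponent mu]
  exact if_congr ⟨fun h => (Nat.Partition.ext h).symm, fun h => by rw [h]⟩ rfl rfl

theorem elemToMonomial_mul_monomialToElem {d : ℕ} :
    (elemToMonomial * Matrix.of (monomialToElem (d := d)) : Matrix _ _ ℤ) = 1 :=
  mul_eq_one_comm.1 monomialToElem_mul_elemToMonomial

/-! ### Partitions with at most two rows and with at most two columns -/

/-- The partition `(2^j, 1^{d - 2j})`. -/
def twosOnes (d j : ℕ) : Nat.Partition d where
  -- Capping `j` at `d / 2` keeps the sum of the parts equal to `d` for every `j`, so no proof of `2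
  -- * j ≤ d` has to be carried along.
  parts := Multiset.replicate (min j (d / 2)) 2 + Multiset.replicate (d - 2 * min j (d / 2)) 1
  parts_pos := by
    intro i hi
    rcases Multiset.mem_add.1 hi with h | h <;> rw [Multiset.eq_of_mem_replicate h] <;> norm_num
  parts_sum := by
    simp only [Multiset.sum_add, Multiset.sum_replicate, smul_eq_mul]
    omega

theorem twoColumn_eq_twosOnes (k l : ℕ) (h : l ≤ k) : twoColumn k l h = twosOnes (k + l) l := by
  apply Nat.Partition.ext
  have h1 : min l ((k + l) / 2) = l := by omega
  have h2 : k + l - 2 * l = k - l := by omega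
  simp only [twoColumn, twosOnes, h1, h2]

/-- The partition with parts `d - j` and `j`, omitting zeros. -/
def twoParts (d j : ℕ) (h : j ≤ d) : Nat.Partition d :=
  Nat.Partition.ofSums d {d - j, j} (by simp; omega)

theorem exists_twosOnes {d : ℕ} (lam : Nat.Partition d) (h : ∀ i ∈ lam.parts, i ≤ 2) :
    ∃ j, 2 * j ≤ d ∧ lam = twosOnes d j := by
  have h1 : lam.parts = Multiset.replicate (lam.parts.count 2) 2 +
      Multiset.replicate (lam.parts.count 1) 1 := by
    ext i
    simp only [Multiset.count_add, Multiset.count_replicate]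
    by_cases hi : i ∈ lam.parts
    · have := lam.parts_pos hi
      have := h i hi
      interval_cases i <;> simp
    · rw [Multiset.count_eq_zero_of_notMem hi]
      split_ifs with h2 h3 h3
      · omega
      · subst h2
        simp [hi]
      · subst h3
        simp [hi]
      · rfl
  have h2 : lam.parts.count 2 * 2 + lam.parts.count 1 = d := by
    conv_rhs => rw [← lam.parts_sum, h1]
    simp
  refine ⟨lam.parts.count 2, by omega, Nat.Partition.ext ?_⟩
  have h3 : min (lam.parts.count 2) (d / 2) = lam.parts.count 2 := by omega
  have h4 : d - 2 * lam.parts.count 2 = lam.parts.count 1 := by omega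
  simp only [twosOnes, h3, h4]
  exact h1

theorem twosOnes_injOn {d i j : ℕ} (hi : 2 * i ≤ d) (hj : 2 * j ≤ d)
    (h : twosOnes d i = twosOnes d j) : i = j := by
  have := congrArg (fun lam : Nat.Partition d => lam.parts.count 2) h
  simp only [twosOnes, Multiset.count_add, Multiset.count_replicate] at this
  norm_num at this
  omega

theorem esymm_two (k : ℕ) : MvPolynomial.esymm (Fin 2) ℤ k =
    if k = 0 then 1 else if k = 1 then MvPolynomial.X 0 + MvPolynomial.X 1 else
      if k = 2 then MvPolynomial.X 0 * MvPolynomial.X 1 else 0 := by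
  split_ifs with h0 h1 h2
  · rw [h0, MvPolynomial.esymm_zero]
  · rw [h1, MvPolynomial.esymm_one, Fin.sum_univ_two]
  · subst h2
    rw [MvPolynomial.esymm]
    have : powersetCard 2 (univ : Finset (Fin 2)) = {univ} := by
      rw [show (2 : ℕ) = (univ : Finset (Fin 2)).card by simp]
      exact powersetCard_self _
    rw [this, Finset.sum_singleton, Fin.prod_univ_two]
  · rw [MvPolynomial.esymm, powersetCard_eq_empty.2, Finset.sum_empty]
    simp
    omega

/-- The exponent `(d - j, j)` in two variables. -/
noncomputable def pairExponent (d j : ℕ) : Fin 2 →₀ ℕ :=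
  Finsupp.equivFunOnFinite.symm ![d - j, j]

theorem hasShape_pairExponent {d j : ℕ} (h : j ≤ d) :
    HasShape (Finsupp.embDomain (Fin.valEmbedding (n := 2)) (pairExponent d j))
      (twoParts d j h) := by
  rw [HasShape, Finsupp.support_embDomain, Finset.map_val, Multiset.map_map]
  have h1 : (Finsupp.embDomain (Fin.valEmbedding (n := 2)) (pairExponent d j)) ∘
      (Fin.valEmbedding (n := 2)) = pairExponent d j := by
    ext i
    exact Finsupp.embDomain_apply_self _ _ _
  rw [h1]
  have h2 : (pairExponent d j).support = univ.filter fun i => pairExponent d j i ≠ 0 := by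
    ext i
    simp
  rw [h2, Finset.filter_val]
  have h3 : ((univ : Finset (Fin 2)).val.map (pairExponent d j)) = {d - j, j} := by
    have : (univ : Finset (Fin 2)).val = {0, 1} := rfl
    rw [this]
    simp [pairExponent]
  change _ = Multiset.filter (fun x => x ≠ 0) {d - j, j}
  rw [← h3, Multiset.filter_map]
  rfl

/-- By symmetry the entry is also the coefficient of a monomial in two variables in `e_λ`, and
setting the other variables to zero does not affect it. -/
theorem elemToMonomial_twoParts {d j : ℕ} (h : j ≤ d) (lam : Nat.Partition d) :
    elemToMonomial (twoParts d j h) lam =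
      MvPolynomial.coeff (pairExponent d j) (MvPolynomial.esymmPart (Fin 2) ℤ lam) := by
  rw [elemToMonomial_comm]
  have h1 := coeff_elemSymPart ℤ lam _ (hasShape_pairExponent h)
  rw [← MvPowerSeries.coeff_killCompl, SymAux.kill_elemSymPart, MvPolynomial.coeff_coe] at h1
  rw [h1]
  simp

/-- The polynomial is `(xy)^i (x + y)^(d - 2i)`; apply the binomial theorem. -/
theorem coeff_esymmPart_twosOnes {d i j : ℕ} (hi : 2 * i ≤ d) (h : j ≤ d) :
    MvPolynomial.coeff (pairExponent d j) (MvPolynomial.esymmPart (Fin 2) ℤ (twosOnes d i)) =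
      if i ≤ j ∧ i ≤ d - j then ((d - 2 * i).choose (j - i) : ℤ) else 0 := by
  have h1 : min i (d / 2) = i := by omega
  rw [MvPolynomial.esymmPart]
  simp only [twosOnes, h1, Multiset.map_add, Multiset.map_replicate, Multiset.prod_add,
    Multiset.prod_replicate, esymm_two]
  norm_num
  have h2 : (MvPolynomial.X 0 * MvPolynomial.X 1 : MvPolynomial (Fin 2) ℤ) ^ i =
      MvPolynomial.monomial (Finsupp.equivFunOnFinite.symm ![i, i]) 1 := by
    rw [MvPolynomial.monomial_eq, Finsupp.prod_fintype _ _ (by simp)]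
    simp [Fin.prod_univ_two, mul_pow]
  rw [h2, MvPolynomial.coeff_monomial_mul', MvPolynomial.coeff_add_pow]
  have h3 : (Finsupp.equivFunOnFinite.symm ![i, i] ≤ pairExponent d j) ↔ i ≤ j ∧ i ≤ d - j := by
    rw [Finsupp.le_def, Fin.forall_fin_two]
    simp [pairExponent, and_comm]
  simp only [h3]
  by_cases h4 : i ≤ j ∧ i ≤ d - j
  · have h5 : (pairExponent d j - Finsupp.equivFunOnFinite.symm ![i, i]) 0 = d - j - i := by
      simp [pairExponent]
    have h6 : (pairExponent d j - Finsupp.equivFunOnFinite.symm ![i, i]) 1 = j - i := by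
      simp [pairExponent]
    rw [h5, h6, if_pos h4, if_pos h4, if_pos (by rw [Finset.HasAntidiagonal.mem_antidiagonal]; omega), one_mul,
      ← Nat.choose_symm (by omega : d - j - i ≤ d - 2 * i)]
    congr 2
    omega
  · rw [if_neg h4, if_neg h4]

theorem elemToMonomial_twoParts_twosOnes {d i j : ℕ} (hi : 2 * i ≤ d) (hj : 2 * j ≤ d) :
    elemToMonomial (twoParts d j (by omega)) (twosOnes d i) =
      if i ≤ j then ((d - 2 * i).choose (j - i) : ℤ) else 0 := by
  rw [elemToMonomial_twoParts, coeff_esymmPart_twosOnes hi (by omega)]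
  exact if_congr (by omega) rfl rfl

theorem elemToMonomial_twoParts_eq_zero {d j : ℕ} (h : j ≤ d) (lam : Nat.Partition d)
    (hlam : ∃ i ∈ lam.parts, 2 < i) : elemToMonomial (twoParts d j h) lam = 0 := by
  obtain ⟨i, hi, h2⟩ := hlam
  rw [elemToMonomial_twoParts, MvPolynomial.esymmPart, Multiset.prod_eq_zero,
    MvPolynomial.coeff_zero]
  refine Multiset.mem_map.2 ⟨i, hi, ?_⟩
  rw [esymm_two, if_neg (by omega), if_neg (by omega), if_neg (by omega)]

/-- This is the row of the partition `(d - j, j)` in the identity saying that the two transition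
matrices are inverse to each other. -/
theorem sum_choose_smul_monomialToElem {d j : ℕ} (h : 2 * j ≤ d) (nu : Nat.Partition d) :
    ∑ i ∈ range (j + 1), ((d - 2 * i).choose (j - i) : ℤ) * monomialToElem (twosOnes d i) nu =
      if nu = twoParts d j (by omega) then 1 else 0 := by
  classical
  have h1 := congrFun (congrFun (elemToMonomial_mul_monomialToElem (d := d))
    (twoParts d j (by omega))) nu
  rw [Matrix.mul_apply, Matrix.one_apply] at h1
  simp only [Matrix.of_apply] at h1
  rw [if_congr eq_comm rfl rfl, ← h1]
  have h2 : Set.InjOn (twosOnes d) (range (j + 1)) := by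
    intro a ha b hb hab
    simp only [coe_range, Set.mem_Iio] at ha hb
    exact twosOnes_injOn (by omega) (by omega) hab
  have h3 : ∑ i ∈ range (j + 1), ((d - 2 * i).choose (j - i) : ℤ) *
      monomialToElem (twosOnes d i) nu = ∑ lam ∈ (range (j + 1)).image (twosOnes d),
        elemToMonomial (twoParts d j (by omega)) lam * monomialToElem lam nu := by
    rw [Finset.sum_image h2]
    refine Finset.sum_congr rfl fun i hi => ?_
    rw [Finset.mem_range] at hi
    rw [elemToMonomial_twoParts_twosOnes (by omega) h, if_pos (by omega)]
  rw [h3]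
  -- The remaining entries of the row vanish: `lam` has a part above `2`, or it has more than `j`
  -- parts equal to `2`.
  refine Finset.sum_subset (Finset.subset_univ _) fun lam _ hlam => ?_
  suffices h4 : elemToMonomial (twoParts d j (by omega)) lam = 0 by rw [h4, zero_mul]
  by_cases h5 : ∀ i ∈ lam.parts, i ≤ 2
  · obtain ⟨i, hi, rfl⟩ := exists_twosOnes lam h5
    rw [elemToMonomial_twoParts_twosOnes hi h, if_neg]
    intro hij
    exact hlam (Finset.mem_image_of_mem _ (Finset.mem_range.2 (by omega)))
  · push Not at h5
    exact elemToMonomial_twoParts_eq_zero _ _ h5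

end SymTransition

/-! ### Two-colorings of the graph of a word and their readings -/

/-- A family of elements of a monoid satisfying the relations of the ideal `I_P`. -/
structure NatUnitIntervalOrder.Satisfies {n : ℕ} (P : NatUnitIntervalOrder n) {R : Type*}
    [Monoid R] (g : Fin n → R) : Prop where
  comm : ∀ a c, P.lt a c → g a * g c = g c * g a
  braid : ∀ a b c, a < b → b < c → ¬ P.lt a b → ¬ P.lt b c → P.lt a c →
    g a * g c * g b = g b * g a * g c

/-- Two elements that occur in opposite orders in the two lists are related by `r` both ways, so
their images commute. Hence the first entry of one list can be moved to the front of the other. -/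
theorem List.prod_map_eq_of_pairwise {V M : Type*} [Monoid M] (f : V → M) (r : V → V → Prop)
    (h : ∀ v w, r v w → r w v → Commute (f v) (f w)) :
    ∀ l₁ l₂ : List V, l₁.Perm l₂ → l₁.Pairwise r → l₂.Pairwise r →
      (l₁.map f).prod = (l₂.map f).prod := by
  intro l₁
  induction l₁ with
  | nil =>
    intro l₂ hp _ _
    rw [hp.nil_eq]
  | cons v t ih =>
    intro l₂ hp h₁ h₂
    obtain ⟨s, u, rfl⟩ := List.append_of_mem (hp.subset List.mem_cons_self)
    have hp' : t.Perm (s ++ u) := (List.perm_cons v).1 (hp.trans List.perm_middle)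
    rw [List.pairwise_cons] at h₁
    have h₃ : (s ++ u).Pairwise r := h₂.sublist (by simp)
    have h₄ : ∀ y ∈ s.map f, Commute y (f v) := by
      intro y hy
      obtain ⟨z, hz, rfl⟩ := List.mem_map.1 hy
      refine h _ _ ?_ (h₁.1 z (hp'.symm.subset (List.mem_append_left _ hz)))
      exact (List.pairwise_append.1 h₂).2.2 z hz v List.mem_cons_self
    have h₅ := Commute.list_prod_left _ _ h₄
    rw [List.map_cons, List.prod_cons, ih _ hp' h₁.2 h₃]
    simp only [List.map_append, List.prod_append, List.map_cons, List.prod_cons]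
    rw [← mul_assoc, ← h₅.eq, mul_assoc]

theorem List.isChain_of_consecutive {V : Type*} [Preorder V] {r : V → V → Prop} :
    ∀ l : List V, l.Pairwise (· < ·) →
      (∀ v ∈ l, ∀ w ∈ l, v < w → (∀ z ∈ l, v < z → ¬ z < w) → r v w) → l.IsChain r
  | [], _, _ => List.IsChain.nil
  | [_], _, _ => List.IsChain.singleton _
  | a :: b :: l, hl, h => by
    rw [List.pairwise_cons] at hl
    refine List.IsChain.cons_cons ?_ (List.isChain_of_consecutive _ hl.2 fun v hv w hw hvw hz => ?_)
    · refine h a (by simp) b (by simp) (hl.1 b (by simp)) fun z hz haz hzb => ?_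
      rcases List.mem_cons.1 hz with rfl | hz
      · exact lt_irrefl _ haz
      rcases List.mem_cons.1 hz with rfl | hz
      · exact lt_irrefl _ hzb
      · exact lt_asymm hzb ((List.pairwise_cons.1 hl.2).1 z hz)
    · refine h v (List.mem_cons_of_mem _ hv) w (List.mem_cons_of_mem _ hw) hvw fun z hz' hvz => ?_
      rcases List.mem_cons.1 hz' with rfl | hz'
      · exact fun _ => lt_asymm hvz (hl.1 v hv)
      · exact hz z hz' hvz

theorem SimpleGraph.Reachable.mem_of_closed {V : Type*} {G : SimpleGraph V} {s : Set V}
    (hs : ∀ u z, u ∈ s → G.Adj u z → z ∈ s) {v w : V} (h : G.Reachable v w) (hv : v ∈ s) :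
    w ∈ s := by
  obtain ⟨p⟩ := h
  induction p with
  | nil => exact hv
  | cons hadj _ ih => exact ih (hs _ _ hv hadj)

/-! ### Components of properly two-colored incomparability graphs -/

namespace TwoColoring

open Finset

/-- `c` is a proper coloring of `G`. -/
def IsProper {V : Type*} (G : SimpleGraph V) (c : V → Bool) : Prop := ∀ v w, G.Adj v w → c v ≠ c w

/-- `l` lists all vertices, and for each edge the end colored `false` comes first. -/
def IsReading {V : Type*} [Fintype V] (G : SimpleGraph V) (c : V → Bool) (l : List V) : Prop :=
  l.Perm univ.toList ∧ l.Pairwise fun v w => G.Adj v w → c v = false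

/-- `G` is the graph in which distinct vertices are adjacent if their letters are incomparable. -/
def IsIncGraph {n : ℕ} (P : NatUnitIntervalOrder n) {V : Type*} (x : V → Fin n)
    (G : SimpleGraph V) : Prop :=
  ∀ v w, G.Adj v w ↔ v ≠ w ∧ ¬ P.lt (x v) (x w) ∧ ¬ P.lt (x w) (x v)

variable {n : ℕ} {P : NatUnitIntervalOrder n} {V : Type*} {x : V → Fin n} {G : SimpleGraph V}
  {R : Type*}

theorem commute_of_not_adj [Monoid R] {g : Fin n → R} (hG : IsIncGraph P x G)
    (hg : P.Satisfies g) {v w : V} (h : ¬ G.Adj v w) : Commute (g (x v)) (g (x w)) := by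
  by_cases hvw : v = w
  · rw [hvw]
  · rw [hG] at h
    by_cases h1 : P.lt (x v) (x w)
    · exact hg.comm _ _ h1
    · by_cases h2 : P.lt (x w) (x v)
      · exact (hg.comm _ _ h2).symm
      · exact absurd ⟨hvw, h1, h2⟩ h

/-- Vertices that may appear in either order are not adjacent, since the coloring is proper, so
their letters are equal or comparable and commute. -/
theorem prod_eq_of_isReading [Fintype V] [Monoid R] {g : Fin n → R} (hG : IsIncGraph P x G)
    (hg : P.Satisfies g) {c : V → Bool} (hc : IsProper G c) {l₁ l₂ : List V}
    (h₁ : IsReading G c l₁) (h₂ : IsReading G c l₂) :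
    (l₁.map fun v => g (x v)).prod = (l₂.map fun v => g (x v)).prod := by
  refine List.prod_map_eq_of_pairwise _ (fun v w => G.Adj v w → c v = false) ?_ _ _
    (h₁.1.trans h₂.1.symm) h₁.2 h₂.2
  intro v w hvw hwv
  apply commute_of_not_adj hG hg
  intro h
  exact hc _ _ h ((hvw h).trans (hwv h.symm).symm)

section Order

variable [LinearOrder V]

/-- In a unit interval order, a vertex between two adjacent ones is adjacent to both; two colors do
not allow this triangle. -/
theorem not_adj_of_lt_of_lt (hx : Monotone x) (hG : IsIncGraph P x G) {c : V → Bool}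
    (hc : IsProper G c) {u v w : V} (huv : u < v) (hvw : v < w) : ¬ G.Adj u w := by
  intro h
  have h1 := ((hG _ _).1 h).2.1
  simp only [NatUnitIntervalOrder.lt, not_lt] at h1
  have h2 : G.Adj u v := by
    rw [hG]
    refine ⟨huv.ne, not_lt.2 ((hx hvw.le).trans h1), not_lt.2 ((hx huv.le).trans (P.le_m _))⟩
  have h3 : G.Adj v w := by
    rw [hG]
    refine ⟨hvw.ne, not_lt.2 (h1.trans (P.mono (hx huv.le))),
      not_lt.2 ((hx hvw.le).trans (P.le_m _))⟩
  have := hc _ _ h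
  have := hc _ _ h2
  have := hc _ _ h3
  cases hu : c u <;> cases hv : c v <;> cases hw : c w <;> simp_all

theorem lt_of_not_adj (hx : Monotone x) (hG : IsIncGraph P x G) {u v : V} (huv : u < v)
    (h : ¬ G.Adj u v) : P.lt (x u) (x v) := by
  by_contra h1
  exact h ((hG _ _).2 ⟨huv.ne, h1, not_lt.2 ((hx huv.le).trans (P.le_m _))⟩)

/-- Along a path, the color of the first vertex occurs as often as the other one, or once more; in
the latter case the products of the letters of the two colors commute. -/
theorem path_balanced_or_commute [Monoid R] {g : Fin n → R} (hx : Monotone x)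
    (hG : IsIncGraph P x G) (hg : P.Satisfies g) {c : V → Bool} (hc : IsProper G c) (t : Bool) :
    ∀ l : List V, l.Pairwise (· < ·) → l.IsChain G.Adj → (∀ a ∈ l.head?, c a = t) →
      l.countP (fun v => c v == !t) = l.countP (fun v => c v == t) ∨
      (l.countP (fun v => c v == t) = l.countP (fun v => c v == !t) + 1 ∧
        Commute ((l.filter fun v => c v == t).map fun v => g (x v)).prod
          ((l.filter fun v => c v == !t).map fun v => g (x v)).prod)
  | [], _, _, _ => by simp
  | [a], _, _, h => by
    right
    have ha : c a = t := h a (by simp)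
    simp [ha]
  | a :: b :: l, hl, hch, h => by
    have ha : c a = t := h a (by simp)
    rw [List.isChain_cons_cons] at hch
    have hb : c b = !t := by
      have := hc _ _ hch.1
      rw [ha] at this
      cases t <;> cases hcb : c b <;> simp_all
    rw [List.pairwise_cons, List.pairwise_cons] at hl
    -- The induction removes the two vertices `a` and `b` at once. The vertex `a` has `b` as its
    -- only neighbor in the list, so its letter commutes with all letters of `l`.
    have hcomm : ∀ v ∈ l, P.lt (x a) (x v) := fun v hv =>
      lt_of_not_adj hx hG (hl.1 v (by simp [hv]))
        (not_adj_of_lt_of_lt hx hG hc (hl.1 b (by simp)) (hl.2.1 v hv))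
    have hhead : ∀ z ∈ l.head?, c z = t := by
      intro z hz
      have h1 := hc _ _ ((List.isChain_cons.1 hch.2).1 z hz)
      rw [hb] at h1
      cases t <;> cases hcz : c z <;> simp_all
    have ih := path_balanced_or_commute hx hG hg hc t l hl.2.2 (List.isChain_cons.1 hch.2).2 hhead
    simp only [List.countP_cons, List.filter_cons, ha, hb]
    rcases ih with ih | ⟨ih, ih2⟩
    · left
      simp [ih]
    · right
      refine ⟨by simp [ih], ?_⟩
      cases l with
      | nil => simp at ih
      | cons z l =>
        have hz : c z = t := hhead z (by simp)
        simp only [List.filter_cons, hz, beq_self_eq_true, if_true, List.map_cons, List.prod_cons,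
          Bool.beq_not_self, Bool.not_beq_self, Bool.false_eq_true, if_false] at ih2 ⊢
        have hbz : G.Adj b z := (List.isChain_cons_cons.1 hch.2).1
        have h1 := ((hG _ _).1 hch.1).2.1
        have h2 := ((hG _ _).1 hbz).2.1
        have h3 := hcomm z (by simp)
        -- The relation of degree three needs strict inequalities: equal letters at `a` and `b`
        -- would make `b` comparable to its neighbor `z`, and likewise on the other side.
        have hab : x a < x b := lt_of_le_of_ne (hx (hl.1 b (by simp)).le) fun h => by
          rw [h] at h3; exact h2 h3
        have hbz' : x b < x z := lt_of_le_of_ne (hx (hl.2.1 z (by simp)).le) fun h => by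
          rw [← h] at h3; exact h1 h3
        have hbr := hg.braid _ _ _ hab hbz' h1 h2 h3
        have hbE : Commute ((l.filter fun v => c v == t).map fun v => g (x v)).prod (g (x b)) := by
          apply Commute.list_prod_left
          intro y hy
          obtain ⟨v, hv, rfl⟩ := List.mem_map.1 hy
          have hv' := List.mem_of_mem_filter hv
          refine (hg.comm _ _ (lt_of_not_adj hx hG (hl.2.1 v (by simp [hv'])) ?_)).symm
          exact not_adj_of_lt_of_lt hx hG hc (hl.2.1 z (by simp))
            ((List.pairwise_cons.1 hl.2.2).1 v hv')
        have haO : Commute ((l.filter fun v => c v == !t).map fun v => g (x v)).prod (g (x a)) := by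
          apply Commute.list_prod_left
          intro y hy
          obtain ⟨v, hv, rfl⟩ := List.mem_map.1 hy
          exact (hg.comm _ _ (hcomm v (by simp [List.mem_of_mem_filter hv]))).symm
        generalize ((l.filter fun v => c v == t).map fun v => g (x v)).prod = E at *
        generalize ((l.filter fun v => c v == !t).map fun v => g (x v)).prod = O at *
        generalize g (x a) = A at *
        generalize g (x b) = B at *
        generalize g (x z) = Z at *
        change A * (Z * E) * (B * O) = B * O * (A * (Z * E))
        -- `B` passes `E`, the relation of degree three turns `A Z B` into `B A Z`, the induction
        -- hypothesis interchanges `Z E` and `O`, and finally `A` passes `O`.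
        calc A * (Z * E) * (B * O) = A * Z * (E * B) * O := by simp only [mul_assoc]
          _ = A * Z * B * (E * O) := by rw [hbE.eq]; simp only [mul_assoc]
          _ = B * A * (Z * E * O) := by rw [hbr]; simp only [mul_assoc]
          _ = B * (O * A) * (Z * E) := by rw [ih2.eq, haO.eq]; simp only [mul_assoc]
          _ = B * O * (A * (Z * E)) := by simp only [mul_assoc]

-- Edges cannot pass over a vertex. If two consecutive vertices `v < w` of a component were not
-- adjacent, no edge could leave the set of its vertices up to `v`, so `w` would not be reachable
-- from `v`.
open Classical in
theorem isChain_component [Fintype V] (hx : Monotone x) (hG : IsIncGraph P x G) {c : V → Bool}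
    (hc : IsProper G c) (C : G.ConnectedComponent) :
    ((univ.filter fun v => G.connectedComponentMk v = C).sort (· ≤ ·)).IsChain G.Adj := by
  refine List.isChain_of_consecutive _ (Finset.sortedLT_sort _).pairwise ?_
  simp only [Finset.mem_sort, Finset.mem_filter, Finset.mem_univ, true_and]
  intro v hv w hw hvw hz
  by_contra hadj
  have hr : G.Reachable v w := SimpleGraph.ConnectedComponent.exact (hv.trans hw.symm)
  have := hr.mem_of_closed (s := {u | G.connectedComponentMk u = C ∧ u ≤ v}) ?_ ⟨hv, le_rfl⟩
  · exact absurd hvw (not_lt.2 this.2)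
  · rintro u z ⟨hu, huv⟩ huz
    have hzC : G.connectedComponentMk z = C := by
      rw [← hu]
      exact SimpleGraph.ConnectedComponent.sound huz.symm.reachable
    refine ⟨hzC, ?_⟩
    by_contra hvz
    rw [not_le] at hvz
    have hwz : w ≤ z := not_lt.1 (hz z hzC hvz)
    rcases huv.lt_or_eq with h | h
    · exact not_adj_of_lt_of_lt hx hG hc h hvz huz
    · subst h
      rcases hwz.lt_or_eq with h | h
      · exact not_adj_of_lt_of_lt hx hG hc hvw h huz
      · subst h
        exact hadj huz

end Order

end TwoColoring

/-! ### Interchanging the colors on an unbalanced component -/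

namespace TwoColoring

open Finset

variable {n : ℕ} {P : NatUnitIntervalOrder n} {V : Type*} {x : V → Fin n} {G : SimpleGraph V}
  {R : Type*}

/-- Vertices with the same letter are ordered by an arbitrary enumeration. -/
theorem exists_linearOrder_monotone [Fintype V] (x : V → Fin n) :
    ∃ o : LinearOrder V, @Monotone V (Fin n) o.toPreorder _ x := by
  let f : V → Fin n ×ₗ Fin (Fintype.card V) := fun v => toLex (x v, Fintype.equivFin V v)
  have hf : Function.Injective f := fun v w h =>
    (Fintype.equivFin V).injective (Prod.ext_iff.1 (toLex.injective h)).2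
  refine ⟨LinearOrder.lift' f hf, fun v w h => ?_⟩
  have h' : f v ≤ f w := h
  rw [Prod.Lex.le_iff] at h'
  rcases h' with h' | h'
  · exact h'.le
  · exact h'.1.le

/-- The product of the letters in a reading of the coloring `c`. -/
noncomputable def weight [Fintype V] [Monoid R] (g : Fin n → R) (x : V → Fin n) (c : V → Bool) : R :=
  (((univ.filter fun v => c v = false).toList ++ (univ.filter fun v => c v = true).toList).map
    fun v => g (x v)).prod

/-- This allows one component to be read in full before the others, so that its two color products
become adjacent factors. -/
theorem isReading_append [Fintype V] {c : V → Bool} (hc : IsProper G c) {A₁ B₁ A₂ B₂ : List V}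
    (hp : (A₁ ++ B₁ ++ (A₂ ++ B₂)).Perm univ.toList)
    (hA₁ : ∀ v ∈ A₁, c v = false) (hA₂ : ∀ v ∈ A₂, c v = false)
    (hB₁ : ∀ v ∈ B₁, c v = true) (hB₂ : ∀ v ∈ B₂, c v = true)
    (h : ∀ v ∈ B₁, ∀ w ∈ A₂, ¬ G.Adj v w) : IsReading G c (A₁ ++ B₁ ++ (A₂ ++ B₂)) := by
  have hf : ∀ l : List V, (∀ v ∈ l, c v = false) →
      l.Pairwise fun v w => G.Adj v w → c v = false := fun l hl =>
    List.Pairwise.imp_of_mem (R := fun _ _ => True) (fun hv _ _ _ => hl _ hv)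
      (List.pairwise_of_forall fun _ _ => trivial)
  have ht : ∀ l : List V, (∀ v ∈ l, c v = true) →
      l.Pairwise fun v w => G.Adj v w → c v = false := fun l hl =>
    List.Pairwise.imp_of_mem (R := fun _ _ => True)
      (fun hv hw _ hvw => absurd ((hl _ hv).trans (hl _ hw).symm) (hc _ _ hvw))
      (List.pairwise_of_forall fun _ _ => trivial)
  refine ⟨hp, ?_⟩
  rw [List.pairwise_append, List.pairwise_append, List.pairwise_append]
  refine ⟨⟨hf _ hA₁, ht _ hB₁, fun v hv _ _ _ => hA₁ v hv⟩,
    ⟨hf _ hA₂, ht _ hB₂, fun v hv _ _ _ => hA₂ v hv⟩, fun v hv w hw hvw => ?_⟩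
  rcases List.mem_append.1 hv with hv | hv
  · exact hA₁ v hv
  · rcases List.mem_append.1 hw with hw | hw
    · exact absurd hvw (h v hv w hw)
    · exact absurd ((hB₁ v hv).trans (hB₂ w hw).symm) (hc _ _ hvw)

theorem isReading_canonical [Fintype V] {c : V → Bool} (hc : IsProper G c) :
    IsReading G c ((univ.filter fun v => c v = false).toList ++
      (univ.filter fun v => c v = true).toList) := by
  classical
  have h := isReading_append hc (A₁ := (univ.filter fun v => c v = false).toList)
    (B₁ := (univ.filter fun v => c v = true).toList) (A₂ := []) (B₂ := []) ?_
    (by simp) (by simp) (by simp) (by simp) (by simp)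
  · simpa using h
  · rw [List.append_nil, List.append_nil, List.perm_ext_iff_of_nodup]
    · intro v
      cases h : c v <;> simp [h]
    · rw [List.nodup_append]
      refine ⟨Finset.nodup_toList _, Finset.nodup_toList _, ?_⟩
      intro a ha b hb hab
      subst hab
      simp only [mem_toList, mem_filter] at ha hb
      rw [ha.2] at hb
      exact absurd hb.2 (by simp)
    · exact Finset.nodup_toList _

theorem weight_eq_of_isReading [Fintype V] [Monoid R] {g : Fin n → R} (hG : IsIncGraph P x G)
    (hg : P.Satisfies g) {c : V → Bool} (hc : IsProper G c) {l : List V} (hl : IsReading G c l) :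
    (l.map fun v => g (x v)).prod = weight g x c :=
  prod_eq_of_isReading hG hg hc hl (isReading_canonical hc)

open Classical in
/-- Interchange the colors on the components in `S`. -/
noncomputable def flip (S : Finset G.ConnectedComponent) (c : V → Bool) (v : V) : Bool :=
  if G.connectedComponentMk v ∈ S then !c v else c v

theorem flip_flip (S : Finset G.ConnectedComponent) (c : V → Bool) : flip S (flip S c) = c := by
  ext v
  simp only [flip]
  split_ifs <;> simp

open Classical in
/-- The number of vertices of color `t` in the component `C`. -/
noncomputable def count [Fintype V] (c : V → Bool) (C : G.ConnectedComponent) (t : Bool) : ℕ :=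
  (univ.filter fun v => G.connectedComponentMk v = C ∧ c v = t).card

theorem IsProper.flip {c : V → Bool} (hc : IsProper G c) (S : Finset G.ConnectedComponent) :
    IsProper G (flip S c) := by
  intro v w h
  have h1 : G.connectedComponentMk v = G.connectedComponentMk w :=
    SimpleGraph.ConnectedComponent.sound h.reachable
  have h2 := hc v w h
  unfold TwoColoring.flip
  rw [h1]
  split_ifs
  · simpa using h2
  · exact h2

theorem count_eq_or_weight_flip [Fintype V] [Monoid R] {g : Fin n → R} (hG : IsIncGraph P x G)
    (hg : P.Satisfies g) {c : V → Bool} (hc : IsProper G c) (C : G.ConnectedComponent) :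
    count c C false = count c C true ∨
      ((∃ t, count c C t = count c C (!t) + 1) ∧
        weight g x (flip {C} c) = weight g x c) := by
  classical
  obtain ⟨o, hx⟩ := exists_linearOrder_monotone x
  set L := (univ.filter fun v => G.connectedComponentMk v = C).sort (· ≤ ·) with hL
  have hmem : ∀ v, v ∈ L ↔ G.connectedComponentMk v = C := fun v => by simp [hL]
  have hcount : ∀ t, L.countP (fun v => c v == t) = count c C t := by
    intro t
    rw [count, ← Finset.filter_filter]
    have h1 : (L : Multiset V) = (univ.filter fun v => G.connectedComponentMk v = C).val :=
      Finset.sort_eq _ _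
    rw [Finset.card_def, Finset.filter_val, ← h1, Multiset.filter_coe, Multiset.coe_card,
      List.countP_eq_length_filter]
    congr 1
  obtain ⟨t, ht⟩ : ∃ t, ∀ a ∈ L.head?, c a = t := by
    cases L with
    | nil => exact ⟨true, by simp⟩
    | cons a l => exact ⟨c a, by simp⟩
  have key := path_balanced_or_commute hx hG hg hc t L (Finset.sortedLT_sort _).pairwise
    (by rw [hL]; convert isChain_component hx hG hc C) ht
  rw [hcount, hcount] at key
  rcases key with key | ⟨key, hcomm⟩
  · left
    cases t
    · exact key.symm
    · exact key
  · right
    refine ⟨⟨t, key⟩, ?_⟩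
    have hcomm' : Commute ((L.filter fun v => c v == false).map fun v => g (x v)).prod
        ((L.filter fun v => c v == true).map fun v => g (x v)).prod := by
      cases t
      · exact hcomm
      · exact hcomm.symm
    set K := (univ.filter fun v => G.connectedComponentMk v ≠ C).toList with hK
    have hmemK : ∀ v, v ∈ K ↔ G.connectedComponentMk v ≠ C := fun v => by simp [hK]
    have hfilter : ∀ l : List V, ((l.filter fun v => c v == false) ++
        l.filter fun v => c v == true).Perm l := by
      intro l
      have := List.filter_append_perm (fun v => c v == false) l
      convert this using 3
      ext v
      cases c v <;> rfl
    have hLK : (L ++ K).Perm univ.toList := by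
      rw [List.perm_ext_iff_of_nodup]
      · intro v
        simp only [List.mem_append, hmem, hmemK, mem_toList, mem_univ, iff_true]
        exact em _
      · rw [List.nodup_append]
        refine ⟨Finset.sort_nodup _ _, Finset.nodup_toList _, ?_⟩
        rintro a ha b hb rfl
        exact (hmemK a).1 hb ((hmem a).1 ha)
      · exact Finset.nodup_toList _
    have hadj : ∀ v ∈ L, ∀ w ∈ K, ¬ G.Adj v w := by
      intro v hv w hw h
      apply (hmemK w).1 hw
      rw [← (hmem v).1 hv]
      exact SimpleGraph.ConnectedComponent.sound h.symm.reachable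
    have hmf : ∀ (l : List V) (t : Bool) (v : V), v ∈ l.filter (fun v => c v == t) →
        v ∈ l ∧ c v = t := by
      intro l t v hv
      simpa using List.mem_filter.1 hv
    have hflipL : ∀ v ∈ L, flip {C} c v = !c v := fun v hv => by
      rw [flip, if_pos (by simpa using (hmem v).1 hv)]
    have hflipK : ∀ v ∈ K, flip {C} c v = c v := fun v hv => by
      rw [flip, if_neg (by simpa using (hmemK v).1 hv)]
    -- Both colorings are read along the component first and the rest afterwards; the two readings
    -- differ only in the order of the two color products on the component, which commute.
    have h1 : IsReading G c ((L.filter fun v => c v == false) ++ (L.filter fun v => c v == true) ++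
        ((K.filter fun v => c v == false) ++ K.filter fun v => c v == true)) := by
      refine isReading_append hc (((hfilter L).append (hfilter K)).trans hLK)
        (fun v hv => (hmf _ _ _ hv).2) (fun v hv => (hmf _ _ _ hv).2)
        (fun v hv => (hmf _ _ _ hv).2) (fun v hv => (hmf _ _ _ hv).2)
        (fun v hv w hw => hadj v (hmf _ _ _ hv).1 w (hmf _ _ _ hw).1)
    have h2 : IsReading G (flip {C} c) ((L.filter fun v => c v == true) ++
        (L.filter fun v => c v == false) ++
        ((K.filter fun v => c v == false) ++ K.filter fun v => c v == true)) := by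
      refine isReading_append (hc.flip _)
        (((List.perm_append_comm.trans (hfilter L)).append (hfilter K)).trans hLK)
        (fun v hv => ?_) (fun v hv => ?_) (fun v hv => ?_) (fun v hv => ?_)
        (fun v hv w hw => hadj v (hmf _ _ _ hv).1 w (hmf _ _ _ hw).1)
      · rw [hflipL v (hmf _ _ _ hv).1, (hmf _ _ _ hv).2]; rfl
      · rw [hflipK v (hmf _ _ _ hv).1, (hmf _ _ _ hv).2]
      · rw [hflipL v (hmf _ _ _ hv).1, (hmf _ _ _ hv).2]; rfl
      · rw [hflipK v (hmf _ _ _ hv).1, (hmf _ _ _ hv).2]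
    rw [← weight_eq_of_isReading hG hg hc h1, ← weight_eq_of_isReading hG hg (hc.flip _) h2]
    simp only [List.map_append, List.prod_append]
    rw [hcomm'.eq]

theorem count_flip [Fintype V] (c : V → Bool) (S : Finset G.ConnectedComponent)
    (C : G.ConnectedComponent) (t : Bool) [Decidable (C ∈ S)] :
    count (flip S c) C t = if C ∈ S then count c C (!t) else count c C t := by
  classical
  unfold count
  split_ifs with h
  · congr 1
    refine Finset.filter_congr fun v _ => and_congr_right fun hv => ?_
    rw [flip, if_pos (hv ▸ h)]
    cases c v <;> cases t <;> simp
  · congr 1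
    refine Finset.filter_congr fun v _ => and_congr_right fun hv => ?_
    rw [flip, if_neg (hv ▸ h)]

/-- The components in which the colors are not balanced. -/
noncomputable def oddComponents [Fintype V] (G : SimpleGraph V) (c : V → Bool) :
    Finset G.ConnectedComponent :=
  open Classical in univ.filter fun C => count c C false ≠ count c C true

/-- The components with more vertices of color `true`. -/
noncomputable def trueComponents [Fintype V] (G : SimpleGraph V) (c : V → Bool) :
    Finset G.ConnectedComponent :=
  open Classical in univ.filter fun C => count c C false + 1 = count c C true

/-- The components are flipped one at a time; earlier flips leave the counts in the current
component unchanged, so it is still unbalanced. -/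
theorem weight_flip [Fintype V] [Monoid R] {g : Fin n → R} (hG : IsIncGraph P x G)
    (hg : P.Satisfies g) {c : V → Bool} (hc : IsProper G c) (S : Finset G.ConnectedComponent)
    (hS : S ⊆ oddComponents G c) : weight g x (flip S c) = weight g x c := by
  classical
  induction S using Finset.induction_on with
  | empty =>
    congr 1
  | insert C S hC ih =>
    have h1 : flip (insert C S) c = flip {C} (flip S c) := by
      ext v
      simp only [flip, Finset.mem_insert, Finset.mem_singleton]
      by_cases h : G.connectedComponentMk v = C
      · simp [h, hC]
      · simp [h]
    rw [h1, ← ih ((Finset.subset_insert _ _).trans hS)]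
    rcases count_eq_or_weight_flip hG hg (hc.flip S) C with h | h
    · exfalso
      rw [count_flip, count_flip, if_neg hC, if_neg hC] at h
      have := hS (Finset.mem_insert_self C S)
      simp only [oddComponents, mem_filter, mem_univ, true_and] at this
      exact this h
    · exact h.2

end TwoColoring

/-! ### Enumeration of colorings by their unbalanced components -/

namespace TwoColoring

open Finset

variable {n : ℕ} {P : NatUnitIntervalOrder n} {V : Type*} [Fintype V] {x : V → Fin n}
  {G : SimpleGraph V} {R : Type*}

theorem count_cases (hG : IsIncGraph P x G) {c : V → Bool} (hc : IsProper G c)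
    (C : G.ConnectedComponent) : count c C false = count c C true ∨
      count c C false = count c C true + 1 ∨ count c C false + 1 = count c C true := by
  -- Only the numerical half of the dichotomy is wanted, so the letters are sent to the trivial
  -- monoid.
  have hg : P.Satisfies (fun _ : Fin n => ()) := ⟨fun _ _ _ => rfl, fun _ _ _ _ _ _ _ _ => rfl⟩
  rcases count_eq_or_weight_flip hG hg hc C with h | ⟨⟨t, h⟩, -⟩
  · exact Or.inl h
  · cases t
    · exact Or.inr (Or.inl h)
    · exact Or.inr (Or.inr h.symm)

/-- Vertices with the same letter are adjacent and have the same other neighbors. Such a neighbor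
would complete a triangle, so the two vertices form a component. Hence flipping unbalanced
components preserves admissibility. -/
theorem count_eq_of_same_letter (hG : IsIncGraph P x G) {c : V → Bool} (hc : IsProper G c)
    {v w : V} (hvw : v ≠ w) (hx : x v = x w) :
    count c (G.connectedComponentMk v) false = count c (G.connectedComponentMk v) true := by
  classical
  have hirr : ∀ a : Fin n, ¬ P.lt a a := fun a => not_lt.2 (P.le_m a)
  have hadj : G.Adj v w := (hG _ _).2 ⟨hvw, by rw [hx]; exact hirr _, by rw [hx]; exact hirr _⟩
  have hcvw := hc _ _ hadj
  have hadj_iff : ∀ z, z ≠ v → z ≠ w → (G.Adj v z ↔ G.Adj w z) := by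
    intro z hzv hzw
    rw [hG, hG, hx]
    exact and_congr_left fun _ => iff_of_true hzv.symm hzw.symm
  have hclosed : ∀ u, G.connectedComponentMk u = G.connectedComponentMk v → u = v ∨ u = w := by
    intro u hu
    have hr : G.Reachable v u := SimpleGraph.ConnectedComponent.exact hu.symm
    refine hr.mem_of_closed (s := {u | u = v ∨ u = w}) (fun u z hu hz => ?_) (Or.inl rfl)
    by_contra hn
    simp only [Set.mem_ofPred_eq, not_or] at hn
    have h1 := hadj_iff z hn.1 hn.2
    have h2 : G.Adj v z ∧ G.Adj w z := by
      rcases hu with rfl | rfl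
      · exact ⟨hz, h1.1 hz⟩
      · exact ⟨h1.2 hz, hz⟩
    have h3 := hc _ _ h2.1
    have h4 := hc _ _ h2.2
    cases hv : c v <;> cases hw : c w <;> cases hz : c z <;> simp_all
  have hw : G.connectedComponentMk w = G.connectedComponentMk v :=
    SimpleGraph.ConnectedComponent.sound hadj.symm.reachable
  have h1 : ∀ t, count c (G.connectedComponentMk v) t = 1 := by
    intro t
    rw [count, Finset.card_eq_one]
    refine ⟨if c v = t then v else w, ?_⟩
    ext u
    simp only [mem_filter, mem_univ, true_and, mem_singleton]
    constructor
    · rintro ⟨hu, hut⟩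
      rcases hclosed u hu with rfl | rfl
      · rw [if_pos hut]
      · rw [if_neg]
        intro h
        exact hcvw (h.trans hut.symm)
    · rintro rfl
      split_ifs with h
      · exact ⟨rfl, h⟩
      · refine ⟨hw, ?_⟩
        cases hv : c v <;> cases hw : c w <;> cases t <;> simp_all
  rw [h1, h1]

/-- The number of vertices of color `t`. -/
def total (c : V → Bool) (t : Bool) : ℕ := (univ.filter fun v => c v = t).card

theorem total_eq_sum (G : SimpleGraph V) [Fintype G.ConnectedComponent] (c : V → Bool) (t : Bool) :
    total c t = ∑ C : G.ConnectedComponent, count c C t := by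
  classical
  rw [total, Finset.card_eq_sum_card_fiberwise (f := G.connectedComponentMk) (t := univ)
    (fun _ _ => by simp)]
  refine Finset.sum_congr rfl fun C _ => ?_
  rw [count, Finset.filter_filter]
  congr 1
  exact Finset.filter_congr fun v _ => and_comm

theorem total_add_total (c : V → Bool) : total c false + total c true = Fintype.card V := by
  classical
  have h := Finset.card_filter_add_card_filter_not (s := (univ : Finset V)) (fun v => c v = false)
  simp only [Bool.not_eq_false] at h
  exact h

/-- Proper colorings in which a prescribed one of two vertices with the same letter is colored
`false`. -/
def IsAdmissible (G : SimpleGraph V) (T : V → V → Prop) (c : V → Bool) : Prop :=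
  IsProper G c ∧ ∀ v w, T v w → c v = false

theorem IsAdmissible.flip (hG : IsIncGraph P x G) {T : V → V → Prop}
    (hT : ∀ v w, T v w → v ≠ w ∧ x v = x w) {c : V → Bool} (hc : IsAdmissible G T c)
    {S : Finset G.ConnectedComponent} (hS : S ⊆ oddComponents G c) :
    IsAdmissible G T (flip S c) := by
  refine ⟨hc.1.flip S, fun v w h => ?_⟩
  rw [TwoColoring.flip, if_neg]
  · exact hc.2 v w h
  · intro hm
    have := hS hm
    simp only [oddComponents, mem_filter, mem_univ, true_and] at this
    exact this (count_eq_of_same_letter hG hc.1 (hT v w h).1 (hT v w h).2)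

theorem oddComponents_flip (c : V → Bool) (S : Finset G.ConnectedComponent) :
    oddComponents G (flip S c) = oddComponents G c := by
  classical
  ext C
  simp only [oddComponents, mem_filter, mem_univ, true_and, count_flip]
  split_ifs
  · exact ne_comm
  · rfl

theorem trueComponents_subset (c : V → Bool) : trueComponents G c ⊆ oddComponents G c := by
  intro C
  simp only [oddComponents, trueComponents, mem_filter, mem_univ, true_and]
  omega

theorem trueComponents_flip_self (hG : IsIncGraph P x G) {c : V → Bool} (hc : IsProper G c) :
    trueComponents G (flip (trueComponents G c) c) = ∅ := by
  classical
  ext C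
  simp only [trueComponents, mem_filter, mem_univ, true_and, count_flip, notMem_empty, iff_false]
  have := count_cases hG hc C
  split_ifs with h
  · simp only [Bool.not_false, Bool.not_true]
    omega
  · exact h

theorem count_of_trueComponents_eq_empty (hG : IsIncGraph P x G) {c : V → Bool}
    (hc : IsProper G c) (h : trueComponents G c = ∅) (C : G.ConnectedComponent)
    [Decidable (C ∈ oddComponents G c)] :
    count c C false = count c C true + if C ∈ oddComponents G c then 1 else 0 := by
  have h1 : C ∉ trueComponents G c := by simp [h]
  have h2 := count_cases hG hc C
  simp only [trueComponents, oddComponents, mem_filter, mem_univ, true_and] at h1 ⊢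
  split_ifs <;> omega

/-- The set of flipped components can be recovered from the result, which makes the decomposition in
`sum_colorings` bijective. -/
theorem trueComponents_flip (hG : IsIncGraph P x G) {c : V → Bool} (hc : IsProper G c)
    (h : trueComponents G c = ∅) {S : Finset G.ConnectedComponent} (hS : S ⊆ oddComponents G c) :
    trueComponents G (flip S c) = S := by
  classical
  ext C
  have h1 := count_of_trueComponents_eq_empty hG hc h C
  simp only [trueComponents, mem_filter, mem_univ, true_and, count_flip]
  by_cases hC : C ∈ S
  · simp only [hC, if_true, hS hC, iff_true, Bool.not_false, Bool.not_true] at h1 ⊢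
    omega
  · simp only [hC, if_false, iff_false]
    omega

theorem total_flip (hG : IsIncGraph P x G) {c : V → Bool} (hc : IsProper G c)
    (h : trueComponents G c = ∅) {S : Finset G.ConnectedComponent} (hS : S ⊆ oddComponents G c) :
    total (flip S c) true = total c true + S.card := by
  classical
  rw [total_eq_sum G, total_eq_sum G, card_eq_sum_ite (subset_univ _),
    ← Finset.sum_add_distrib]
  refine Finset.sum_congr rfl fun C _ => ?_
  have h1 := count_of_trueComponents_eq_empty hG hc h C
  rw [count_flip]
  by_cases hC : C ∈ S
  · simp only [hC, if_true, hS hC, Bool.not_true] at h1 ⊢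
    exact h1
  · simp [hC]

/-- Each unbalanced component contributes exactly one to the excess of `false` over `true`. -/
theorem card_oddComponents (hG : IsIncGraph P x G) {c : V → Bool} (hc : IsProper G c)
    (h : trueComponents G c = ∅) :
    (oddComponents G c).card = Fintype.card V - 2 * total c true := by
  classical
  have h1 : total c false = total c true + (oddComponents G c).card := by
    rw [total_eq_sum G, total_eq_sum G, card_eq_sum_ite (subset_univ _),
      ← Finset.sum_add_distrib]
    exact Finset.sum_congr rfl fun C _ => count_of_trueComponents_eq_empty hG hc h C
  have h2 := total_add_total c
  omega

theorem total_flip_oddComponents (c : V → Bool) :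
    total (flip (oddComponents G c) c) true = total c false := by
  classical
  rw [total_eq_sum G, total_eq_sum G]
  refine Finset.sum_congr rfl fun C _ => ?_
  rw [count_flip]
  split_ifs with h
  · rfl
  · simp only [oddComponents, mem_filter, mem_univ, true_and, not_not] at h
    exact h.symm

open Classical in
/-- The admissible colorings with `j` vertices of color `true`. -/
noncomputable def colorings (G : SimpleGraph V) (T : V → V → Prop) (j : ℕ) : Finset (V → Bool) :=
  univ.filter fun c => IsAdmissible G T c ∧ total c true = j

open Classical in
/-- The admissible colorings with `j` vertices of color `true` in which no component has more
vertices of color `true`. -/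
noncomputable def falseColorings (G : SimpleGraph V) (T : V → V → Prop) (j : ℕ) :
    Finset (V → Bool) :=
  univ.filter fun c => IsAdmissible G T c ∧ total c true = j ∧ trueComponents G c = ∅

theorem mem_colorings {T : V → V → Prop} {j : ℕ} {c : V → Bool} :
    c ∈ colorings G T j ↔ IsAdmissible G T c ∧ total c true = j := by
  simp [colorings]

theorem mem_falseColorings {T : V → V → Prop} {j : ℕ} {c : V → Bool} :
    c ∈ falseColorings G T j ↔
      IsAdmissible G T c ∧ total c true = j ∧ trueComponents G c = ∅ := by
  simp [falseColorings]

/-- Flipping all unbalanced components is an involution that interchanges the total numbers of the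
two colors. -/
theorem sum_colorings_comm [Ring R] {g : Fin n → R} (hG : IsIncGraph P x G)
    (hg : P.Satisfies g) {T : V → V → Prop} (hT : ∀ v w, T v w → v ≠ w ∧ x v = x w) {j : ℕ}
    (hj : j ≤ Fintype.card V) :
    ∑ c ∈ colorings G T j, weight g x c = ∑ c ∈ colorings G T (Fintype.card V - j), weight g x c := by
  have h : ∀ (c : V → Bool), flip (oddComponents G (flip (oddComponents G c) c))
      (flip (oddComponents G c) c) = c := fun c => by
    rw [oddComponents_flip, flip_flip]
  refine Finset.sum_bij' (fun c _ => flip (oddComponents G c) c)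
    (fun c _ => flip (oddComponents G c) c) ?_ ?_ (fun c _ => h c) (fun c _ => h c) ?_
  · intro c hc
    rw [mem_colorings] at hc ⊢
    refine ⟨hc.1.flip hG hT subset_rfl, ?_⟩
    rw [total_flip_oddComponents]
    have := total_add_total c
    omega
  · intro c hc
    rw [mem_colorings] at hc ⊢
    refine ⟨hc.1.flip hG hT subset_rfl, ?_⟩
    rw [total_flip_oddComponents]
    have := total_add_total c
    omega
  · intro c hc
    exact (weight_flip hG hg (mem_colorings.1 hc).1.1 _ subset_rfl).symm

/-- A coloring is determined by the set `S` of its components with a majority of `true` and by the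
coloring obtained by flipping `S`. If the latter has `i` vertices of color `true`, then `S` is any
set of `j - i` of its unbalanced components. -/
theorem sum_colorings [Ring R] {g : Fin n → R} (hG : IsIncGraph P x G)
    (hg : P.Satisfies g) {T : V → V → Prop} (hT : ∀ v w, T v w → v ≠ w ∧ x v = x w) (j : ℕ) :
    ∑ c ∈ colorings G T j, weight g x c = ∑ i ∈ range (j + 1),
      (Fintype.card V - 2 * i).choose (j - i) • ∑ c ∈ falseColorings G T i, weight g x c := by
  classical
  let A : Finset ((V → Bool) × Finset G.ConnectedComponent) := univ.filter fun p =>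
    IsAdmissible G T p.1 ∧ trueComponents G p.1 = ∅ ∧ p.2 ⊆ oddComponents G p.1 ∧
      total p.1 true + p.2.card = j
  have hA : ∀ p, p ∈ A ↔ IsAdmissible G T p.1 ∧ trueComponents G p.1 = ∅ ∧
      p.2 ⊆ oddComponents G p.1 ∧ total p.1 true + p.2.card = j := fun p => by simp [A]
  have h1 : ∑ c ∈ colorings G T j, weight g x c = ∑ p ∈ A, weight g x p.1 := by
    refine Finset.sum_bij' (fun c _ => (flip (trueComponents G c) c, trueComponents G c))
      (fun p _ => flip p.2 p.1) ?_ ?_ ?_ ?_ ?_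
    · intro c hc
      rw [mem_colorings] at hc
      have h2 := trueComponents_flip_self hG hc.1.1
      have h3 : trueComponents G c ⊆ oddComponents G (flip (trueComponents G c) c) := by
        rw [oddComponents_flip]
        exact trueComponents_subset c
      rw [hA]
      refine ⟨hc.1.flip hG hT (trueComponents_subset c), h2, h3, ?_⟩
      rw [← total_flip hG (hc.1.1.flip _) h2 h3, flip_flip]
      exact hc.2
    · intro p hp
      rw [hA] at hp
      rw [mem_colorings, total_flip hG hp.1.1 hp.2.1 hp.2.2.1]
      exact ⟨hp.1.flip hG hT hp.2.2.1, hp.2.2.2⟩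
    · intro c hc
      exact flip_flip _ _
    · intro p hp
      rw [hA] at hp
      have h2 := trueComponents_flip hG hp.1.1 hp.2.1 hp.2.2.1
      ext1
      · simp only [h2, flip_flip]
      · exact h2
    · intro c hc
      exact (weight_flip hG hg (mem_colorings.1 hc).1.1 _ (trueComponents_subset c)).symm
  rw [h1, ← Finset.sum_fiberwise_of_maps_to (t := range (j + 1)) (g := fun p => total p.1 true)]
  · refine Finset.sum_congr rfl fun i hi => ?_
    rw [Finset.mem_range] at hi
    rw [Finset.sum_finset_product _ (falseColorings G T i)
      fun c => powersetCard (j - i) (oddComponents G c), Finset.smul_sum]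
    · refine Finset.sum_congr rfl fun c hc => ?_
      rw [mem_falseColorings] at hc
      simp only
      rw [Finset.sum_const, Finset.card_powersetCard, card_oddComponents hG hc.1.1 hc.2.2, hc.2.1]
    · intro p
      rw [mem_filter, hA, mem_falseColorings, mem_powersetCard]
      constructor
      · rintro ⟨⟨a, b, c, d⟩, e⟩
        exact ⟨⟨a, e, b⟩, c, by omega⟩
      · rintro ⟨⟨a, b, c⟩, d, e⟩
        exact ⟨⟨a, c, d, by omega⟩, b⟩
  · intro p hp
    rw [hA] at hp
    rw [Finset.mem_range]
    omega

end TwoColoring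

/-! ### Pairs of chains as two-colorings of the blocks -/

namespace NatUnitIntervalOrder

open Finset TwoColoring

variable {n : ℕ} (P : NatUnitIntervalOrder n)

open Classical in
/-- The chains of `P` with `k` elements. -/
noncomputable def chainSets (k : ℕ) : Finset (Finset (Fin n)) :=
  univ.filter fun S => S.card = k ∧ (S : Set (Fin n)).Pairwise fun a b => P.lt a b ∨ P.lt b a

theorem mem_chainSets {k : ℕ} {S : Finset (Fin n)} : S ∈ P.chainSets k ↔
    S.card = k ∧ (S : Set (Fin n)).Pairwise fun a b => P.lt a b ∨ P.lt b a := by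
  simp [chainSets]

theorem lt_of_lt {P : NatUnitIntervalOrder n} {a b : Fin n} (h : P.lt a b) : a < b :=
  lt_of_le_of_lt (P.le_m a) h

open Classical in
theorem sum_isChain_eq_sum_chainSets {M : Type*} [AddCommMonoid M] (k : ℕ)
    (F : List (Fin n) → M) :
    ∑ i : Fin k → Fin n with (List.ofFn i).IsChain (fun a b => P.lt b a), F (List.ofFn i) =
      ∑ S ∈ P.chainSets k, F (S.sort (· ≥ ·)) := by
  have htrans : IsTrans (Fin n) fun a b => P.lt b a := ⟨fun _ _ _ h1 h2 => Heap.lt_trans' h2 h1⟩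
  have hnd : ∀ l : List (Fin n), l.IsChain (fun a b => P.lt b a) → l.Nodup := fun l hl =>
    hl.pairwise.imp fun h => (lt_of_lt h).ne'
  have hsort : ∀ l : List (Fin n), l.IsChain (fun a b => P.lt b a) →
      l.toFinset.sort (· ≥ ·) = l := fun l hl =>
    (List.toFinset_sort _ (hnd l hl)).2 (hl.pairwise.imp fun h => (lt_of_lt h).le)
  refine Finset.sum_bij (fun i _ => (List.ofFn i).toFinset) ?_ ?_ ?_ ?_
  · intro i hi
    have hi := (mem_filter.1 hi).2
    rw [mem_chainSets, List.toFinset_card_of_nodup (hnd _ hi)]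
    refine ⟨List.length_ofFn, ?_⟩
    have h1 : (List.ofFn i).Pairwise fun a b => P.lt a b ∨ P.lt b a :=
      hi.pairwise.imp fun h => Or.inr h
    intro a ha b hb hab
    have : Std.Symm fun a b => P.lt a b ∨ P.lt b a := ⟨fun _ _ h => h.symm⟩
    exact h1.forall (by simpa using ha) (by simpa using hb) hab
  · intro i hi j hj h
    have hi := hsort _ (mem_filter.1 hi).2
    have hj := hsort _ (mem_filter.1 hj).2
    apply List.ofFn_injective
    rw [← hi, ← hj, h]
  · intro S hS
    rw [mem_chainSets] at hS
    have hlen : (S.sort (· ≥ ·)).length = k := by rw [Finset.length_sort, hS.1]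
    have h1 : List.ofFn (fun j : Fin k => (S.sort (· ≥ ·)).get (j.cast hlen.symm)) =
        S.sort (· ≥ ·) := by
      apply List.ext_getElem
      · simp [hS.1]
      · intro j h1 h2
        simp
    refine ⟨_, ?_, (congrArg List.toFinset h1).trans (Finset.sort_toFinset _ _)⟩
    rw [mem_filter, h1]
    refine ⟨mem_univ _, List.Pairwise.isChain ?_⟩
    refine List.Pairwise.imp_of_mem ?_ (Finset.sortedGT_sort S).pairwise
    intro a b ha hb hab
    rcases hS.2 (by simpa using ha) (by simpa using hb) hab.ne' with h | h
    · exact absurd (lt_of_lt h) (not_lt.2 hab.le)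
    · exact h
  · intro i hi
    rw [hsort _ (mem_filter.1 hi).2]

/-- The image of `e_k(u)` under a map from the letters to a ring. -/
noncomputable def elemIn {R : Type*} [Ring R] (g : Fin n → R) (k : ℕ) : R :=
  ∑ S ∈ P.chainSets k, ((S.sort (· ≥ ·)).map g).prod

theorem map_u {R : Type*} [Ring R] (f : FreeAlgebra ℤ (Fin n) →+* R) (w : List (Fin n)) :
    f (u w) = (w.map fun a => f (FreeAlgebra.ι ℤ a)).prod := by
  rw [u, map_list_prod, List.map_map]
  rfl

theorem map_elem {R : Type*} [Ring R] (f : FreeAlgebra ℤ (Fin n) →+* R) (k : ℕ) :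
    f (P.elem k) = P.elemIn (fun a => f (FreeAlgebra.ι ℤ a)) k := by
  rw [elem, sum_isChain_eq_sum_chainSets P k, map_sum, elemIn]
  simp only [map_u]

theorem isIncGraph_blockGraph (μ : Fin n → ℕ) :
    IsIncGraph P (fun v : Block μ => v.1) (P.blockGraph μ) := by
  intro v w
  have hirr : ∀ a : Fin n, ¬ P.lt a a := fun a h => Heap.lt_irrefl' h
  simp only [blockGraph, inc]
  refine and_congr_right fun _ => ⟨?_, fun h => ?_⟩
  · rintro (h | h)
    · rw [h]
      exact ⟨hirr _, hirr _⟩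
    · exact h.2
  · by_cases hvw : v.1 = w.1
    · exact Or.inl hvw
    · exact Or.inr ⟨hvw, h⟩

/-- `v` and `w` have the same letter, and `v` comes first. -/
def Lower (μ : Fin n → ℕ) (v w : Block μ) : Prop := v.1 = w.1 ∧ (v.2 : ℕ) < w.2

theorem Lower.ne_and_eq {μ : Fin n → ℕ} (v w : Block μ) (h : Lower μ v w) :
    v ≠ w ∧ v.1 = w.1 :=
  ⟨fun hvw => by rw [hvw] at h; exact lt_irrefl _ h.2, h.1⟩

theorem lower_or_lower {μ : Fin n → ℕ} {v w : Block μ} (hvw : v ≠ w) (h : v.1 = w.1) :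
    Lower μ v w ∨ Lower μ w v := by
  obtain ⟨a, i⟩ := v
  obtain ⟨b, j⟩ := w
  obtain rfl : a = b := h
  rcases lt_trichotomy i j with h | h | h
  · exact Or.inl ⟨rfl, h⟩
  · exact absurd (by rw [h]) hvw
  · exact Or.inr ⟨rfl, h⟩

/-- The letters of the blocks of color `t`. -/
def letters {μ : Fin n → ℕ} (c : Block μ → Bool) (t : Bool) : Finset (Fin n) :=
  (univ.filter fun v => c v = t).image Sigma.fst

theorem mem_letters {μ : Fin n → ℕ} {c : Block μ → Bool} {t : Bool} {a : Fin n} :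
    a ∈ letters c t ↔ ∃ v, c v = t ∧ v.1 = a := by
  simp [letters]

variable {P}

theorem eq_of_color_eq {μ : Fin n → ℕ} {c : Block μ → Bool} (hc : IsProper (P.blockGraph μ) c)
    {v w : Block μ} (h : c v = c w) (hvw : v.1 = w.1) : v = w := by
  by_contra hne
  exact hc v w ⟨hne, Or.inl hvw⟩ h

theorem card_letters {μ : Fin n → ℕ} {c : Block μ → Bool} (hc : IsProper (P.blockGraph μ) c)
    (t : Bool) : (letters c t).card = total c t := by
  rw [letters, Finset.card_image_of_injOn, total]
  intro v hv w hw hvw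
  simp only [coe_filter, mem_univ, true_and, Set.mem_ofPred_eq] at hv hw
  exact eq_of_color_eq hc (hv.trans hw.symm) hvw

theorem letters_mem_chainSets {μ : Fin n → ℕ} {c : Block μ → Bool}
    (hc : IsProper (P.blockGraph μ) c) (t : Bool) : letters c t ∈ P.chainSets (total c t) := by
  rw [mem_chainSets]
  refine ⟨card_letters hc t, ?_⟩
  intro a ha b hb hab
  obtain ⟨v, hv, rfl⟩ := mem_letters.1 ha
  obtain ⟨w, hw, rfl⟩ := mem_letters.1 hb
  exact Heap.comparable (P := P) (fun h => hab (by rw [h])) fun h => hc _ _ h (hv.trans hw.symm)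

/-- The multiplicities of the letters in two sets. -/
def pairType (p : Finset (Fin n) × Finset (Fin n)) (a : Fin n) : ℕ :=
  (if a ∈ p.1 then 1 else 0) + if a ∈ p.2 then 1 else 0

theorem pairType_letters {μ : Fin n → ℕ} {c : Block μ → Bool}
    (hc : IsProper (P.blockGraph μ) c) : pairType (letters c false, letters c true) = μ := by
  funext a
  have h1 : ∀ t, (univ.filter fun i : Fin (μ a) => c ⟨a, i⟩ = t).card =
      if a ∈ letters c t then 1 else 0 := by
    intro t
    split_ifs with h
    · obtain ⟨⟨b, i⟩, hi, rfl⟩ := mem_letters.1 h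
      rw [Finset.card_eq_one]
      refine ⟨i, ?_⟩
      ext j
      simp only [mem_filter, mem_univ, true_and, mem_singleton]
      refine ⟨fun hj => ?_, fun hj => by rw [hj]; exact hi⟩
      have := eq_of_color_eq hc (hj.trans hi.symm) rfl
      simpa using this
    · rw [Finset.card_eq_zero, Finset.filter_eq_empty_iff]
      exact fun i _ hi => h (mem_letters.2 ⟨_, hi, rfl⟩)
  rw [pairType, ← h1, ← h1]
  have h2 := Finset.card_filter_add_card_filter_not (s := (univ : Finset (Fin (μ a))))
    (fun i => c ⟨a, i⟩ = false)
  simp only [Bool.not_eq_false, card_univ, Fintype.card_fin] at h2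
  exact h2

/-- The letter sets determine the color of every letter occurring once; for a letter in both sets,
admissibility prescribes which block has color `false`. -/
theorem letters_injective {μ : Fin n → ℕ} {c c' : Block μ → Bool}
    (hc : IsAdmissible (P.blockGraph μ) (Lower μ) c)
    (hc' : IsAdmissible (P.blockGraph μ) (Lower μ) c')
    (h : ∀ t, letters c t = letters c' t) : c = c' := by
  have key : ∀ {c c' : Block μ → Bool}, IsAdmissible (P.blockGraph μ) (Lower μ) c →
      IsAdmissible (P.blockGraph μ) (Lower μ) c' → (∀ t, letters c t = letters c' t) →
      ∀ v, c v = false → c' v = false := by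
    intro c c' hc hc' h v hv
    by_contra hv'
    rw [Bool.not_eq_false] at hv'
    have h1 : v.1 ∈ letters c true := by
      rw [h]
      exact mem_letters.2 ⟨v, hv', rfl⟩
    obtain ⟨w, hw, hwv⟩ := mem_letters.1 h1
    have hne : v ≠ w := by
      rintro rfl
      rw [hv] at hw
      exact absurd hw (by simp)
    rcases lower_or_lower hne hwv.symm with h2 | h2
    · rw [hc'.2 _ _ h2] at hv'
      exact absurd hv' (by simp)
    · rw [hc.2 _ _ h2] at hw
      exact absurd hw (by simp)
  funext v
  have h1 := key hc hc' h v
  have h2 := key hc' hc (fun t => (h t).symm) v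
  cases hv : c v <;> cases hv' : c' v <;> simp_all

theorem exists_coloring {μ : Fin n → ℕ} {k l : ℕ} {S T : Finset (Fin n)} (hS : S ∈ P.chainSets k)
    (hT : T ∈ P.chainSets l) (hμ : pairType (S, T) = μ) :
    ∃ c, IsAdmissible (P.blockGraph μ) (Lower μ) c ∧ letters c false = S ∧ letters c true = T := by
  rw [mem_chainSets] at hS hT
  -- The first block of each letter of `S` receives color `false`; what remains is one block for
  -- each letter of `T`.
  let c : Block μ → Bool := fun v => !decide (v.1 ∈ S ∧ (v.2 : ℕ) = 0)
  have hf : ∀ v, c v = false ↔ v.1 ∈ S ∧ (v.2 : ℕ) = 0 := fun v => by simp [c]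
  have hμ' : ∀ a, μ a = (if a ∈ S then 1 else 0) + if a ∈ T then 1 else 0 := fun a => by
    rw [← hμ]
    rfl
  have ht : ∀ v, c v = true → v.1 ∈ T := by
    intro v hv
    have h1 : ¬ (v.1 ∈ S ∧ (v.2 : ℕ) = 0) := fun h => by
      rw [← hf, hv] at h
      exact absurd h (by simp)
    have h2 := v.2.2
    have h3 := hμ' v.1
    by_contra h4
    rw [if_neg h4] at h3
    split_ifs at h3 with h5
    · exact h1 ⟨h5, by omega⟩
    · omega
  have hlow : ∀ v w, Lower μ v w → (c v = false ∧ c w = true) := by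
    intro v w h
    have h2 := v.2.2
    have h4 := w.2.2
    have h3 := hμ' v.1
    have h5 := h.2
    have h6 : μ v.1 = μ w.1 := by rw [h.1]
    have h7 : v.1 ∈ S := by
      by_contra h7
      rw [if_neg h7] at h3
      split_ifs at h3 <;> omega
    rw [if_pos h7] at h3
    refine ⟨(hf v).2 ⟨h7, ?_⟩, ?_⟩
    · split_ifs at h3 <;> omega
    · by_contra h8
      rw [Bool.not_eq_true, hf] at h8
      omega
  refine ⟨c, ⟨fun v w hvw h => ?_, fun v w h => (hlow v w h).1⟩, ?_, ?_⟩
  · by_cases hl : v.1 = w.1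
    · rcases lower_or_lower hvw.1 hl with h1 | h1
      · rw [(hlow _ _ h1).1, (hlow _ _ h1).2] at h
        exact absurd h (by simp)
      · rw [(hlow _ _ h1).1, (hlow _ _ h1).2] at h
        exact absurd h (by simp)
    · have h1 := ((P.isIncGraph_blockGraph μ v w).1 hvw).2
      cases hv : c v
      · rw [hv] at h
        have := hS.2 ((hf v).1 hv).1 ((hf w).1 h.symm).1 hl
        tauto
      · rw [hv] at h
        have := hT.2 (ht v hv) (ht w h.symm) hl
        tauto
  · ext a
    rw [mem_letters]
    constructor
    · rintro ⟨v, hv, rfl⟩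
      exact ((hf v).1 hv).1
    · intro ha
      have h1 := hμ' a
      rw [if_pos ha] at h1
      exact ⟨⟨a, ⟨0, by omega⟩⟩, (hf _).2 ⟨ha, rfl⟩, rfl⟩
  · ext a
    rw [mem_letters]
    constructor
    · rintro ⟨v, hv, rfl⟩
      exact ht v hv
    · intro ha
      have h1 := hμ' a
      rw [if_pos ha] at h1
      refine ⟨⟨a, ⟨μ a - 1, by omega⟩⟩, ?_, rfl⟩
      by_contra h2
      rw [Bool.not_eq_true, hf] at h2
      simp only at h2
      rw [if_pos h2.1] at h1
      omega

theorem Satisfies.commute_of_mem {R : Type*} [Monoid R] {g : Fin n → R} (hg : P.Satisfies g)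
    {k : ℕ} {S : Finset (Fin n)} (hS : S ∈ P.chainSets k) {a b : Fin n} (ha : a ∈ S) (hb : b ∈ S) :
    Commute (g a) (g b) := by
  by_cases hab : a = b
  · rw [hab]
  · rcases ((P.mem_chainSets).1 hS).2 ha hb hab with h | h
    · exact hg.comm _ _ h
    · exact (hg.comm _ _ h).symm

/-- Letters of one color form a chain, so they commute and the order of the factors is irrelevant.
-/
theorem prod_sort_letters {R : Type*} [Monoid R] {g : Fin n → R} (hg : P.Satisfies g)
    {μ : Fin n → ℕ} {c : Block μ → Bool} (hc : IsProper (P.blockGraph μ) c) (t : Bool) :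
    (((letters c t).sort (· ≥ ·)).map g).prod =
      ((univ.filter fun v => c v = t).toList.map fun v => g v.1).prod := by
  have h1 : ((letters c t).sort (· ≥ ·)).Perm
      ((univ.filter fun v => c v = t).toList.map Sigma.fst) := by
    rw [List.perm_ext_iff_of_nodup]
    · intro a
      simp [mem_letters]
    · exact Finset.sort_nodup _ _
    · refine List.Nodup.map_on ?_ (Finset.nodup_toList _)
      intro v hv w hw hvw
      simp only [mem_toList, mem_filter, mem_univ, true_and] at hv hw
      exact eq_of_color_eq hc (hv.trans hw.symm) hvw
  have h2 := h1.map g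
  rw [List.map_map] at h2
  refine h2.prod_eq' ?_
  rw [List.pairwise_map]
  refine List.Pairwise.imp_of_mem (R := fun _ _ => True) (fun ha hb _ => ?_)
    (List.pairwise_of_forall fun _ _ => trivial)
  exact hg.commute_of_mem (letters_mem_chainSets hc t) (by simpa using ha) (by simpa using hb)

theorem elemIn_mul_elemIn {R : Type*} [Ring R] {g : Fin n → R} (hg : P.Satisfies g) (k l : ℕ) :
    P.elemIn g k * P.elemIn g l = ∑ μ ∈ piAntidiag (univ : Finset (Fin n)) (k + l),
      ∑ c ∈ colorings (P.blockGraph μ) (Lower μ) l, weight g (fun v : Block μ => v.1) c := by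
  classical
  rw [elemIn, elemIn, Finset.sum_mul_sum, ← Finset.sum_product',
    ← Finset.sum_fiberwise_of_maps_to (t := piAntidiag (univ : Finset (Fin n)) (k + l))
      (g := pairType)]
  · refine Finset.sum_congr rfl fun μ hμ => ?_
    rw [mem_piAntidiag] at hμ
    have hcard : Fintype.card (Block μ) = k + l := by
      rw [← hμ.1]
      simp
    symm
    refine Finset.sum_bij (fun c _ => (letters c false, letters c true)) ?_ ?_ ?_ ?_
    · intro c hc
      rw [mem_colorings] at hc
      have h1 := total_add_total c
      have h2 := letters_mem_chainSets hc.1.1 false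
      have h3 := letters_mem_chainSets hc.1.1 true
      rw [hc.2] at h3
      rw [show total c false = k by omega] at h2
      rw [mem_filter, mem_product]
      exact ⟨⟨h2, h3⟩, pairType_letters hc.1.1⟩
    · intro c hc c' hc' h
      rw [mem_colorings] at hc hc'
      rw [Prod.mk.injEq] at h
      refine letters_injective hc.1 hc'.1 fun t => ?_
      cases t
      · exact h.1
      · exact h.2
    · rintro ⟨S, T⟩ hST
      rw [mem_filter, mem_product] at hST
      obtain ⟨c, hc, h1, h2⟩ := exists_coloring hST.1.1 hST.1.2 hST.2
      refine ⟨c, ?_, by rw [h1, h2]⟩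
      rw [mem_colorings, ← card_letters hc.1, h2]
      exact ⟨hc, ((P.mem_chainSets).1 hST.1.2).1⟩
    · intro c hc
      rw [mem_colorings] at hc
      rw [weight, List.map_append, List.prod_append, ← prod_sort_letters hg hc.1.1,
        ← prod_sort_letters hg hc.1.1]
  · rintro ⟨S, T⟩ hST
    rw [mem_product, mem_chainSets, mem_chainSets] at hST
    rw [mem_piAntidiag]
    refine ⟨?_, fun _ _ => mem_univ _⟩
    change ∑ a, ((if a ∈ S then 1 else 0) + if a ∈ T then 1 else 0) = k + l
    rw [Finset.sum_add_distrib, ← card_eq_sum_ite (subset_univ _),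
      ← card_eq_sum_ite (subset_univ _), hST.1.1, hST.2.1]

end NatUnitIntervalOrder

/-! ### Heaps of rank at most two as two-colorings -/

namespace Heap

open Finset TwoColoring NatUnitIntervalOrder

variable {n : ℕ} {P : NatUnitIntervalOrder n} {μ : Fin n → ℕ} (H : Heap P μ)

theorem rank_lt_of_arrow {v w : Block μ} (h : H.arrow v w) : H.rank w < H.rank v := by
  obtain ⟨l, hl, hh, ⟨s, hs, hss⟩, hlen⟩ := (H.isGreatest_rank w).1
  cases l with
  | nil => simp at hh
  | cons y l =>
    obtain rfl : y = w := by simpa using hh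
    refine (H.isGreatest_rank v).2 ⟨v :: y :: l, List.IsChain.cons_cons h hl, rfl,
      ⟨s, by simpa using hs, hss⟩, ?_⟩
    rw [List.length_cons, hlen]

theorem one_le_rank (v : Block μ) : 1 ≤ H.rank v := by
  obtain ⟨l, -, hh, -, hlen⟩ := (H.isGreatest_rank v).1
  rw [← hlen]
  cases l with
  | nil => simp at hh
  | cons y l => simp

/-- The coloring of the blocks of a heap by rank; `true` means rank `2`. -/
noncomputable def color (v : Block μ) : Bool := decide (H.rank v = 2)

variable {H}

theorem color_eq_true {v : Block μ} : H.color v = true ↔ H.rank v = 2 := by simp [color]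

theorem color_eq_false (h : ∀ v, H.rank v ≤ 2) {v : Block μ} :
    H.color v = false ↔ H.rank v = 1 := by
  have := h v
  have := H.one_le_rank v
  rw [← Bool.not_eq_true, color_eq_true]
  omega

theorem color_of_arrow (h : ∀ v, H.rank v ≤ 2) {v w : Block μ} (hvw : H.arrow v w) :
    H.color v = true ∧ H.color w = false := by
  rw [color_eq_true, color_eq_false h]
  have := H.rank_lt_of_arrow hvw
  have := h v
  have := H.one_le_rank w
  omega

theorem isAdmissible_color (h : ∀ v, H.rank v ≤ 2) :
    IsAdmissible (P.blockGraph μ) (Lower μ) H.color := by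
  refine ⟨fun v w hvw => ?_, ?_⟩
  · rcases H.arrow_or_arrow _ _ hvw with h1 | h1
    · rw [(color_of_arrow h h1).1, (color_of_arrow h h1).2]
      simp
    · rw [(color_of_arrow h h1).1, (color_of_arrow h h1).2]
      simp
  · rintro ⟨a, i⟩ ⟨b, j⟩ ⟨hab, hij⟩
    obtain rfl : a = b := hab
    exact (color_of_arrow h (H.toward a i j hij)).2

theorem arrow_iff_color (h : ∀ v, H.rank v ≤ 2) (v w : Block μ) : H.arrow v w ↔
    (P.blockGraph μ).Adj v w ∧ H.color v = true ∧ H.color w = false := by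
  refine ⟨fun hvw => ⟨H.adj_of_arrow _ _ hvw, color_of_arrow h hvw⟩, ?_⟩
  rintro ⟨hadj, hv, -⟩
  rcases H.arrow_or_arrow _ _ hadj with h1 | h1
  · exact h1
  · rw [(color_of_arrow h h1).2] at hv
    exact absurd hv (by simp)

/-- Type W means one more block of rank 2 than of rank 1, so these are the components with a
majority of `true`. The number of blocks of rank 1 is forced by the total. -/
theorem isTwoColumn_iff {k l : ℕ} (hcard : k + l = ∑ a, μ a) (h : ∀ v, H.rank v ≤ 2) :
    H.IsTwoColumn k l ↔ total H.color true = l ∧ trueComponents (P.blockGraph μ) H.color = ∅ := by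
  classical
  have h1 : (univ.filter fun v => H.rank v = 1).card = total H.color false := by
    rw [total]
    congr 1
    exact Finset.filter_congr fun v _ => (color_eq_false h).symm
  have h2 : (univ.filter fun v => H.rank v = 2).card = total H.color true := by
    rw [total]
    congr 1
    exact Finset.filter_congr fun v _ => color_eq_true.symm
  have h3 : ∀ C, H.IsTypeW C ↔ count H.color C false + 1 = count H.color C true := by
    intro C
    rw [IsTypeW, and_iff_right fun v _ => h v, count, count]
    have h4 : (univ.filter fun v => v ∈ C.supp ∧ H.rank v = 1) = univ.filter fun v =>
        (P.blockGraph μ).connectedComponentMk v = C ∧ H.color v = false :=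
      Finset.filter_congr fun v _ => and_congr Iff.rfl (color_eq_false h).symm
    have h5 : (univ.filter fun v => v ∈ C.supp ∧ H.rank v = 2) = univ.filter fun v =>
        (P.blockGraph μ).connectedComponentMk v = C ∧ H.color v = true :=
      Finset.filter_congr fun v _ => and_congr Iff.rfl color_eq_true.symm
    rw [← h4, ← h5]
  have h6 := total_add_total H.color
  have h7 : Fintype.card (Block μ) = ∑ a, μ a := by simp
  rw [IsTwoColumn, and_iff_right h, trueComponents, Finset.filter_eq_empty_iff]
  simp only [h3]
  have h8 : (univ.filter fun v => H.rank v = 1).card = k ∧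
      (univ.filter fun v => H.rank v = 2).card = l ↔ total H.color true = l := by
    rw [h1, h2]
    omega
  rw [← h8, and_assoc]
  simp

/-- Every linear extension of the heap is a reading of its coloring by rank, so the choice of the
word without descents does not matter here. -/
theorem prod_word {R : Type*} [Monoid R] {g : Fin n → R} (hg : P.Satisfies g)
    (h : ∀ v, H.rank v ≤ 2) :
    (H.word.map g).prod = weight g (fun v : Block μ => v.1) H.color := by
  obtain ⟨f, hf, hw⟩ := H.existsUnique_word.choose_spec.1.1
  have hc := isAdmissible_color h
  have h1 : IsReading (P.blockGraph μ) H.color (List.ofFn f.symm) := by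
    constructor
    · rw [List.perm_ext_iff_of_nodup]
      · intro v
        simp only [List.mem_ofFn, mem_toList, mem_univ, iff_true]
        exact f.symm.surjective v
      · exact List.nodup_ofFn.2 f.symm.injective
      · exact Finset.nodup_toList _
    · rw [List.pairwise_ofFn]
      intro i j hij hadj
      rcases H.arrow_or_arrow _ _ hadj with h2 | h2
      · have := hf _ _ h2
        simp only [Equiv.apply_symm_apply] at this
        exact absurd hij (lt_asymm this)
      · exact (color_of_arrow h h2).2
  rw [← weight_eq_of_isReading (P.isIncGraph_blockGraph μ) hg hc.1 h1, word, hw, wordOf,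
    List.map_ofFn, List.map_ofFn]
  rfl

/-- The heap of rank at most `2` with a given coloring. -/
def ofColoring (c : Block μ → Bool) (hc : IsAdmissible (P.blockGraph μ) (Lower μ) c) :
    Heap P μ where
  arrow v w := (P.blockGraph μ).Adj v w ∧ c v = true ∧ c w = false
  adj_of_arrow _ _ h := h.1
  arrow_or_arrow v w h := by
    have := hc.1 v w h
    cases hv : c v <;> cases hw : c w <;> simp_all [SimpleGraph.adj_comm]
  acyclic v h := by
    -- A directed path starts at a `true` block and ends at a `false` one, so it is not closed.
    have key : ∀ w, Relation.TransGen (fun v w => (P.blockGraph μ).Adj v w ∧ c v = true ∧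
        c w = false) v w → c v = true ∧ c w = false := by
      intro w hw
      induction hw with
      | single h => exact h.2
      | tail _ h ih => exact ⟨ih.1, h.2.2⟩
    have := key v h
    rw [this.1] at this
    exact absurd this.2 (by simp)
  toward a i j hij := by
    have h1 : (P.blockGraph μ).Adj ⟨a, j⟩ ⟨a, i⟩ :=
      ⟨fun h => by simp at h; exact hij.ne' h, Or.inl rfl⟩
    have h2 := hc.2 ⟨a, i⟩ ⟨a, j⟩ ⟨rfl, hij⟩
    have h3 := hc.1 _ _ h1
    rw [h2, ne_eq, Bool.not_eq_false] at h3
    exact ⟨h1, h3, h2⟩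

theorem rank_ofColoring_of_false {c : Block μ → Bool}
    (hc : IsAdmissible (P.blockGraph μ) (Lower μ) c) {v : Block μ} (hv : c v = false) :
    (ofColoring c hc).rank v = 1 := by
  obtain ⟨l, hl, hh, -, hlen⟩ := ((ofColoring c hc).isGreatest_rank v).1
  rw [← hlen]
  match l, hl, hh with
  | [_], _, _ => rfl
  | a :: b :: l, hl, hh =>
    obtain rfl : a = v := by simpa using hh
    have := (List.isChain_cons_cons.1 hl).1.2.1
    rw [hv] at this
    exact absurd this (by simp)

theorem rank_ofColoring_le {c : Block μ → Bool}
    (hc : IsAdmissible (P.blockGraph μ) (Lower μ) c) (v : Block μ) :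
    (ofColoring c hc).rank v ≤ 2 := by
  obtain ⟨l, hl, hh, -, hlen⟩ := ((ofColoring c hc).isGreatest_rank v).1
  rw [← hlen]
  match l, hl, hh with
  | [_], _, _ => simp
  | [_, _], _, _ => simp
  | a :: b :: z :: l, hl, hh =>
    rw [List.isChain_cons_cons, List.isChain_cons_cons] at hl
    have h1 := hl.1.2.2
    have h2 := hl.2.1.2.1
    rw [h1] at h2
    exact absurd h2 (by simp)

/-- An isolated vertex of color `true` would itself be a component with more `true` than `false`. -/
theorem exists_adj_of_trueComponents {V : Type*} [Fintype V] {G : SimpleGraph V} {c : V → Bool}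
    (h : trueComponents G c = ∅) {v : V} (hv : c v = true) : ∃ w, G.Adj v w := by
  classical
  by_contra hn
  push Not at hn
  have h1 : ∀ w, G.connectedComponentMk w = G.connectedComponentMk v → w = v := by
    intro w hw
    have hr : G.Reachable v w := SimpleGraph.ConnectedComponent.exact hw.symm
    refine hr.mem_of_closed (s := {v}) ?_ rfl
    rintro u z rfl huz
    exact absurd huz (hn z)
  have h2 : G.connectedComponentMk v ∈ trueComponents G c := by
    simp only [trueComponents, mem_filter, mem_univ, true_and]
    rw [count, count, Finset.card_eq_zero.2, Finset.card_eq_one.2]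
    · refine ⟨v, ?_⟩
      ext w
      simp only [mem_filter, mem_univ, true_and, mem_singleton]
      exact ⟨fun hw => h1 w hw.1, fun hw => by rw [hw]; exact ⟨rfl, hv⟩⟩
    · rw [Finset.filter_eq_empty_iff]
      rintro w - ⟨hw, hcw⟩
      rw [h1 w hw, hv] at hcw
      exact absurd hcw (by simp)
  rw [h] at h2
  exact Finset.notMem_empty _ h2

/-- A `true` block has rank 2 as soon as it has a neighbor. Without the hypothesis on components it
could be isolated, hence of rank 1, and the coloring would be lost. -/
theorem color_ofColoring {c : Block μ → Bool}
    (hc : IsAdmissible (P.blockGraph μ) (Lower μ) c)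
    (h : trueComponents (P.blockGraph μ) c = ∅) : (ofColoring c hc).color = c := by
  funext v
  cases hv : c v
  · rw [color_eq_false (rank_ofColoring_le hc), rank_ofColoring_of_false hc hv]
  · obtain ⟨w, hw⟩ := exists_adj_of_trueComponents h hv
    have h1 := hc.1 _ _ hw
    rw [hv] at h1
    have h2 : (ofColoring c hc).arrow v w := ⟨hw, hv, by simpa using h1.symm⟩
    exact (color_of_arrow (rank_ofColoring_le hc) h2).1

theorem sum_twoColumnHeaps {R : Type*} [Ring R] {g : Fin n → R} (hg : P.Satisfies g) {k l : ℕ}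
    (hcard : k + l = ∑ a, μ a) :
    ∑ H ∈ twoColumnHeaps P μ k l, (H.word.map g).prod =
      ∑ c ∈ falseColorings (P.blockGraph μ) (Lower μ) l, weight g (fun v : Block μ => v.1) c := by
  have hmem : ∀ H : Heap P μ, H ∈ twoColumnHeaps P μ k l ↔ H.IsTwoColumn k l := fun H => by
    simp [twoColumnHeaps]
  refine Finset.sum_bij' (fun H _ => H.color)
    (fun c hc => ofColoring c (mem_falseColorings.1 hc).1) ?_ ?_ ?_ ?_ ?_
  · intro H hH
    rw [hmem] at hH
    rw [mem_falseColorings]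
    exact ⟨isAdmissible_color hH.1, (isTwoColumn_iff hcard hH.1).1 hH⟩
  · intro c hc
    rw [mem_falseColorings] at hc
    rw [hmem, isTwoColumn_iff hcard (rank_ofColoring_le _), color_ofColoring hc.1 hc.2.2]
    exact hc.2
  · intro H hH
    rw [hmem] at hH
    ext v w
    exact (arrow_iff_color hH.1 v w).symm
  · intro c hc
    exact color_ofColoring _ (mem_falseColorings.1 hc).2.2
  · intro H hH
    rw [hmem] at hH
    exact prod_word hg hH.1

end Heap

/-! ### Products of two elementary functions as combinations of heap sums -/

namespace NatUnitIntervalOrder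

open Finset TwoColoring

variable {n : ℕ} {P : NatUnitIntervalOrder n} {R : Type*} [Ring R] {g : Fin n → R}

/-- Applied type by type, the exchange of the two colors gives commutativity; `coeff_chromatic`
needs it to reorder the color classes. -/
theorem elemIn_mul_comm (hg : P.Satisfies g) (k l : ℕ) :
    P.elemIn g k * P.elemIn g l = P.elemIn g l * P.elemIn g k := by
  rw [elemIn_mul_elemIn hg, elemIn_mul_elemIn hg, add_comm l k]
  refine Finset.sum_congr rfl fun μ hμ => ?_
  have hcard : Fintype.card (Block μ) = k + l := by
    rw [← (mem_piAntidiag.1 hμ).1]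
    simp
  rw [sum_colorings_comm (P.isIncGraph_blockGraph μ) hg Lower.ne_and_eq (by omega), hcard]
  rw [Nat.add_sub_cancel]

/-- The sum of the images of the words of the heaps in the theorem. -/
noncomputable def heapSumIn (P : NatUnitIntervalOrder n) (g : Fin n → R) (k l : ℕ) : R :=
  ∑ μ ∈ piAntidiag (univ : Finset (Fin n)) (k + l),
    ∑ H ∈ twoColumnHeaps P μ k l, (H.word.map g).prod

theorem elemIn_mul_elemIn_eq_sum (hg : P.Satisfies g) {d j : ℕ} (hj : j ≤ d) :
    P.elemIn g (d - j) * P.elemIn g j =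
      ∑ i ∈ range (j + 1), (d - 2 * i).choose (j - i) • P.heapSumIn g (d - i) i := by
  rw [elemIn_mul_elemIn hg]
  have h1 : ∀ i ∈ range (j + 1), d - i + i = d := fun i hi => by
    rw [Finset.mem_range] at hi
    omega
  rw [show d - j + j = d by omega]
  have h2 : ∑ i ∈ range (j + 1), (d - 2 * i).choose (j - i) • P.heapSumIn g (d - i) i =
      ∑ i ∈ range (j + 1), ∑ μ ∈ piAntidiag (univ : Finset (Fin n)) d,
        (d - 2 * i).choose (j - i) • ∑ H ∈ twoColumnHeaps P μ (d - i) i, (H.word.map g).prod :=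
    Finset.sum_congr rfl fun i hi => by rw [heapSumIn, h1 i hi, Finset.smul_sum]
  rw [h2, Finset.sum_comm]
  refine Finset.sum_congr rfl fun μ hμ => ?_
  have hcard : Fintype.card (Block μ) = d := by
    rw [← (mem_piAntidiag.1 hμ).1]
    simp
  rw [sum_colorings (P.isIncGraph_blockGraph μ) hg Lower.ne_and_eq, hcard]
  refine Finset.sum_congr rfl fun i hi => ?_
  rw [← Heap.sum_twoColumnHeaps (k := d - i) hg (by rw [h1 i hi, ← (mem_piAntidiag.1 hμ).1])]

end NatUnitIntervalOrder

/-! ### The congruence modulo the ideal -/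

namespace NatUnitIntervalOrder

open Finset TwoColoring SymTransition

variable {n : ℕ} (P : NatUnitIntervalOrder n)

theorem elem_zero : P.elem 0 = 1 := by
  classical
  rw [elem, Finset.filter_true_of_mem (by simp)]
  simp [u]

/-- The bound on `j` puts the parts in weakly decreasing order; omitted zero parts are harmless
because `e_0(u) = 1`. -/
theorem elemPart_twoParts {d j : ℕ} (h : 2 * j ≤ d) :
    P.elemPart (twoParts d j (by omega)) = P.elem (d - j) * P.elem j := by
  have h1 : (twoParts d j (by omega)).parts =
      Multiset.filter (fun i => i ≠ 0) (([d - j, j] : List ℕ) : Multiset ℕ) := rfl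
  rw [elemPart, h1, Multiset.filter_coe, Multiset.coe_sort]
  rcases Nat.eq_zero_or_pos j with rfl | hj
  · rcases Nat.eq_zero_or_pos d with rfl | hd
    · simp [elem_zero]
    · simp [elem_zero, hd.ne']
  · have h2 : [d - j, j].filter (fun i => i ≠ 0) = [d - j, j] := by
      rw [List.filter_eq_self]
      simp
      omega
    rw [h2, List.mergeSort_of_pairwise]
    · simp
    · simp
      omega

theorem sum_choose_smul_monomial {d j : ℕ} (h : 2 * j ≤ d) :
    ∑ i ∈ range (j + 1), (d - 2 * i).choose (j - i) • P.monomial (twosOnes d i) =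
      P.elem (d - j) * P.elem j := by
  classical
  rw [← elemPart_twoParts P h]
  simp only [monomial, Finset.smul_sum]
  rw [Finset.sum_comm]
  have h1 : ∀ nu : Nat.Partition d, ∑ i ∈ range (j + 1), (d - 2 * i).choose (j - i) •
      monomialToElem (twosOnes d i) nu • P.elemPart nu =
        (if nu = twoParts d j (by omega) then 1 else 0 : ℤ) • P.elemPart nu := by
    intro nu
    rw [← sum_choose_smul_monomialToElem h nu, Finset.sum_smul]
    refine Finset.sum_congr rfl fun i _ => ?_
    rw [mul_smul, natCast_zsmul]
  rw [Finset.sum_congr rfl fun nu _ => h1 nu]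
  simp

variable {P} {R : Type*} [Ring R] {f : FreeAlgebra ℤ (Fin n) →+* R}

theorem satisfies_of_map_ideal (hf : ∀ y ∈ P.ideal, f y = 0) :
    P.Satisfies fun a => f (FreeAlgebra.ι ℤ a) := by
  constructor
  · intro a c h
    have := hf _ (TwoSidedIdeal.subset_span (Or.inl ⟨a, c, h, rfl⟩))
    rw [map_sub, map_u, map_u, sub_eq_zero] at this
    simpa using this
  · intro a b c hab hbc h1 h2 h3
    have := hf _ (TwoSidedIdeal.subset_span (Or.inr ⟨a, b, c, hab, hbc, h1, h2, h3, rfl⟩))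
    rw [map_sub, map_u, map_u, sub_eq_zero] at this
    simpa [mul_assoc] using this

/-- The monomial functions and the heap sums solve the same linear system, whose diagonal
coefficients are `1`: the terms with `i < j` agree by induction and cancel. The general `f` serves
both the quotient by the ideal and `appendRep`. -/
theorem map_monomial_twosOnes (hf : ∀ y ∈ P.ideal, f y = 0) {d : ℕ} (j : ℕ) (hj : 2 * j ≤ d) :
    f (P.monomial (twosOnes d j)) =
      P.heapSumIn (fun a => f (FreeAlgebra.ι ℤ a)) (d - j) j := by
  induction j using Nat.strong_induction_on with
  | _ j ih =>
    have h1 := congrArg f (sum_choose_smul_monomial P hj)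
    rw [map_mul, map_elem, map_elem,
      elemIn_mul_elemIn_eq_sum (satisfies_of_map_ideal hf) (by omega : j ≤ d), map_sum,
      Finset.sum_range_succ, Finset.sum_range_succ, Nat.sub_self, Nat.choose_zero_right, one_smul,
      one_smul] at h1
    have h2 : ∑ i ∈ range j, f ((d - 2 * i).choose (j - i) • P.monomial (twosOnes d i)) =
        ∑ i ∈ range j, (d - 2 * i).choose (j - i) •
          P.heapSumIn (fun a => f (FreeAlgebra.ι ℤ a)) (d - i) i :=
      Finset.sum_congr rfl fun i hi => by
        rw [Finset.mem_range] at hi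
        rw [map_nsmul, ih i hi (by omega)]
    rw [h2] at h1
    exact add_left_cancel h1

theorem map_monomial_twoColumn (hf : ∀ y ∈ P.ideal, f y = 0) (k l : ℕ) (h : l ≤ k) :
    f (P.monomial (twoColumn k l h)) = f (∑ μ ∈ piAntidiag (univ : Finset (Fin n)) (k + l),
      ∑ H ∈ twoColumnHeaps P μ k l, u H.word) := by
  rw [twoColumn_eq_twosOnes, map_monomial_twosOnes hf l (by omega), Nat.add_sub_cancel]
  simp only [heapSumIn, map_sum, map_u]

theorem monomial_twoColumn_sub_mem (k l : ℕ) (h : l ≤ k) :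
    (P.monomial (twoColumn k l h) - ∑ μ ∈ piAntidiag (univ : Finset (Fin n)) (k + l),
      ∑ H ∈ twoColumnHeaps P μ k l, u H.word) ∈ P.ideal := by
  -- Membership in the ideal is vanishing in the quotient ring, so the preceding result is applied
  -- to the quotient map.
  have hker : ∀ y, y ∈ P.ideal ↔ P.ideal.ringCon.mk' y = 0 := fun y => by
    rw [← TwoSidedIdeal.mem_ker, TwoSidedIdeal.ker_ringCon_mk']
  rw [hker, map_sub, sub_eq_zero]
  exact map_monomial_twoColumn (fun y hy => (hker y).1 hy) k l h

end NatUnitIntervalOrder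

/-! ### A representation counting inversions -/

namespace NatUnitIntervalOrder

open Finset TwoColoring SymTransition Polynomial

variable {n : ℕ} (P : NatUnitIntervalOrder n)

open Classical in
/-- The number of inversions created by appending `b` to a word with multiplicities `ν`. -/
noncomputable def newInversions (b : Fin n) (ν : Fin n → ℕ) : ℕ :=
  ∑ a, if P.inc.Adj a b ∧ b < a then ν a else 0

open Classical in
theorem newInversions_add_single (a b : Fin n) (ν : Fin n → ℕ) :
    P.newInversions b (ν + Pi.single a 1) =
      P.newInversions b ν + if P.inc.Adj a b ∧ b < a then 1 else 0 := by
  have h : ∀ c, (if P.inc.Adj c b ∧ b < c then (ν + Pi.single a 1 : Fin n → ℕ) c else 0) =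
      (if P.inc.Adj c b ∧ b < c then ν c else 0) +
        if c = a then (if P.inc.Adj a b ∧ b < a then 1 else 0) else 0 := by
    intro c
    by_cases hc : c = a
    · subst hc
      simp only [Pi.add_apply, Pi.single_eq_same, if_true]
      split_ifs <;> rfl
    · simp [hc]
  simp only [newInversions, h]
  rw [Finset.sum_add_distrib, Finset.sum_ite_eq' univ a, if_pos (mem_univ a)]

/-- Appending the letter `a`, as an operator on functions of the multiplicities. -/
noncomputable def appendLetter (a : Fin n) : Module.End ℚ[X] ((Fin n → ℕ) → ℚ[X]) where
  toFun F ν := X ^ P.newInversions a ν * F (ν + Pi.single a 1)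
  map_add' F G := by
    funext ν
    simp [mul_add]
  map_smul' r F := by
    funext ν
    simp [mul_left_comm]

theorem appendLetter_apply (a : Fin n) (F : (Fin n → ℕ) → ℚ[X]) (ν : Fin n → ℕ) :
    P.appendLetter a F ν = X ^ P.newInversions a ν * F (ν + Pi.single a 1) := rfl

/-- Comparable letters create no inversions with each other. For `a < b < c` as in the second
relation, each of the words `a c b` and `b a c` has exactly one inversion, namely `c b` and `b a`.
-/
theorem satisfies_appendLetter : P.Satisfies P.appendLetter := by
  classical
  constructor
  · intro a c h
    have hac : ¬ P.inc.Adj a c := fun h' => h'.2.1 h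
    have hca : ¬ P.inc.Adj c a := fun h' => h'.2.2 h
    refine LinearMap.ext fun F => funext fun ν => ?_
    simp only [Module.End.mul_apply, appendLetter_apply, newInversions_add_single, hac, hca,
      false_and, if_false, add_zero]
    rw [add_right_comm]
    ring
  · intro a b c hab hbc h1 h2 h3
    have hac : ¬ P.inc.Adj a c := fun h' => h'.2.1 h3
    have hba' : ¬ P.lt b a := fun h => lt_asymm hab (lt_of_lt h)
    have hcb' : ¬ P.lt c b := fun h => lt_asymm hbc (lt_of_lt h)
    have hab' : P.inc.Adj a b := ⟨hab.ne, h1, hba'⟩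
    have hbc' : P.inc.Adj b c := ⟨hbc.ne, h2, hcb'⟩
    refine LinearMap.ext fun F => funext fun ν => ?_
    simp only [Module.End.mul_apply, appendLetter_apply, newInversions_add_single, hac, hab', hbc',
      hab'.symm, hbc'.symm, hab, hbc, lt_asymm hab, lt_asymm hbc, false_and, if_false, add_zero,
      and_self, if_true, and_false]
    rw [show ν + Pi.single a 1 + Pi.single c 1 + Pi.single b 1 =
      ν + Pi.single b 1 + Pi.single a 1 + Pi.single c 1 by abel]
    ring

/-- The representation of `ℤ⟨u_1, …, u_n⟩` by appending letters. -/
noncomputable def appendRep :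
    FreeAlgebra ℤ (Fin n) →+* Module.End ℚ[X] ((Fin n → ℕ) → ℚ[X]) :=
  (FreeAlgebra.lift ℤ P.appendLetter).toRingHom

theorem appendRep_ι (a : Fin n) : P.appendRep (FreeAlgebra.ι ℤ a) = P.appendLetter a := by
  simp [appendRep]

theorem appendRep_eq_zero {y : FreeAlgebra ℤ (Fin n)} (hy : y ∈ P.ideal) : P.appendRep y = 0 := by
  have h : P.ideal ≤ TwoSidedIdeal.ker P.appendRep := by
    rw [ideal, TwoSidedIdeal.span_le]
    have hs := P.satisfies_appendLetter
    rintro _ (⟨a, c, h, rfl⟩ | ⟨a, b, c, hab, hbc, h1, h2, h3, rfl⟩)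
    · rw [SetLike.mem_coe, TwoSidedIdeal.mem_ker, map_sub, map_u, map_u, sub_eq_zero]
      simpa [appendRep_ι] using hs.comm a c h
    · rw [SetLike.mem_coe, TwoSidedIdeal.mem_ker, map_sub, map_u, map_u, sub_eq_zero]
      simpa [appendRep_ι, mul_assoc] using hs.braid a b c hab hbc h1 h2 h3
  exact (TwoSidedIdeal.mem_ker _).1 (h hy)

open Classical in
/-- The number of pairs of positions of `w` with incomparable decreasing letters. -/
noncomputable def inversions : List (Fin n) → ℕ
  | [] => 0
  | a :: w => (w.map fun b => if P.inc.Adj a b ∧ b < a then 1 else 0).sum + inversions w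

/-- The leftmost operator shifts `ν` first, so the letters are appended from left to right; the
exponent adds the inversions with the earlier multiplicities `ν` to those inside `w`. -/
theorem prod_appendLetter_apply (w : List (Fin n)) (F : (Fin n → ℕ) → ℚ[X]) (ν : Fin n → ℕ) :
    (w.map P.appendLetter).prod F ν =
      X ^ ((w.map fun b => P.newInversions b ν).sum + P.inversions w) *
        F (ν + fun a => w.count a) := by
  classical
  induction w generalizing ν with
  | nil =>
    have : (ν + fun _ => 0) = ν := by
      funext a
      simp
    simp [inversions, this]
  | cons a w ih =>
    rw [List.map_cons, List.prod_cons, Module.End.mul_apply, appendLetter_apply, ih, ← mul_assoc,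
      ← pow_add]
    have h1 : ν + Pi.single a 1 + (fun b => w.count b) = ν + fun b => (a :: w).count b := by
      funext b
      simp only [Pi.add_apply, List.count_cons, Pi.single_apply, beq_iff_eq, eq_comm (a := a)]
      omega
    rw [h1]
    congr 2
    simp only [newInversions_add_single, inversions, List.map_cons, List.sum_cons,
      List.sum_map_add]
    ring

theorem inversions_ofFn {N : ℕ} (y : Fin N → Fin n) [DecidableRel P.inc.Adj] :
    P.inversions (List.ofFn y) =
      ∑ i, ∑ j, if i < j ∧ P.inc.Adj (y i) (y j) ∧ y j < y i then 1 else 0 := by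
  induction N with
  | zero => simp [inversions]
  | succ N ih =>
    rw [List.ofFn_succ, inversions, ih, Fin.sum_univ_succ]
    congr 1
    · rw [List.map_ofFn, List.sum_ofFn, Fin.sum_univ_succ]
      simp only [lt_irrefl, false_and, if_false, zero_add, Fin.succ_pos, true_and]
      refine Finset.sum_congr rfl fun i _ => ?_
      simp only [Function.comp]
      congr
    · refine Finset.sum_congr rfl fun i _ => ?_
      rw [Fin.sum_univ_succ]
      simp

theorem inversions_eq_zero {w : List (Fin n)} (h : w.Pairwise fun a b => ¬ P.inc.Adj a b) :
    P.inversions w = 0 := by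
  induction w with
  | nil => rfl
  | cons a w ih =>
    rw [List.pairwise_cons] at h
    rw [inversions, ih h.2, add_zero]
    refine List.sum_eq_zero fun y hy => ?_
    obtain ⟨b, hb, rfl⟩ := List.mem_map.1 hy
    rw [if_neg fun h' => h.1 b hb h'.1]

/-- In a linear extension the target of an arrow precedes its source, so an inversion is an arrow
whose target has the larger letter. -/
theorem inversions_word {μ : Fin n → ℕ} (H : Heap P μ) : P.inversions H.word = H.asc := by
  classical
  obtain ⟨f, hf, hw⟩ := H.existsUnique_word.choose_spec.1.1
  rw [Heap.word, hw, Heap.wordOf, inversions_ofFn, Heap.asc, Finset.card_filter,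
    Fintype.sum_prod_type_right]
  rw [← Equiv.sum_comp f]
  refine Finset.sum_congr rfl fun v _ => ?_
  rw [← Equiv.sum_comp f]
  refine Finset.sum_congr rfl fun w _ => ?_
  refine if_congr ?_ rfl rfl
  simp only [Equiv.symm_apply_apply]
  constructor
  · rintro ⟨h1, h2, h3⟩
    refine ⟨?_, h3⟩
    rcases H.arrow_or_arrow v w ⟨fun h => lt_irrefl _ (h ▸ h1), Or.inr h2⟩ with h | h
    · exact absurd h1 (lt_asymm (hf _ _ h))
    · exact h
  · rintro ⟨h1, h2⟩
    refine ⟨hf _ _ h1, ?_, h2⟩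
    exact ((H.adj_of_arrow _ _ h1).2.resolve_left h2.ne).symm

theorem count_word {μ : Fin n → ℕ} (H : Heap P μ) (a : Fin n) : H.word.count a = μ a := by
  classical
  obtain ⟨f, hf, hw⟩ := H.existsUnique_word.choose_spec.1.1
  rw [Heap.word, hw, Heap.wordOf, ← Multiset.coe_count, ← Fin.univ_val_map, Multiset.count_map,
    ← Finset.filter_val, Finset.card_val]
  have h1 : (univ.filter fun k => a = (f.symm k).1).card = (univ : Finset (Fin (μ a))).card := by
    symm
    refine Finset.card_bij (fun i _ => f ⟨a, i⟩) (by simp) (fun i _ j _ h => by simpa using h) ?_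
    intro k hk
    obtain ⟨v, rfl⟩ := f.surjective k
    simp only [mem_filter, Equiv.symm_apply_apply] at hk
    obtain ⟨b, i⟩ := v
    obtain rfl : a = b := hk.2
    exact ⟨i, mem_univ _, rfl⟩
  rw [h1]
  simp

/-- The sum of `q^{inv(w)}` over the words `w` of type `μ` in a noncommutative polynomial. -/
noncomputable def typeCoeff (μ : Fin n → ℕ) : FreeAlgebra ℤ (Fin n) →+ ℚ[X] where
  -- Evaluation at `0` starts from the empty word, and the indicator of `μ` keeps only the words of
  -- type `μ`.
  toFun y := P.appendRep y (Pi.single μ 1) 0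
  map_zero' := by simp
  map_add' y z := by simp

theorem typeCoeff_apply (μ : Fin n → ℕ) (y : FreeAlgebra ℤ (Fin n)) :
    P.typeCoeff μ y = P.appendRep y (Pi.single μ 1) 0 := rfl

theorem typeCoeff_word (μ : Fin n → ℕ) {ν : Fin n → ℕ} (H : Heap P ν) :
    P.typeCoeff μ (u H.word) = if ν = μ then X ^ H.asc else 0 := by
  classical
  rw [typeCoeff_apply, map_u]
  simp only [appendRep_ι]
  rw [prod_appendLetter_apply, inversions_word]
  have h1 : ((0 : Fin n → ℕ) + fun a => H.word.count a) = ν := by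
    funext a
    simp [count_word]
  have h2 : ∀ b, P.newInversions b 0 = 0 := fun b => by simp [newInversions]
  rw [h1]
  simp only [h2, List.map_const', List.sum_replicate, smul_zero, zero_add, Pi.single_apply]
  split_ifs <;> simp

theorem typeCoeff_monomial_twoColumn (μ : Fin n → ℕ) (k l : ℕ) (h : l ≤ k) :
    P.typeCoeff μ (P.monomial (twoColumn k l h)) = ∑ H ∈ twoColumnHeaps P μ k l, X ^ H.asc := by
  classical
  rw [typeCoeff_apply, map_monomial_twoColumn (fun y hy => P.appendRep_eq_zero hy),
    ← typeCoeff_apply]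
  simp only [map_sum, typeCoeff_word]
  by_cases hμ : ∑ a, μ a = k + l
  · rw [Finset.sum_eq_single μ]
    · simp
    · intro ν _ hν
      simp [hν]
    · intro h1
      exact absurd (mem_piAntidiag.2 ⟨hμ, fun _ _ => mem_univ _⟩) h1
  -- If `μ` does not have `k + l` blocks, both sides vanish.
  · have h1 : twoColumnHeaps P μ k l = ∅ := by
      rw [Finset.eq_empty_iff_forall_notMem]
      intro H hH
      apply hμ
      simp only [twoColumnHeaps, mem_filter, mem_univ, true_and] at hH
      obtain ⟨h2, h3, h4, -⟩ := hH
      have h5 := Finset.card_filter_add_card_filter_not (s := (univ : Finset (Block μ)))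
        (fun v => H.rank v = 1)
      have h6 : (univ.filter fun v => ¬ H.rank v = 1) = univ.filter fun v => H.rank v = 2 := by
        refine Finset.filter_congr fun v _ => ?_
        have := h2 v
        have := H.one_le_rank v
        omega
      have h7 : (univ : Finset (Block μ)).card = ∑ a, μ a := by simp
      rw [← h7, ← h5, h6, ← h3, ← h4]
    rw [h1, Finset.sum_empty]
    refine Finset.sum_eq_zero fun ν hν => ?_
    have h2 : ν ≠ μ := by
      rintro rfl
      exact hμ (mem_piAntidiag.1 hν).1
    simp [h2]

end NatUnitIntervalOrder

/-! ### Coefficients of the chromatic quasisymmetric function -/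

namespace MultiColoring

open Finset NatUnitIntervalOrder Polynomial

variable {n : ℕ}

open Classical in
/-- The proper multi-colorings of arbitrary type with `x^κ = x^α`. -/
noncomputable def properWithContent (G : SimpleGraph (Fin n)) (α : ℕ →₀ ℕ) :
    Finset (Fin n → Finset ℕ) :=
  (Fintype.piFinset fun _ => α.support.powerset).filter fun κ =>
    (∀ i j, G.Adj i j → Disjoint (κ i) (κ j)) ∧ content κ = α

theorem mem_properWithContent {G : SimpleGraph (Fin n)} {α : ℕ →₀ ℕ} {κ : Fin n → Finset ℕ} :
    κ ∈ properWithContent G α ↔ (∀ i j, G.Adj i j → Disjoint (κ i) (κ j)) ∧ content κ = α := by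
  classical
  rw [properWithContent, mem_filter, and_iff_right_iff_imp]
  rintro ⟨h1, h2⟩
  have h3 : κ ∈ withContent G (fun i => (κ i).card) α :=
    (mem_withContent _ _ _ _).2 ⟨⟨fun _ => rfl, h1⟩, h2⟩
  rw [withContent, mem_filter] at h3
  exact h3.1

theorem mem_withContent_iff {G : SimpleGraph (Fin n)} {μ : Fin n → ℕ} {α : ℕ →₀ ℕ}
    {κ : Fin n → Finset ℕ} : κ ∈ withContent G μ α ↔
      κ ∈ properWithContent G α ∧ (fun i => (κ i).card) = μ := by
  rw [mem_withContent, mem_properWithContent, IsProper, funext_iff]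
  tauto

theorem content_apply (κ : Fin n → Finset ℕ) (c : ℕ) :
    content κ c = (univ.filter fun i => c ∈ κ i).card := by
  classical
  rw [content, Finsupp.finsetSum_apply, Finset.card_filter]
  refine Finset.sum_congr rfl fun i _ => ?_
  rw [Finsupp.finsetSum_apply]
  simp [Finsupp.single_apply]

theorem mem_support_of_mem {κ : Fin n → Finset ℕ} {i : Fin n} {c : ℕ} (h : c ∈ κ i) :
    c ∈ (content κ).support := by
  rw [Finsupp.mem_support_iff, content_apply]
  exact (Finset.card_pos.2 ⟨i, by simpa using h⟩).ne'

/-- Add the color `r` to the vertices in `S`. -/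
def addColor (r : ℕ) (S : Finset (Fin n)) (κ : Fin n → Finset ℕ) (i : Fin n) : Finset ℕ :=
  if i ∈ S then insert r (κ i) else κ i

theorem content_addColor {r : ℕ} {S : Finset (Fin n)} {κ : Fin n → Finset ℕ}
    (hr : ∀ i, r ∉ κ i) : content (addColor r S κ) = (content κ).update r S.card := by
  classical
  ext c
  rw [content_apply, Finsupp.update_apply]
  split_ifs with hc
  · subst hc
    congr 1
    ext i
    rw [mem_filter, addColor]
    split_ifs with h
    · simp [h]
    · simp [h, hr i]
  · rw [content_apply]
    congr 1
    refine Finset.filter_congr fun i _ => ?_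
    rw [addColor]
    split_ifs
    · rw [mem_insert, or_iff_right hc]
    · rfl

theorem card_filter_lt_product (A B : Finset ℕ) :
    ((A ×ˢ B).filter fun c => c.1 < c.2).card = ∑ s ∈ A, (B.filter fun t => s < t).card := by
  rw [Finset.card_filter, Finset.sum_product]
  refine Finset.sum_congr rfl fun s _ => ?_
  rw [Finset.card_filter]

/-- Since `r` is below all colors in use, each new pair `(b, r)` forms an ascent with every `(a, s)`
such that `a` is adjacent to `b` and `b < a`, and no others arise. -/
theorem asc_addColor (P : NatUnitIntervalOrder n) {r : ℕ} {S : Finset (Fin n)}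
    {κ : Fin n → Finset ℕ} (hr : ∀ i, ∀ s ∈ κ i, r < s) :
    asc P.inc (addColor r S κ) =
      asc P.inc κ + ∑ b ∈ S, P.newInversions b fun i => (κ i).card := by
  classical
  have hr' : ∀ i, r ∉ κ i := fun i h => lt_irrefl _ (hr i r h)
  have h1 : ∀ i s, r ≤ s → ((addColor r S κ i).filter fun t => s < t) =
      (κ i).filter fun t => s < t := by
    intro i s hs
    rw [addColor]
    split_ifs
    · rw [Finset.filter_insert, if_neg (not_lt.2 hs)]
    · rfl
  have h2 : ∀ i j, ((addColor r S κ i ×ˢ addColor r S κ j).filter fun c => c.1 < c.2).card =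
      ((κ i ×ˢ κ j).filter fun c => c.1 < c.2).card + if i ∈ S then (κ j).card else 0 := by
    intro i j
    rw [card_filter_lt_product, card_filter_lt_product]
    have h3 : ∑ s ∈ κ i, ((addColor r S κ j).filter fun t => s < t).card =
        ∑ s ∈ κ i, ((κ j).filter fun t => s < t).card :=
      Finset.sum_congr rfl fun s hs => by rw [h1 j s (hr i s hs).le]
    by_cases hi : i ∈ S
    · rw [if_pos hi, addColor, if_pos hi, Finset.sum_insert (hr' i), h1 j r le_rfl, h3, add_comm,
        Finset.filter_true_of_mem (hr j)]
    · rw [if_neg hi, add_zero]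
      nth_rewrite 1 [addColor]
      rw [if_neg hi, h3]
  rw [asc, asc]
  simp only [h2]
  rw [Finset.sum_add_distrib]
  congr 1
  rw [Finset.sum_filter, Fintype.sum_prod_type, ← Finset.sum_subset (Finset.subset_univ S)]
  · refine Finset.sum_congr rfl fun b hb => ?_
    rw [newInversions]
    refine Finset.sum_congr rfl fun a _ => ?_
    simp only [hb, if_true, P.inc.adj_comm a b]
  · intro b _ hb
    simp [hb]

theorem elemIn_appendLetter_apply (P : NatUnitIntervalOrder n) (k : ℕ)
    (F : (Fin n → ℕ) → ℚ[X]) (ν : Fin n → ℕ) : P.elemIn P.appendLetter k F ν =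
      ∑ S ∈ P.chainSets k, X ^ (∑ b ∈ S, P.newInversions b ν) *
        F (ν + fun a => if a ∈ S then 1 else 0) := by
  classical
  rw [elemIn, LinearMap.sum_apply, Finset.sum_apply]
  refine Finset.sum_congr rfl fun S hS => ?_
  rw [prod_appendLetter_apply, inversions_eq_zero, add_zero]
  · congr 2
    · rw [← List.sum_toFinset _ (Finset.sort_nodup _ _), Finset.sort_toFinset]
    · congr 1
      funext a
      rw [List.Nodup.count (Finset.sort_nodup _ _)]
      simp
  · refine List.Pairwise.imp_of_mem ?_ (Finset.sortedGT_sort S).pairwise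
    intro a b ha hb hab h
    rcases ((P.mem_chainSets).1 hS).2 (by simpa using ha) (by simpa using hb) hab.ne' with h' | h'
    · exact h.2.1 h'
    · exact h.2.2 h'

/-- A proper multi-coloring is a sequence of color classes, each a chain of `P`. They are appended
from the largest color down, so that ascents of the coloring become inversions of the word. -/
theorem prod_elemIn_apply (P : NatUnitIntervalOrder n) (L : List ℕ) (hL : L.Pairwise (· < ·))
    (α : ℕ →₀ ℕ) (hα : L.toFinset = α.support) (F : (Fin n → ℕ) → ℚ[X]) :
    (L.reverse.map fun r => P.elemIn P.appendLetter (α r)).prod F 0 =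
      ∑ κ ∈ properWithContent P.inc α, X ^ asc P.inc κ * F fun i => (κ i).card := by
  classical
  induction L generalizing α F with
  | nil =>
    have h0 : α = 0 := by
      rw [← Finsupp.support_eq_empty, ← hα]
      rfl
    subst h0
    have h1 : properWithContent P.inc 0 = {fun _ => ∅} := by
      ext κ
      rw [mem_properWithContent, mem_singleton]
      constructor
      · rintro ⟨-, h⟩
        funext i
        rw [Finset.eq_empty_iff_forall_notMem]
        intro c hc
        have := mem_support_of_mem hc
        rw [h] at this
        simp at this
      · rintro rfl
        exact ⟨fun _ _ _ => by simp, by simp [content]⟩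
    rw [h1, Finset.sum_singleton]
    simp [asc]
    rfl
  | cons r L ih =>
    rw [List.pairwise_cons] at hL
    have hrL : r ∉ L := fun h => lt_irrefl _ (hL.1 r h)
    have hα' : L.toFinset = (α.erase r).support := by
      rw [Finsupp.support_erase, ← hα, List.toFinset_cons, Finset.erase_insert (by simpa using hrL)]
    have hlt : ∀ κ ∈ properWithContent P.inc (α.erase r), ∀ i, ∀ s ∈ κ i, r < s := by
      intro κ hκ i s hs
      have := mem_support_of_mem hs
      rw [(mem_properWithContent.1 hκ).2, ← hα'] at this
      exact hL.1 s (by simpa using this)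
    have h1 : (L.reverse.map fun s => P.elemIn P.appendLetter (α s)) =
        L.reverse.map fun s => P.elemIn P.appendLetter (α.erase r s) := by
      refine List.map_congr_left fun s hs => ?_
      rw [Finsupp.erase_ne]
      rintro rfl
      exact hrL (by simpa using hs)
    -- The factor of the smallest color `r` comes last and is absorbed into `F`; the induction
    -- hypothesis then handles the larger colors.
    rw [List.reverse_cons, List.map_append, List.prod_append, h1, List.map_singleton,
      List.prod_singleton, Module.End.mul_apply, ih hL.2 _ hα']
    simp only [elemIn_appendLetter_apply, Finset.mul_sum]
    rw [← Finset.sum_product']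
    refine Finset.sum_bij' (fun p _ => addColor r p.2 p.1)
      (fun κ _ => (fun i => (κ i).erase r, univ.filter fun i => r ∈ κ i)) ?_ ?_ ?_ ?_ ?_
    · rintro ⟨κ, S⟩ h
      rw [mem_product] at h
      obtain ⟨hκ, hS⟩ := h
      simp only at hκ hS ⊢
      have hr := hlt κ hκ
      have hr' : ∀ i, r ∉ κ i := fun i h => lt_irrefl _ (hr i r h)
      rw [mem_properWithContent] at hκ ⊢
      rw [mem_chainSets] at hS
      refine ⟨fun i j hij => ?_, ?_⟩
      · have hd := hκ.1 i j hij
        have hn : ¬ (i ∈ S ∧ j ∈ S) := by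
          rintro ⟨hi, hj⟩
          rcases hS.2 hi hj hij.1 with h | h
          · exact hij.2.1 h
          · exact hij.2.2 h
        rw [addColor, addColor]
        split_ifs with h2 h3 h3
        · exact absurd ⟨h2, h3⟩ hn
        · rw [Finset.disjoint_insert_left]
          exact ⟨hr' j, hd⟩
        · rw [Finset.disjoint_insert_right]
          exact ⟨hr' i, hd⟩
        · exact hd
      · rw [content_addColor hr', hκ.2, hS.1]
        ext c
        rw [Finsupp.update_apply]
        split_ifs with hc
        · rw [hc]
        · exact Finsupp.erase_ne hc
    · intro κ hκ
      rw [mem_properWithContent] at hκ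
      rw [mem_product, mem_properWithContent, mem_chainSets]
      refine ⟨⟨fun i j hij => ?_, ?_⟩, ?_, ?_⟩
      · exact (hκ.1 i j hij).mono (Finset.erase_subset _ _) (Finset.erase_subset _ _)
      · ext c
        rw [content_apply]
        by_cases hc : c = r
        · subst hc
          simp
        · rw [Finsupp.erase_ne hc, ← hκ.2, content_apply]
          congr 1
          refine Finset.filter_congr fun i _ => ?_
          simp [hc]
      · rw [← hκ.2, content_apply]
      · intro i hi j hj hij
        simp only [coe_filter, mem_univ, true_and, Set.mem_ofPred_eq] at hi hj
        by_contra hn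
        rw [not_or] at hn
        exact Finset.disjoint_left.1 (hκ.1 i j ⟨hij, hn⟩) hi hj
    · rintro ⟨κ, S⟩ h
      rw [mem_product] at h
      have hr' : ∀ i, r ∉ κ i := fun i h' => lt_irrefl _ (hlt κ h.1 i r h')
      ext1
      · funext i
        simp only [addColor]
        split_ifs
        · rw [Finset.erase_insert (hr' i)]
        · rw [Finset.erase_eq_of_notMem (hr' i)]
      · ext i
        simp only [addColor, mem_filter, mem_univ, true_and]
        split_ifs with h2
        · simp [h2]
        · simp [h2, hr' i]
    · intro κ hκ
      funext i
      simp only [addColor, mem_filter, mem_univ, true_and]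
      split_ifs with h2
      · rw [Finset.insert_erase h2]
      · rw [Finset.erase_eq_of_notMem h2]
    · rintro ⟨κ, S⟩ h
      rw [mem_product] at h
      have hr := hlt κ h.1
      have hr' : ∀ i, r ∉ κ i := fun i h' => lt_irrefl _ (hr i r h')
      simp only
      rw [asc_addColor P hr, pow_add, mul_assoc]
      congr 3
      funext i
      simp only [Pi.add_apply, addColor]
      split_ifs
      · rw [Finset.card_insert_of_notMem (hr' i)]
      · rfl

end MultiColoring

/-! ### Elementary expansion of the chromatic function -/

namespace NatUnitIntervalOrder

open Finset SymTransition Polynomial MultiColoring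

variable {n : ℕ} (P : NatUnitIntervalOrder n)

/-- The color classes come in decreasing order of the colors, the factors of `e_λ(u)` in decreasing
order of size; the images of the elementary functions commute. -/
theorem coeff_chromatic (μ : Fin n → ℕ) {d : ℕ} {lam : Nat.Partition d} {α : ℕ →₀ ℕ}
    (h : HasShape α lam) :
    MvPowerSeries.coeff α (chromatic P.inc μ) = P.typeCoeff μ (P.elemPart lam) := by
  classical
  have h1 : MvPowerSeries.coeff α (chromatic P.inc μ) =
      ∑ κ ∈ properWithContent P.inc α,
        X ^ asc P.inc κ * (Pi.single μ 1 : (Fin n → ℕ) → ℚ[X]) fun i => (κ i).card := by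
    change ∑ κ ∈ withContent P.inc μ α, _ = _
    have h2 : withContent P.inc μ α =
        (properWithContent P.inc α).filter fun κ => (fun i => (κ i).card) = μ := by
      ext κ
      rw [mem_withContent_iff, mem_filter]
    rw [h2, Finset.sum_filter]
    refine Finset.sum_congr rfl fun κ _ => ?_
    rw [Pi.single_apply]
    split_ifs <;> simp
  rw [h1, ← prod_elemIn_apply P (α.support.sort (· ≤ ·)) (Finset.sortedLT_sort _).pairwise α
    (Finset.sort_toFinset _ _), typeCoeff_apply, elemPart, map_list_prod, List.map_map]
  have h3 : (⇑P.appendRep ∘ P.elem) = P.elemIn P.appendLetter := by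
    funext k
    rw [Function.comp, map_elem]
    simp only [appendRep_ι]
  have h4 : ((α.support.sort (· ≤ ·)).reverse.map α).Perm (lam.parts.sort (· ≥ ·)) := by
    rw [← Multiset.coe_eq_coe, Multiset.sort_eq, ← h, ← Multiset.map_coe,
      Multiset.coe_eq_coe.2 (List.reverse_perm _), Finset.sort_eq]
  have h5 := h4.map (P.elemIn P.appendLetter)
  rw [List.map_map] at h5
  rw [h3, ← h5.prod_eq']
  · rfl
  · rw [List.pairwise_map]
    exact List.pairwise_of_forall fun a b => elemIn_mul_comm P.satisfies_appendLetter _ _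

theorem coeff_chromatic_of_degree_ne (μ : Fin n → ℕ) {α : ℕ →₀ ℕ} (h : α.degree ≠ ∑ a, μ a) :
    MvPowerSeries.coeff α (chromatic P.inc μ) = 0 := by
  change ∑ κ ∈ withContent P.inc μ α, _ = _
  refine Finset.sum_eq_zero fun κ hκ => ?_
  rw [mem_withContent] at hκ
  exfalso
  apply h
  rw [← hκ.2, MultiColoring.content, map_sum]
  refine Finset.sum_congr rfl fun a _ => ?_
  rw [map_sum, ← hκ.1.1 a]
  simp

theorem typeCoeff_monomial (μ : Fin n → ℕ) {d : ℕ} (lam : Nat.Partition d) :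
    P.typeCoeff μ (P.monomial lam) =
      ∑ nu, ((monomialToElem lam nu : ℤ) : ℚ[X]) * P.typeCoeff μ (P.elemPart nu) := by
  rw [monomial, map_sum]
  refine Finset.sum_congr rfl fun nu _ => ?_
  rw [map_zsmul, zsmul_eq_mul]

/-- Isolates the part of degree `d` of an expansion that may involve partitions of several sizes. -/
theorem sum_sigma_eq {K : Type*} [AddCommMonoid K] (c : (Σ d : ℕ, Nat.Partition d) →₀ ℚ[X]) (d : ℕ)
    (F : (Σ d : ℕ, Nat.Partition d) → ℚ[X] → K) (h0 : ∀ s, F s 0 = 0)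
    (hd : ∀ s a, s.1 ≠ d → F s a = 0) :
    c.sum F = ∑ lam : Nat.Partition d, F ⟨d, lam⟩ (c ⟨d, lam⟩) := by
  classical
  refine Eq.trans ?_ (Finset.sum_map (univ : Finset (Nat.Partition d))
    (Function.Embedding.sigmaMk d) (fun s => F s (c s)))
  rw [Finsupp.sum,
    Finset.sum_subset (Finset.subset_union_left (s₂ := univ.map (Function.Embedding.sigmaMk d)))]
  · symm
    refine Finset.sum_subset Finset.subset_union_right fun s _ hs => ?_
    apply hd
    rintro rfl
    exact hs (Finset.mem_map.2 ⟨s.2, mem_univ _, rfl⟩)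
  · intro s _ hs
    rw [Finsupp.notMem_support_iff.1 hs, h0]

/-- Comparing coefficients at an exponent of shape `rho` expresses the value at `e_rho(u)` through
`c` and the transition matrix. Applying the inverse matrix, with symmetry to match the indices,
isolates one coefficient. -/
theorem eq_typeCoeff_monomial (μ : Fin n → ℕ) (c : (Σ d : ℕ, Nat.Partition d) →₀ ℚ[X])
    (hc : chromatic P.inc μ = c.sum fun lam a => a • elemSymPart ℚ[X] lam.2) {d : ℕ}
    (nu : Nat.Partition d) : c ⟨d, nu⟩ = P.typeCoeff μ (P.monomial nu) := by
  classical
  have h1 : ∀ rho : Nat.Partition d, P.typeCoeff μ (P.elemPart rho) =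
      ∑ lam : Nat.Partition d, c ⟨d, lam⟩ * ((elemToMonomial lam rho : ℤ) : ℚ[X]) := by
    intro rho
    rw [← coeff_chromatic P μ (hasShape_exponent rho), hc, Finsupp.sum, map_sum]
    have h2 := sum_sigma_eq c d (fun s a => a *
      MvPowerSeries.coeff (exponent rho) (elemSymPart ℚ[X] s.2)) (by simp) (fun s a hs => by
        rw [coeff_elemSymPart_of_degree_ne, mul_zero]
        rw [SymAux.degree_of_shape rho _ (hasShape_exponent rho)]
        exact hs.symm)
    simp only [coeff_elemSymPart ℚ[X] _ rho (hasShape_exponent rho)] at h2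
    rw [← h2, Finsupp.sum]
    simp
  rw [typeCoeff_monomial]
  simp only [h1, Finset.mul_sum]
  rw [Finset.sum_comm]
  have h3 : ∀ lam : Nat.Partition d, ∑ rho, ((monomialToElem nu rho : ℤ) : ℚ[X]) *
      (c ⟨d, lam⟩ * ((elemToMonomial lam rho : ℤ) : ℚ[X])) =
        c ⟨d, lam⟩ * (((1 : Matrix (Nat.Partition d) (Nat.Partition d) ℤ) nu lam : ℤ) : ℚ[X]) := by
    intro lam
    rw [← monomialToElem_mul_elemToMonomial, Matrix.mul_apply, Int.cast_sum, Finset.mul_sum]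
    refine Finset.sum_congr rfl fun rho _ => ?_
    rw [Int.cast_mul, elemToMonomial_comm lam rho, Matrix.of_apply]
    ring
  rw [Finset.sum_congr rfl fun lam _ => h3 lam]
  simp [Matrix.one_apply]

theorem exists_expansion (μ : Fin n → ℕ) : ∃ c : (Σ d : ℕ, Nat.Partition d) →₀ ℚ[X],
    chromatic P.inc μ = c.sum fun lam a => a • elemSymPart ℚ[X] lam.2 := by
  classical
  -- These are the only possible coefficients, by `eq_typeCoeff_monomial`; the chromatic function is
  -- homogeneous of degree `∑ a, μ a`, so other sizes are not needed.
  refine ⟨∑ lam : Nat.Partition (∑ a, μ a), Finsupp.single ⟨_, lam⟩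
    (P.typeCoeff μ (P.monomial lam)), ?_⟩
  change _ = Finsupp.linearCombination ℚ[X]
    (fun s : Σ d : ℕ, Nat.Partition d => elemSymPart ℚ[X] s.2) _
  rw [map_sum]
  simp only [Finsupp.linearCombination_single]
  ext1 α
  rw [map_sum]
  by_cases hα : α.degree = ∑ a, μ a
  · obtain ⟨sh, hsh⟩ : ∃ sh : Nat.Partition (∑ a, μ a), HasShape α sh := hα ▸ exists_shape α
    simp only [map_smul, smul_eq_mul, coeff_elemSymPart ℚ[X] _ sh hsh, typeCoeff_monomial,
      Finset.sum_mul, coeff_chromatic P μ hsh]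
    rw [Finset.sum_comm]
    have h3 : ∀ rho : Nat.Partition (∑ a, μ a), ∑ lam : Nat.Partition (∑ a, μ a),
        ((monomialToElem lam rho : ℤ) : ℚ[X]) * P.typeCoeff μ (P.elemPart rho) *
          ((elemToMonomial lam sh : ℤ) : ℚ[X]) = P.typeCoeff μ (P.elemPart rho) *
            (((1 : Matrix (Nat.Partition (∑ a, μ a)) (Nat.Partition (∑ a, μ a)) ℤ)
              sh rho : ℤ) : ℚ[X]) := by
      intro rho
      rw [← elemToMonomial_mul_monomialToElem, Matrix.mul_apply, Int.cast_sum, Finset.mul_sum]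
      refine Finset.sum_congr rfl fun lam _ => ?_
      rw [Int.cast_mul, elemToMonomial_comm lam sh, Matrix.of_apply]
      ring
    rw [Finset.sum_congr rfl fun rho _ => h3 rho]
    simp [Matrix.one_apply]
  · rw [coeff_chromatic_of_degree_ne P μ hα]
    symm
    refine Finset.sum_eq_zero fun lam _ => ?_
    rw [map_smul, coeff_elemSymPart_of_degree_ne _ _ hα, smul_zero]

end NatUnitIntervalOrder

theorem mainTheorem5 {n : ℕ} (P : NatUnitIntervalOrder n) :
    (∀ (k l : ℕ) (h : l ≤ k),
      (P.monomial (twoColumn k l h) -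
        ∑ μ ∈ Finset.piAntidiag (Finset.univ : Finset (Fin n)) (k + l),
          ∑ H ∈ twoColumnHeaps P μ k l, NatUnitIntervalOrder.u H.word) ∈ P.ideal) ∧
    ∀ μ : Fin n → ℕ,
      (∃ c : (Σ d : ℕ, Nat.Partition d) →₀ Polynomial ℚ,
        chromatic P.inc μ = c.sum fun lam a => a • elemSymPart (Polynomial ℚ) lam.2) ∧
      ∀ c : (Σ d : ℕ, Nat.Partition d) →₀ Polynomial ℚ,
        chromatic P.inc μ = (c.sum fun lam a => a • elemSymPart (Polynomial ℚ) lam.2) →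
        ∀ (k l : ℕ) (h : l ≤ k),
          c ⟨k + l, twoColumn k l h⟩ =
            ∑ H ∈ twoColumnHeaps P μ k l, (Polynomial.X : Polynomial ℚ) ^ H.asc := by
  refine ⟨fun k l h => P.monomial_twoColumn_sub_mem k l h, fun μ => ⟨P.exists_expansion μ, ?_⟩⟩
  intro c hc k l h
  rw [P.eq_typeCoeff_monomial μ c hc, P.typeCoeff_monomial_twoColumn]
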